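/- Let $W$ be a finite Coxeter group with set $S$ of simple reflections, let $\mathcal R=\{wsw^{-1} : w\in W, s\in S\}$ be its set of reflections, and for $s,t\in S$ let $m_{st}$ be the order of $st$. Let $\mathcal W$ be the set of reflection subgroups of $W$ (the subgroups generated by a subset of $\mathcal R$, including the trivial one). For a commutative ring $\mathbf k$ and parameters $\underline u=(u_s)_{s\in S}\in\mathbf k^S$ with $u_s=u_{s'}$ whenever $s,s'$ are conjugate in $W$, let $\mathcal C_W(\underline u)$ be the associative unital $\mathbf k$-algebra with generators $g_s$ $(s\in S)$, $e_t$ $(t\in\mathcal R)$ and relations 1. $\underbrace{g_sg_tg_s\cdots}_{m_{st}}=\underbrace{g_tg_sg_t\cdots}_{m_{st}}$ for $s,t\in S$; 2. $e_t^2=e_t$ for $t\in\mathcal R$; 3. $e_{t}e_{t_1}=e_{t_1}e_{t}$ for $t,t_1\in\mathcal R$; 4. $e_te_{t_1}=e_te_{tt_1t^{-1}}$ for $t,t_1\in\mathcal R$; 5. $g_se_t=e_{sts}g_s$ for $s\in S$, $t\in\mathcal R$; 6. $g_s^2=1+(u_s-1)e_s(1+g_s)$ for $s\in S$. Write $\mathcal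 C_W(1)$ for the case where all $u_s=1$. Let $\mathbf k^{\mathcal W}$ be the algebra of functions $\mathcal W\to\mathbf k$ with pointwise operations, on which $W$ acts by $(w\cdot f)(W_0)=f(w^{-1}W_0w)$, and let $\mathbf k^{\mathcal W}\rtimes\mathbf kW$ be the corresponding semidirect product (skew group) algebra. An algebra over a field is called split semisimple if it is isomorphic to a finite direct product of full matrix algebras over that field. **Theorem.** For every commutative ring $\mathbf k$, $\mathcal C_W(1)\simeq\mathbf k^{\mathcal W}\rtimes\mathbf kW$ as $\mathbf k$-algebras. If $\mathbf k$ is a field, then moreover: (1) If the characteristic of $\mathbf k$ does not divide $|W|$, then $\mathcal C_W(1)$ is semisimple. If $\mathbf k$ has characteristic $0$, then $\mathcal C_W(\underline u)$ is generically semisimple and, up to a finite extension of the base field, isomorphic to $\mathbf k^{\mathcal W}\rtimes\mathbf kW$ for generic $\underline u$. Precisely, taking one indeterminate for each conjugacy class of $W$ that contains a simple reflection: (a) if $K=\mathbf k(\underline u)$ is the field of rational functions in these indeterminates, then $\mathcal C_W(\underline u)$ over $K$ is semisimple, and there is a finite extension $K'$ of $K$ such that $K'\otimes_K\mathcal C_W(\underline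 u)\simeq K'^{\mathcal W}\rtimes K'W$ as $K'$-algebras; (b) there is a nonzero polynomial $D$ over $\mathbf k$ in these indeterminates such that, for every field extension $L$ of $\mathbf k$ (in particular $L=\mathbf k$) and all parameters $\underline u$ in $L$ with $D(\underline u)\neq0$, the $L$-algebra $\mathcal C_W(\underline u)$ is semisimple, and there is a finite extension $L'$ of $L$ (depending on $\underline u$) such that $L'\otimes_L\mathcal C_W(\underline u)\simeq L'^{\mathcal W}\rtimes L'W$ as $L'$-algebras. (2) If the group algebra $\mathbf kN_W(W_0)$ of the normalizer of $W_0$ in $W$ is split semisimple for every reflection subgroup $W_0$ of $W$, then $\mathcal C_W(1)$ is split semisimple. -/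

import Mathlib

open scoped TensorProduct

universe uB uW uk uL

/-- A `k`-algebra is split semisimple if it is isomorphic to a finite direct product of
full matrix algebras over the base field `k`. -/
def IsSplitSemisimple (k A : Type*) [Field k] [Ring A] [Algebra k A] : Prop :=
  ∃ (n : ℕ) (d : Fin n → ℕ), (∀ i, 0 < d i) ∧
    Nonempty (A ≃ₐ[k] ((i : Fin n) → Matrix (Fin (d i)) (Fin (d i)) k))

namespace CoxeterSystem

section Reflections

variable {B W : Type*} [Group W] {M : CoxeterMatrix B} (cs : CoxeterSystem M W)

/-- The set of reflections of `W`, as a type. -/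
abbrev Reflection : Type _ := {t : W // cs.IsReflection t}

/-- The simple reflection `s_i`, as a reflection. -/
def simpleRefl (i : B) : cs.Reflection := ⟨cs.simple i, cs.isReflection_simple i⟩

/-- The conjugate `w t w⁻¹` of a reflection `t`, as a reflection. -/
def conjRefl (w : W) (t : cs.Reflection) : cs.Reflection :=
  ⟨w * (t : W) * w⁻¹, t.2.conj w⟩

/-- The set of conjugacy classes of `W` that contain a simple reflection. -/
abbrev SimpleClass : Type _ := Set.range (fun i : B => ConjClasses.mk (cs.simple i))

/-- The conjugacy class of the simple reflection `s_i`. -/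
def simpleClass (i : B) : cs.SimpleClass := ⟨ConjClasses.mk (cs.simple i), i, rfl⟩

/-- A finitely generated reflection subgroup: a subgroup generated by a finite set of reflections.
When `W` is finite these are all the subgroups generated by reflections. -/
def IsFGReflectionSubgroup (H : Subgroup W) : Prop :=
  ∃ J : Set W, J.Finite ∧ (∀ t ∈ J, cs.IsReflection t) ∧ Subgroup.closure J = H

/-- The collection `𝒲` of all finitely generated reflection subgroups of `W`. -/
abbrev ReflectionSubgroups : Type _ := {H : Subgroup W // cs.IsFGReflectionSubgroup H}

theorem IsFGReflectionSubgroup.map_conj {H : Subgroup W} (hH : cs.IsFGReflectionSubgroup H)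
    (w : W) : cs.IsFGReflectionSubgroup (H.map (MulAut.conj w).toMonoidHom) := by
  obtain ⟨J, hf, hJ, rfl⟩ := hH
  refine ⟨(MulAut.conj w).toMonoidHom '' J, hf.image _, ?_, ?_⟩
  · rintro _ ⟨t, ht, rfl⟩
    exact (hJ t ht).conj w
  · exact (MonoidHom.map_closure _ _).symm

/-- `W` acts on `𝒲` by conjugation: `w • W₀ = w W₀ w⁻¹`. -/
instance : MulAction W cs.ReflectionSubgroups where
  smul w H := ⟨(H : Subgroup W).map (MulAut.conj w).toMonoidHom, H.2.map_conj cs w⟩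
  one_smul H := by
    apply Subtype.ext
    change (H : Subgroup W).map (MulAut.conj (1 : W)).toMonoidHom = H
    ext x
    simp [Subgroup.mem_map]
  mul_smul v w H := by
    apply Subtype.ext
    change (H : Subgroup W).map (MulAut.conj (v * w)).toMonoidHom =
      ((H : Subgroup W).map (MulAut.conj w).toMonoidHom).map (MulAut.conj v).toMonoidHom
    rw [Subgroup.map_map]
    congr 1
    ext x
    simp [mul_assoc]

theorem coe_smul_reflectionSubgroups (w : W) (H : cs.ReflectionSubgroups) :
    ((w • H : cs.ReflectionSubgroups) : Subgroup W) =
      (H : Subgroup W).map (MulAut.conj w).toMonoidHom := rfl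

end Reflections

section SemidirectProduct

variable {B W : Type*} [Group W] {M : CoxeterMatrix B} (cs : CoxeterSystem M W)
variable (k : Type*) [CommRing k]

/-- The algebra `k^𝒲` of `k`-valued functions on `𝒲`, with pointwise operations. -/
abbrev FunReflectionSubgroups : Type _ := cs.ReflectionSubgroups → k

/-- `W` acts on `k^𝒲` by ring automorphisms, `(w • f)(W₀) = f (w⁻¹ W₀ w)`. -/
instance : MulSemiringAction W (cs.FunReflectionSubgroups k) where
  smul w f := fun H => f (w⁻¹ • H)
  one_smul f := by
    funext H
    change f ((1 : W)⁻¹ • H) = f H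
    simp
  mul_smul v w f := by
    funext H
    change f ((v * w)⁻¹ • H) = f (w⁻¹ • v⁻¹ • H)
    rw [mul_inv_rev, mul_smul]
  smul_zero _ := rfl
  smul_add _ _ _ := rfl
  smul_one _ := rfl
  smul_mul _ _ _ := rfl

theorem smul_funReflectionSubgroups_apply (w : W) (f : cs.FunReflectionSubgroups k)
    (H : cs.ReflectionSubgroups) : (w • f) H = f (w⁻¹ • H) := rfl

instance : SMulCommClass W k (cs.FunReflectionSubgroups k) where
  smul_comm _ _ _ := rfl

/-- The semidirect product algebra `k^𝒲 ⋊ kW`: as a `k`-module `k^𝒲 ⊗ kW`, with multiplication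
determined by `(f w) (f' w') = f (w • f') w w'`. -/
abbrev FunSemidirect : Type _ := SkewMonoidAlgebra (cs.FunReflectionSubgroups k) W

end SemidirectProduct

section Algebra

variable {B W : Type*} [Group W] {M : CoxeterMatrix B} (cs : CoxeterSystem M W)
variable (k : Type*) [CommRing k]

/-- The generator `g_i` of the free algebra on the `g_i` (`i ∈ B`, one for each simple
reflection) and the `e_t` (`t` a reflection). -/
def freeG (i : B) : FreeAlgebra k (B ⊕ cs.Reflection) := FreeAlgebra.ι k (Sum.inl i)

/-- The generator `e_t` of the free algebra on the `g_i` and the `e_t`. -/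
def freeE (t : cs.Reflection) : FreeAlgebra k (B ⊕ cs.Reflection) := FreeAlgebra.ι k (Sum.inr t)

/-- The defining relations of `𝒞_W(u)`. The parameters `u` are indexed by the conjugacy classes
of simple reflections, so that conjugate simple reflections have the same parameter.
`braidWord M i j` is the word of length `m_{ij}` alternating between `i` and `j` and ending with
`j`; for `m_{ij} = ∞` (encoded as `0`) the braid relation is void. -/
inductive CRel (u : cs.SimpleClass → k) :
    FreeAlgebra k (B ⊕ cs.Reflection) → FreeAlgebra k (B ⊕ cs.Reflection) → Prop
  | braid (i j : B) : CRel u ((braidWord M i j).map (cs.freeG k)).prod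
      ((braidWord M j i).map (cs.freeG k)).prod
  | e_idem (t : cs.Reflection) : CRel u (cs.freeE k t * cs.freeE k t) (cs.freeE k t)
  | e_comm (t₁ t₂ : cs.Reflection) : CRel u (cs.freeE k t₁ * cs.freeE k t₂)
      (cs.freeE k t₂ * cs.freeE k t₁)
  | e_conj (t t₁ : cs.Reflection) : CRel u (cs.freeE k t * cs.freeE k t₁)
      (cs.freeE k t * cs.freeE k (cs.conjRefl (t : W) t₁))
  | g_e (i : B) (t : cs.Reflection) : CRel u (cs.freeG k i * cs.freeE k t)
      (cs.freeE k (cs.conjRefl (cs.simple i) t) * cs.freeG k i)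
  | quadratic (i : B) : CRel u (cs.freeG k i * cs.freeG k i)
      (1 + algebraMap k (FreeAlgebra k (B ⊕ cs.Reflection)) (u (cs.simpleClass i) - 1) *
        cs.freeE k (cs.simpleRefl i) * (1 + cs.freeG k i))

/-- The associative unital `k`-algebra `𝒞_W(u)`. -/
abbrev CAlgebra (u : cs.SimpleClass → k) : Type _ := RingQuot (cs.CRel k u)

/-- The field `k(u)` of rational functions over `k` in one indeterminate for each conjugacy class
of simple reflections. -/
abbrev GenericField (k : Type*) [Field k] : Type _ := FractionRing (MvPolynomial cs.SimpleClass k)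

/-- The indeterminates, as parameters in `k(u)`. -/
noncomputable def genericParam (k : Type*) [Field k] : cs.SimpleClass → cs.GenericField k :=
  fun c => algebraMap (MvPolynomial cs.SimpleClass k) (cs.GenericField k) (MvPolynomial.X c)

end Algebra

end CoxeterSystem

/-! For all parameters, `𝒞_W(u)` is free on the products `ε_H g_w` with `H` a reflection subgroup
and `w ∈ W` (`standardBasis`). The commuting idempotents `e_t` split `1` into orthogonal idempotents
`ε_J`, one for each set `J` of reflections. Relation 4 kills `ε_J` unless `J` is stable under
conjugation by its own elements, and such a `J` is the full set of reflections of the group it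
generates (`IsClosedReflectionSet.mem_of_mem_closure`, through canonical generators of reflection
subgroups). Matsumoto's theorem makes `g_w` well defined, and these products span. They are
independent because an explicit representation on the free module on pairs `(H, w)` separates them.
Its braid relations need no rank two computation: the left operators commute with right operators,
hence are determined by their values at `w = 1`.

At `u = 1` the `g_w` form a copy of `W` that permutes the `ε_H` by conjugation, so the basis is
carried to the basis `δ_H w` of the semidirect product. Grouping the `H` by conjugacy class
identifies the same algebra with a product of matrix algebras over the group algebras `k N_W(H)`
(`nonempty_algEquiv_block`), which gives (2). If `|W|` is invertible, averaging over `W` gives a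
separability idempotent and therefore semisimplicity.

For generic `u`, call splitting a copy of `W` in `𝒞_W(u)` that permutes the `e_t` and forms a basis
together with the `ε_H`; a splitting amounts to an isomorphism with `𝒞_W(1)`. Over `P = k[u]` the
splittings are parametrised by a finitely presented `P`-algebra `R`. One exists at the point `u =
1`, and since `|W|` is invertible it lifts along square-zero extensions (`IsSplitting.exists_lift`,
the vanishing of a degree two cohomology class), hence to `P / I ^ n` for all `n`, with `I` the
ideal of that point. Krull's intersection theorem then makes `P → R` injective, and by Chevalley's
theorem the image of `Spec R` contains the locus `D ≠ 0` of some nonzero `D`. A field-valued point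
of this locus acquires a splitting after a finite extension, and semisimplicity descends from the
extension. The field `k(u)` is the case of the generic point. -/

namespace CoxeterSystem

/-! ### Inversion sets as a cocycle with values in `ZMod 2` -/

section Inversions

variable {B W : Type*} [Group W] {M : CoxeterMatrix B} (cs : CoxeterSystem M W)

local prefix:100 "s" => cs.simple
local prefix:100 "π" => cs.wordProd
local prefix:100 "ℓ" => cs.length
local prefix:100 "lis" => cs.leftInvSeq
local prefix:100 "ris" => cs.rightInvSeq

theorem functionEnd_mul_apply {α : Type*} (f g : Function.End α) (x : α) : (f * g) x = f (g x) := rfl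

open Classical in
/-- The action of a simple reflection on signed elements: `s_i` conjugates and changes the sign of
`s_i` only. -/
noncomputable def signedSimple (i : B) : Function.End (W × ZMod 2) :=
  fun p => (s i * p.1 * s i, p.2 + if p.1 = s i then 1 else 0)

-- How often an element occurs in the inversion sequence depends on the word. Recording the parity
-- of this number in an action is what turns it into a function of the group element.
open Classical in
theorem prod_signedSimple (ω : List B) (p : W × ZMod 2) :
    (ω.map cs.signedSimple).prod p =
      (π ω * p.1 * (π ω)⁻¹, p.2 + (((ris ω).count p.1 : ℕ) : ZMod 2)) := by
  induction ω with
  | nil => simp; rfl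
  | cons i ω ih =>
    rw [List.map_cons, List.prod_cons, functionEnd_mul_apply, ih]
    simp only [signedSimple, rightInvSeq, wordProd_cons, List.count_cons, Prod.mk.injEq]
    refine ⟨by simp [mul_assoc], ?_⟩
    have : (π ω * p.1 * (π ω)⁻¹ = s i) ↔ ((π ω)⁻¹ * s i * π ω == p.1) = true := by
      rw [beq_iff_eq]
      constructor
      · intro h; rw [← h]; group
      · intro h; rw [← h]; group
    simp only [this]
    push_cast
    split_ifs <;> ring

theorem leftInvSeq_eq_reverse_rightInvSeq (ω : List B) :
    lis ω = (ris ω.reverse).reverse := by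
  rw [rightInvSeq_reverse, List.reverse_reverse]

theorem alternatingWord_two_mul (i j : B) (m : ℕ) :
    alternatingWord i j (2 * m) = (List.replicate m [i, j]).flatten := by
  induction m with
  | zero => rfl
  | succ m ih =>
    rw [show 2 * (m + 1) = 2 * m + 1 + 1 by ring, alternatingWord_succ', alternatingWord_succ',
      ih]
    simp [List.replicate_succ]

theorem simple_mul_simple_pow_mod (i j : B) (k : ℕ) :
    (s i * s j) ^ (k + M i j) = (s i * s j) ^ k := by
  rw [pow_add, simple_mul_simple_pow, mul_one]

-- Read from the left, the inversions of `(s_i s_j) ^ m` are the alternating products of odd length.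
-- Since `(s_i s_j) ^ m = 1`, this sequence has period `m`, so it consists of two equal halves.
open Classical in
theorem even_count_rightInvSeq (i j : B) (t : W) :
    Even ((ris (alternatingWord i j (2 * M i j))).count t) := by
  have hrev : (alternatingWord i j (2 * M i j)).reverse = alternatingWord j i (2 * M i j) := by
    rw [alternatingWord_two_mul, alternatingWord_two_mul]
    generalize M i j = m
    induction m with
    | zero => rfl
    | succ m ih =>
      rw [List.replicate_succ', List.flatten_append, List.reverse_append, ih, List.replicate_succ]
      simp
  rw [← List.count_reverse, ← List.reverse_reverse (alternatingWord i j (2 * M i j)), hrev,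
    ← leftInvSeq_eq_reverse_rightInvSeq]
  set L := lis (alternatingWord j i (2 * M i j)) with hL
  have hlen : L.length = 2 * M i j := by simp [hL]
  have hper : L.take (M i j) = L.drop (M i j) := by
    apply List.ext_getElem
    · simp [hlen]; omega
    · intro k h1 h2
      rw [List.getElem_take, List.getElem_drop]
      simp only [List.length_take, hlen] at h1
      rw [cs.getElem_leftInvSeq_alternatingWord j i (M i j) k (by omega),
        cs.getElem_leftInvSeq_alternatingWord j i (M i j) (M i j + k) (by omega)]
      rw [prod_alternatingWord_eq_mul_pow, prod_alternatingWord_eq_mul_pow,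
        show (2 * k + 1) / 2 = k by omega, show (2 * (M i j + k) + 1) / 2 = k + M i j by omega,
        simple_mul_simple_pow_mod]
      simp
  rw [← List.take_append_drop (M i j) L, List.count_append, hper]
  exact ⟨_, rfl⟩

theorem isLiftable_signedSimple : M.IsLiftable cs.signedSimple := by
  classical
  intro i j
  have h : (cs.signedSimple i * cs.signedSimple j) ^ M i j =
      ((alternatingWord i j (2 * M i j)).map cs.signedSimple).prod := by
    rw [alternatingWord_two_mul, List.map_flatten, List.prod_flatten]
    simp
  rw [h]
  funext p
  rw [prod_signedSimple]
  have h1 : π (alternatingWord i j (2 * M i j)) = 1 := by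
    rw [prod_alternatingWord_eq_mul_pow]
    simp
  have h2 : (((ris (alternatingWord i j (2 * M i j))).count p.1 : ℕ) : ZMod 2) = 0 :=
    (ZMod.natCast_eq_zero_iff_even).2 (cs.even_count_rightInvSeq i j p.1)
  rw [h1, h2]
  simp [Function.End.one_def]

/-- The action of `W` on signed elements of `W`. -/
noncomputable def signedAction : W →* Function.End (W × ZMod 2) :=
  cs.lift ⟨cs.signedSimple, cs.isLiftable_signedSimple⟩

/-- The indicator, with values in `ZMod 2`, of the set of left inversions of `w`. -/
noncomputable def inversionSign (w t : W) : ZMod 2 := (cs.signedAction w⁻¹ (t, 0)).2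

theorem signedAction_wordProd (ω : List B) :
    cs.signedAction (π ω) = (ω.map cs.signedSimple).prod := by
  rw [wordProd, map_list_prod, List.map_map]
  congr 2
  funext i
  simp [signedAction]

open Classical in
theorem inversionSign_wordProd (ω : List B) (t : W) :
    cs.inversionSign (π ω) t = (((lis ω).count t : ℕ) : ZMod 2) := by
  rw [inversionSign, ← wordProd_reverse, signedAction_wordProd, prod_signedSimple,
    leftInvSeq_eq_reverse_rightInvSeq, List.count_reverse]
  simp

theorem signedAction_inv_apply (w : W) (p : W × ZMod 2) :
    cs.signedAction w⁻¹ p = (w⁻¹ * p.1 * w, p.2 + cs.inversionSign w p.1) := by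
  classical
  obtain ⟨ω, rfl⟩ := cs.wordProd_surjective w
  rw [inversionSign, ← wordProd_reverse, signedAction_wordProd, prod_signedSimple,
    prod_signedSimple]
  simp

theorem inversionSign_one (t : W) : cs.inversionSign 1 t = 0 := by
  simp [inversionSign, Function.End.one_def]

/-- For the inversion sets this is `N(vw) = N(v) Δ v N(w) v⁻¹`. The later arguments about inversions
are computations with this identity. -/
theorem inversionSign_mul (v w t : W) :
    cs.inversionSign (v * w) t = cs.inversionSign v t + cs.inversionSign w (v⁻¹ * t * v) := by
  rw [inversionSign, mul_inv_rev, map_mul, functionEnd_mul_apply,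
    signedAction_inv_apply, signedAction_inv_apply]
  simp

open Classical in
theorem inversionSign_simple (i : B) (t : W) :
    cs.inversionSign (s i) t = if t = s i then 1 else 0 := by
  have h := cs.inversionSign_wordProd [i] t
  rw [wordProd_singleton] at h
  rw [h]
  simp only [leftInvSeq_singleton, List.count_singleton, beq_iff_eq, @eq_comm _ t]
  split_ifs <;> simp

theorem inversionSign_inv (w t : W) :
    cs.inversionSign w⁻¹ t = cs.inversionSign w (w * t * w⁻¹) := by
  have h := cs.inversionSign_mul w w⁻¹ (w * t * w⁻¹)
  rw [mul_inv_cancel, inversionSign_one] at h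
  rw [show w⁻¹ * (w * t * w⁻¹) * w = t by group] at h
  exact ((CharTwo.add_eq_zero).1 h.symm).symm

theorem inversionSign_reflection (w : W) (i : B) (t : W) :
    cs.inversionSign (w * s i * w⁻¹) t = cs.inversionSign w t +
      cs.inversionSign (s i) (w⁻¹ * t * w) +
      cs.inversionSign w ((w * s i * w⁻¹) * t * (w * s i * w⁻¹)) := by
  rw [inversionSign_mul, inversionSign_mul, inversionSign_inv]
  congr 2
  simp [mul_assoc]

/-- Write `t = w s w⁻¹`: the contributions of `w` and of `w⁻¹` at `t` coincide and cancel modulo 2,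
and `s` contributes 1. -/
theorem inversionSign_self {t : W} (ht : cs.IsReflection t) : cs.inversionSign t t = 1 := by
  classical
  obtain ⟨w, i, rfl⟩ := ht
  rw [inversionSign_reflection, inversionSign_simple]
  rw [show w * s i * w⁻¹ * (w * s i * w⁻¹) * (w * s i * w⁻¹) = w * s i * w⁻¹ by simp [mul_assoc],
    show w⁻¹ * (w * s i * w⁻¹) * w = s i by group, if_pos rfl, add_right_comm,
    CharTwo.add_self_eq_zero, zero_add]

theorem mem_leftInvSeq_of_inversionSign {ω : List B} {t : W}
    (h : cs.inversionSign (π ω) t = 1) : t ∈ lis ω := by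
  classical
  rw [inversionSign_wordProd] at h
  by_contra hn
  rw [List.count_eq_zero.2 hn] at h
  simp at h

theorem isLeftInversion_of_inversionSign {w t : W} (h : cs.inversionSign w t = 1) :
    cs.IsLeftInversion w t := by
  obtain ⟨ω, hω, rfl⟩ := cs.exists_isReduced w
  exact cs.isLeftInversion_of_mem_leftInvSeq hω (cs.mem_leftInvSeq_of_inversionSign h)

theorem zmod_two_cases (a : ZMod 2) : a = 0 ∨ a = 1 := by
  revert a; decide

theorem inversionSign_eq_one_iff {w t : W} :
    cs.inversionSign w t = 1 ↔ cs.IsLeftInversion w t := by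
  refine ⟨cs.isLeftInversion_of_inversionSign, fun h => ?_⟩
  -- If the sign of `w` at `t` were 0, that of `t * w` would be 1, so both passages between `w` and
  -- `t * w` would shorten.
  refine (zmod_two_cases _).resolve_left fun h0 => ?_
  have h1 : cs.inversionSign (t * w) t = 1 := by
    rw [inversionSign_mul, cs.inversionSign_self h.1, inv_mul_cancel, one_mul, h0, add_zero]
  have h2 := (cs.isLeftInversion_of_inversionSign h1).2
  rw [← mul_assoc, h.1.mul_self, one_mul] at h2
  exact absurd h.2 (by omega)

theorem finite_inversions (w : W) : {t | cs.inversionSign w t = 1}.Finite := by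
  obtain ⟨ω, rfl⟩ := cs.wordProd_surjective w
  exact (List.finite_toSet (lis ω)).subset fun t ht => cs.mem_leftInvSeq_of_inversionSign ht

theorem inversionSign_simple_mul_self (i : B) (w : W) :
    cs.inversionSign (s i * w) (s i) = 1 + cs.inversionSign w (s i) := by
  classical
  rw [inversionSign_mul, inversionSign_simple, if_pos rfl]
  simp

end Inversions

end CoxeterSystem

/-! ### The geometric representation and the exact order of `s_i s_j` -/

namespace CoxeterMatrix

open Polynomial.Chebyshev Module

variable {B : Type*} (M : CoxeterMatrix B)

/-- The coroots of the geometric representation, as linear forms on the space spanned by the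
simple roots. -/
noncomputable def coroot (i : B) : Module.Dual ℝ (B →₀ ℝ) :=
  -- For `M i j = 0`, which encodes `∞`, division by zero gives `cos 0 = 1`, hence the usual entry
  -- `-2`.
  Finsupp.lsum ℝ fun j => (-2 * Real.cos (Real.pi / M i j)) • LinearMap.id

theorem coroot_single (i j : B) :
    M.coroot i (Finsupp.single j 1) = -2 * Real.cos (Real.pi / M i j) := by
  simp [coroot]

theorem coroot_single_self (i : B) : M.coroot i (Finsupp.single i 1) = 2 := by
  rw [coroot_single, M.diagonal]
  simp

/-- The simple reflections of the geometric representation. -/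
noncomputable def geometricReflection (i : B) : (B →₀ ℝ) ≃ₗ[ℝ] (B →₀ ℝ) :=
  Module.reflection (M.coroot_single_self i)

theorem coroot_mul_coroot_sub_two (i j : B) :
    M.coroot i (Finsupp.single j 1) * M.coroot j (Finsupp.single i 1) - 2 =
      2 * Real.cos (2 * (Real.pi / M i j)) := by
  rw [coroot_single, coroot_single, M.symmetric j i, Real.cos_two_mul]
  ring

theorem sin_two_pi_div_pos {m : ℕ} (hm : 3 ≤ m) : 0 < Real.sin (2 * (Real.pi / m)) := by
  have hm' : (3 : ℝ) ≤ m := by exact_mod_cast hm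
  apply Real.sin_pos_of_pos_of_lt_pi
  · have := Real.pi_pos
    positivity
  · rw [mul_div_assoc', div_lt_iff₀ (by linarith)]
    nlinarith [Real.pi_pos]

/-- Powers of a product of two reflections are given by Chebyshev polynomials at `2 cos θ` with `θ =
2π / m`, that is by `sin ((n + 1) θ) / sin θ`. For `m = 2k` the relevant value is `sin π / sin θ =
0`; for `m = 2k + 1` two terms cancel because `(k + 1) θ = 2π - k θ`. -/
theorem isLiftable_geometricReflection : M.IsLiftable M.geometricReflection := by
  intro i j
  have key := reflection_mul_reflection_pow_apply (M.coroot_single_self i)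
    (M.coroot_single_self j) (M i j) (t := 2 * Real.cos (2 * (Real.pi / M i j)))
    (ht := (M.coroot_mul_coroot_sub_two i j).symm)
  have hS := fun n : ℤ => S_two_mul_real_cos (2 * (Real.pi / M i j)) n
  have hc1 := M.coroot_single i j
  have hc2 := M.coroot_single j i
  rw [M.symmetric j i] at hc2
  have hij : i = j ∨ M i j ≠ 1 := by
    by_cases h : i = j
    · exact Or.inl h
    · exact Or.inr (M.off_diagonal i j h)
  ext1 z
  change ((reflection (M.coroot_single_self i) * reflection (M.coroot_single_self j)) ^ M i j) z = z
  rcases hij with rfl | hij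
  · rw [M.diagonal, pow_one, LinearEquiv.mul_apply]
    exact involutive_reflection _ z
  rw [key z]
  generalize hm : M i j = m at *
  clear key
  -- For `m ≤ 2` the denominator `sin θ` vanishes, so these values are treated by hand.
  rcases Nat.lt_or_ge m 3 with h3 | h3
  · interval_cases m
    · simp
    · exact absurd rfl hij
    · norm_num at hc1 hc2
      have h0 : 2 * Real.cos (2 * (Real.pi / (2 : ℕ))) = -2 := by
        rw [Nat.cast_ofNat, mul_div_cancel₀ _ (two_ne_zero), Real.cos_pi]; norm_num
      rw [h0, hc1, hc2]
      norm_num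
      abel
  · have hs := sin_two_pi_div_pos h3
    have hm0 : (m : ℝ) ≠ 0 := by positivity
    set θ := 2 * (Real.pi / (m : ℝ)) with hθ
    have hS' : ∀ n : ℤ, (S ℝ n).eval (2 * Real.cos θ) = Real.sin ((n + 1) * θ) / Real.sin θ :=
      fun n => by rw [eq_div_iff hs.ne', hS]
    have hmθ : (m : ℝ) * θ = 2 * Real.pi := by rw [hθ]; field_simp
    rcases Nat.even_or_odd' m with ⟨k, hk | hk⟩
    · have e1 : ((m : ℤ) - 2) / 2 = k - 1 := by omega
      have e2 : ((m : ℤ) - 1) / 2 = k - 1 := by omega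
      have h0 : (S ℝ ((k : ℤ) - 1)).eval (2 * Real.cos θ) = 0 := by
        rw [hS']
        have : (((k : ℤ) - 1 : ℤ) + 1 : ℝ) * θ = Real.pi := by
          push_cast
          rw [hk] at hmθ
          push_cast at hmθ
          linarith
        rw [this]; simp
      rw [e1, e2, h0]
      simp
    · have e1 : ((m : ℤ) - 2) / 2 = k - 1 := by omega
      have e2 : ((m : ℤ) - 1) / 2 = k := by omega
      have e3 : ((m : ℤ) - 3) / 2 = k - 1 := by omega
      have e4 : (m : ℤ) / 2 = k := by omega
      have h0 : (S ℝ (k : ℤ)).eval (2 * Real.cos θ) +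
          (S ℝ ((k : ℤ) - 1)).eval (2 * Real.cos θ) = 0 := by
        rw [hS', hS', ← add_div]
        have : (((k : ℤ) : ℝ) + 1) * θ = 2 * Real.pi - (((k : ℤ) - 1 : ℤ) + 1 : ℝ) * θ := by
          push_cast
          rw [hk] at hmθ
          push_cast at hmθ
          linarith
        rw [this, Real.sin_two_pi_sub]
        simp
      rw [e1, e2, e3, e4, h0]
      simp

end CoxeterMatrix

namespace CoxeterSystem

open Polynomial.Chebyshev Module

variable {B W : Type*} [Group W] {M : CoxeterMatrix B} (cs : CoxeterSystem M W)

/-- Apply the power to the simple root `α_i`. If it is fixed and `m ≥ 3`, the coefficient of `α_j`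
forces `sin (n θ) = 0` and that of `α_i` then forces `cos (n θ) = 1`, impossible for `0 < n θ < 2π`.
For infinite bonds the coefficient of `α_j` grows linearly in `n`. -/
theorem simple_mul_simple_pow_ne_one {i j : B} (hij : i ≠ j) {n : ℕ} (hn : 0 < n)
    (hnm : M i j = 0 ∨ n < M i j) : (cs.simple i * cs.simple j) ^ n ≠ 1 := by
  intro h
  have h1 : (M.geometricReflection i * M.geometricReflection j) ^ n = 1 := by
    have := congrArg (cs.lift ⟨_, M.isLiftable_geometricReflection⟩) h
    rwa [map_pow, map_mul, lift_apply_simple, lift_apply_simple, map_one] at this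
  have key := reflection_mul_reflection_pow_apply_self (M.coroot_single_self i)
    (M.coroot_single_self j) n (t := 2 * Real.cos (2 * (Real.pi / M i j)))
    (ht := (M.coroot_mul_coroot_sub_two i j).symm)
  have h2 : ((reflection (M.coroot_single_self i) * reflection (M.coroot_single_self j)) ^ n)
      (Finsupp.single i 1) = Finsupp.single i 1 := by
    change ((M.geometricReflection i * M.geometricReflection j) ^ n) _ = _
    rw [h1]; rfl
  rw [h2] at key
  have ki := DFunLike.congr_fun key i
  have kj := DFunLike.congr_fun key j
  simp only [Finsupp.add_apply, Finsupp.smul_apply, smul_eq_mul, Finsupp.single_eq_same,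
    Finsupp.single_eq_of_ne hij, Finsupp.single_eq_of_ne hij.symm, mul_one, mul_zero, add_zero,
    zero_add, M.coroot_single j i, M.symmetric j i] at ki kj
  have hij1 := M.off_diagonal i j hij
  generalize M i j = m at *
  have hS := fun n : ℤ => S_two_mul_real_cos (2 * (Real.pi / m)) n
  have hn' : (0 : ℝ) < n := by exact_mod_cast hn
  rcases Nat.lt_or_ge m 3 with h3 | h3
  · interval_cases m
    · simp only [CharP.cast_eq_zero, div_zero, mul_zero, Real.cos_zero, mul_one] at kj
      have : (S ℝ ((n : ℤ) - 1)).eval 2 = n := by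
        simp
      rw [this] at kj
      norm_num at kj
      omega
    · exact hij1 rfl
    · obtain rfl : n = 1 := by omega
      norm_num [mul_div_cancel₀] at ki
  · have hnm' : n < m := by omega
    have hs := CoxeterMatrix.sin_two_pi_div_pos h3
    have hm0 : (0 : ℝ) < m := by positivity
    have hm3 : (3 : ℝ) ≤ m := by exact_mod_cast h3
    have hnm'' : (n : ℝ) < m := by exact_mod_cast hnm'
    have hcos : 0 < Real.cos (Real.pi / m) := by
      apply Real.cos_pos_of_mem_Ioo
      constructor
      · have : 0 < Real.pi / m := by have := Real.pi_pos; positivity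
        linarith [Real.pi_pos]
      · rw [div_lt_div_iff₀ hm0 two_pos]
        nlinarith [Real.pi_pos]
    have k0 : (S ℝ ((n : ℤ) - 1)).eval (2 * Real.cos (2 * (Real.pi / m))) = 0 := by
      rcases mul_eq_zero.1 kj.symm with h | h
      · exact h
      · exfalso; linarith
    rw [k0, add_zero] at ki
    have hmθ : (m : ℝ) * (2 * (Real.pi / m)) = 2 * Real.pi := by field_simp
    have hθ : 0 < 2 * (Real.pi / m) := by have := Real.pi_pos; positivity
    set θ := 2 * (Real.pi / (m : ℝ))
    have a1 := hS n
    have a2 := hS ((n : ℤ) - 1)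
    rw [← ki, one_mul] at a1
    rw [k0, zero_mul] at a2
    push_cast at a1 a2
    rw [sub_add_cancel] at a2
    rw [add_mul, one_mul, Real.sin_add, ← a2, zero_mul, zero_add] at a1
    have hc : Real.cos (n * θ) = 1 := by
      have := mul_right_cancel₀ hs.ne' (a1.symm.trans (one_mul _).symm)
      exact this
    have := (Real.cos_eq_one_iff_of_lt_of_lt (x := n * θ)
      (by nlinarith [Real.pi_pos]) (by nlinarith)).1 hc
    have : 0 < n * θ := by positivity
    linarith

theorem matrix_ne_zero (cs : CoxeterSystem M W) [Finite W] (i j : B) : M i j ≠ 0 := by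
  intro h0
  have hij : i ≠ j := by
    rintro rfl
    rw [M.diagonal] at h0
    exact one_ne_zero h0
  exact cs.simple_mul_simple_pow_ne_one hij (orderOf_pos (cs.simple i * cs.simple j))
    (Or.inl h0) (pow_orderOf_eq_one _)

end CoxeterSystem

namespace CoxeterSystem

/-! ### Reflection subgroups and their canonical generators -/

section ClosedReflectionSets

variable {B W : Type*} [Group W] {M : CoxeterMatrix B} (cs : CoxeterSystem M W)

/-- A set of reflections that is stable under conjugation by its elements. -/
structure IsClosedReflectionSet (J : Set W) : Prop where
  isReflection : ∀ t ∈ J, cs.IsReflection t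
  conj_mem : ∀ t ∈ J, ∀ u ∈ J, t * u * t ∈ J

/-- The canonical generators of the reflection subgroup with set of reflections `J`. -/
def canonicalGenerators (J : Set W) : Set W :=
  {r | r ∈ J ∧ ∀ t ∈ J, cs.inversionSign r t = 1 → t = r}

variable {cs} {J : Set W}

theorem IsClosedReflectionSet.conj_mem_of_mem_closure (hJ : cs.IsClosedReflectionSet J) {p t : W}
    (hp : p ∈ Subgroup.closure J) (ht : t ∈ J) : p * t * p⁻¹ ∈ J := by
  have h : Subgroup.closure J ≤ Subgroup.normalizer J := by
    rw [Subgroup.closure_le]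
    intro q hq
    have hqr := hJ.isReflection q hq
    rw [SetLike.mem_coe, Subgroup.mem_set_normalizer_iff, hqr.inv]
    refine fun u => ⟨hJ.conj_mem q hq u, fun hu => ?_⟩
    have := hJ.conj_mem q hq _ hu
    rwa [← mul_assoc, ← mul_assoc, hqr.mul_self, one_mul, mul_assoc, hqr.mul_self, mul_one] at this
  exact ((Subgroup.mem_set_normalizer_iff).1 (h hp) t).1 ht

theorem inversionSign_mul_simple (w : W) (i : B) (t : W) :
    cs.inversionSign (w * cs.simple i) t = 1 ↔
      (cs.inversionSign w t = 1 ∧ t ≠ w * cs.simple i * w⁻¹) ∨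
      (cs.inversionSign w t = 0 ∧ t = w * cs.simple i * w⁻¹) := by
  classical
  have h : w⁻¹ * t * w = cs.simple i ↔ t = w * cs.simple i * w⁻¹ := by
    constructor
    · intro h; rw [← h]; group
    · intro h; rw [h]; group
  rw [inversionSign_mul, inversionSign_simple]
  simp only [h]
  rcases zmod_two_cases (cs.inversionSign w t) with h0 | h0 <;> rw [h0] <;> split_ifs with h1 <;>
    simp [h1, CharTwo.add_self_eq_zero]

/-- In the cocycle formula for `w s w⁻¹` the two terms that come from `w` vanish on `J`, which
leaves only the inversion of `s`. This is the source of canonical generators. -/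
theorem inversionSign_conj_of_forall {J : Set W} {w : W} (i : B)
    (hw : ∀ t ∈ J, cs.inversionSign w t = 0)
    (hconj : ∀ t ∈ J, (w * cs.simple i * w⁻¹) * t * (w * cs.simple i * w⁻¹) ∈ J) {t : W}
    (ht : t ∈ J) (h : cs.inversionSign (w * cs.simple i * w⁻¹) t = 1) :
    t = w * cs.simple i * w⁻¹ := by
  classical
  rw [inversionSign_reflection, hw t ht, hw _ (hconj t ht), inversionSign_simple] at h
  split_ifs at h with h1
  · rw [← h1]; group
  · simp at h

/-- Shorten `w` by right descents until its inversion set no longer meets `J`. The last inversion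
lost has the form `v s v⁻¹` with no inversion of `v` in `J`, hence is canonical. It is also an
inversion of `w`, since a descent removes only one inversion. -/
theorem IsClosedReflectionSet.exists_mem_canonicalGenerators (hJ : cs.IsClosedReflectionSet J)
    (w : W) (hw : ∃ t ∈ J, cs.inversionSign w t = 1) :
    ∃ q ∈ cs.canonicalGenerators J, cs.inversionSign w q = 1 := by
  induction hn : cs.length w using Nat.strong_induction_on generalizing w with
  | _ n ih =>
    subst hn
    by_cases h1 : w = 1
    · obtain ⟨t, _, ht⟩ := hw
      rw [h1, inversionSign_one] at ht
      simp at ht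
    obtain ⟨i, hi⟩ := cs.exists_rightDescent_of_ne_one h1
    set v := w * cs.simple i with hv
    have hwv : w = v * cs.simple i := by simp [hv]
    have hv0 : cs.inversionSign v (v * cs.simple i * v⁻¹) = 0 := by
      refine (zmod_two_cases _).resolve_right fun h => ?_
      have h2 := (cs.isLeftInversion_of_inversionSign h).2
      rw [inv_mul_cancel_right, ← hwv] at h2
      exact absurd hi (by unfold IsRightDescent; rw [← hv]; omega)
    by_cases hJv : ∃ t ∈ J, cs.inversionSign v t = 1
    · obtain ⟨q, hq, hq1⟩ := ih _ hi v hJv rfl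
      refine ⟨q, hq, ?_⟩
      rw [hwv, inversionSign_mul_simple]
      refine Or.inl ⟨hq1, ?_⟩
      rintro rfl
      rw [hv0] at hq1
      simp at hq1
    · push Not at hJv
      have hJv0 : ∀ t ∈ J, cs.inversionSign v t = 0 := fun t ht =>
        (zmod_two_cases _).resolve_right (hJv t ht)
      obtain ⟨t, ht, ht1⟩ := hw
      have ht2 := ht1
      rw [hwv, inversionSign_mul_simple] at ht1
      rcases ht1 with h | h
      · exact absurd h.1 (hJv t ht)
      · have hq : v * cs.simple i * v⁻¹ ∈ J := h.2 ▸ ht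
        refine ⟨t, ⟨ht, ?_⟩, ht2⟩
        rw [h.2]
        intro u hu
        exact inversionSign_conj_of_forall i hJv0 (fun t ht => hJ.conj_mem _ hq t ht) hu

/-- The factor `w₀` plays the role of a minimal coset representative. It is reached by multiplying
on the left by canonical generators, each of which lowers the number of inversions in `J`. -/
theorem IsClosedReflectionSet.exists_eq_mul (hJ : cs.IsClosedReflectionSet J) (w : W) :
    ∃ p ∈ Subgroup.closure (cs.canonicalGenerators J), ∃ w₀ : W, w = p * w₀ ∧
      ∀ t ∈ J, cs.inversionSign w₀ t = 0 := by
  induction hn : {t | t ∈ J ∧ cs.inversionSign w t = 1}.ncard using Nat.strong_induction_on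
    generalizing w with
  | _ n ih =>
    subst hn
    by_cases h : ∃ t ∈ J, cs.inversionSign w t = 1
    · obtain ⟨q, hq, hq1⟩ := hJ.exists_mem_canonicalGenerators w h
      have hqr := hJ.isReflection q hq.1
      have hqq : q⁻¹ = q := hqr.inv
      have hlt : {t | t ∈ J ∧ cs.inversionSign (q * w) t = 1}.ncard <
          {t | t ∈ J ∧ cs.inversionSign w t = 1}.ncard := by
        have hfin : {t | t ∈ J ∧ cs.inversionSign w t = 1}.Finite :=
          (cs.finite_inversions w).subset fun t ht => ht.2
        have hqmem : q ∈ {t | t ∈ J ∧ cs.inversionSign w t = 1} := ⟨hq.1, hq1⟩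
        rw [← Set.ncard_sdiff_singleton_add_one hqmem hfin, Nat.lt_succ_iff]
        have hfin' := hfin.subset (Set.sdiff_subset (t := {q}))
        -- Conjugation by `q` carries the inversions of `q * w` in `J` into those of `w` other than
        -- `q`, because `q` has no inversion in `J` besides itself.
        refine Set.ncard_le_ncard_of_injOn (fun t => q * t * q) ?_ ?_ hfin'
        · rintro t ⟨ht, ht1⟩
          rw [inversionSign_mul, hqq] at ht1
          have htq : t ≠ q := by
            rintro rfl
            rw [cs.inversionSign_self hqr, hqr.mul_self, one_mul, hq1] at ht1
            exact absurd ht1 (by decide)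
          have h0 : cs.inversionSign q t = 0 :=
            (zmod_two_cases _).resolve_right fun h => htq (hq.2 t ht h)
          rw [h0, zero_add] at ht1
          refine ⟨⟨hJ.conj_mem q hq.1 t ht, ht1⟩, fun h => htq ?_⟩
          rw [Set.mem_singleton_iff, mul_assoc, mul_eq_left] at h
          rw [eq_inv_of_mul_eq_one_left h, hqq]
        · intro a _ b _ hab
          simpa using hab
      obtain ⟨p, hp, w₀, hw, hw₀⟩ := ih _ hlt _ rfl
      refine ⟨q * p, mul_mem (Subgroup.subset_closure hq) hp, w₀, ?_, hw₀⟩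
      rw [mul_assoc, ← hw, ← mul_assoc, hqr.mul_self, one_mul]
    · push Not at h
      exact ⟨1, one_mem _, w, (one_mul w).symm, fun t ht =>
        (zmod_two_cases _).resolve_right (h t ht)⟩

/-- The exchange property relative to the canonical generators. Either `q` is the first letter and
cancels, or it is not an inversion of that letter `p`, and `p q p` is an inversion of the remaining
product. -/
theorem IsClosedReflectionSet.exchange (hJ : cs.IsClosedReflectionSet J) (L : List W)
    (hL : ∀ x ∈ L, x ∈ cs.canonicalGenerators J) {q : W} (hq : q ∈ J)
    (h : cs.inversionSign L.prod q = 1) :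
    ∃ L' : List W, (∀ x ∈ L', x ∈ cs.canonicalGenerators J) ∧ L'.length < L.length ∧
      q * L.prod = L'.prod := by
  induction L generalizing q with
  | nil =>
    rw [List.prod_nil, inversionSign_one] at h
    simp at h
  | cons p L ih =>
    have hp := hL p List.mem_cons_self
    have hpr := hJ.isReflection p hp.1
    have hL' : ∀ x ∈ L, x ∈ cs.canonicalGenerators J := fun x hx => hL x (List.mem_cons_of_mem _ hx)
    by_cases hpq : q = p
    · refine ⟨L, hL', by simp, ?_⟩
      rw [hpq, List.prod_cons, ← mul_assoc, hpr.mul_self, one_mul]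
    · have h0 : cs.inversionSign p q = 0 :=
        (zmod_two_cases _).resolve_right fun h => hpq (hp.2 q hq h)
      rw [List.prod_cons, inversionSign_mul, h0, zero_add, hpr.inv] at h
      obtain ⟨L', h1, h2, h3⟩ := ih hL' (hJ.conj_mem p hp.1 q hq) h
      refine ⟨p :: L', ?_, by simpa using h2, ?_⟩
      · simpa using ⟨hp, h1⟩
      · rw [List.prod_cons, List.prod_cons, ← h3]
        simp only [← mul_assoc, hpr.mul_self, one_mul]

/-- If the first letter `q` is not an inversion of the whole product, it is one of the remaining
product, and the exchange property gives a shorter word. -/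
theorem IsClosedReflectionSet.prod_eq_one (hJ : cs.IsClosedReflectionSet J) (L : List W)
    (hL : ∀ x ∈ L, x ∈ cs.canonicalGenerators J) (h : ∀ t ∈ J, cs.inversionSign L.prod t = 0) :
    L.prod = 1 := by
  induction hn : L.length using Nat.strong_induction_on generalizing L with
  | _ n ih =>
    subst hn
    cases L with
    | nil => rfl
    | cons q L =>
      have hq := hL q List.mem_cons_self
      have hqr := hJ.isReflection q hq.1
      have h1 := h q hq.1
      rw [List.prod_cons, inversionSign_mul, cs.inversionSign_self hqr, inv_mul_cancel,
        one_mul] at h1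
      have h2 : cs.inversionSign L.prod q = 1 := by
        rcases zmod_two_cases (cs.inversionSign L.prod q) with h3 | h3
        · rw [h3] at h1; exact absurd h1 (by decide)
        · exact h3
      obtain ⟨L', hL', hlt, he⟩ := hJ.exchange L
        (fun x hx => hL x (List.mem_cons_of_mem _ hx)) hq.1 h2
      rw [List.prod_cons, he] at h ⊢
      exact ih _ (by rw [List.length_cons]; omega) L' hL' h rfl

theorem IsClosedReflectionSet.eq_one_of_mem_closure (hJ : cs.IsClosedReflectionSet J) {u : W}
    (hu : u ∈ Subgroup.closure (cs.canonicalGenerators J))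
    (h : ∀ t ∈ J, cs.inversionSign u t = 0) : u = 1 := by
  rw [← Subgroup.mem_toSubmonoid, Subgroup.closure_toSubmonoid] at hu
  obtain ⟨L, hL, rfl⟩ := Submonoid.exists_list_of_mem_closure hu
  refine hJ.prod_eq_one L (fun x hx => ?_) h
  rcases hL x hx with h | h
  · exact h
  · have := (hJ.isReflection _ h.1).inv
    rw [inv_inv] at this
    rwa [this]

/-- For `r = w s w⁻¹` in `J`, write `w = p w₀` with no inversion of `w₀` in `J`. Then `w₀ s w₀⁻¹` is
a canonical generator, and `p` conjugates it to `r`. -/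
theorem IsClosedReflectionSet.closure_canonicalGenerators (hJ : cs.IsClosedReflectionSet J) :
    Subgroup.closure (cs.canonicalGenerators J) = Subgroup.closure J := by
  have hle : Subgroup.closure (cs.canonicalGenerators J) ≤ Subgroup.closure J :=
    Subgroup.closure_mono fun r hr => hr.1
  refine le_antisymm hle ?_
  rw [Subgroup.closure_le]
  intro r hr
  obtain ⟨w, i, hw⟩ := hJ.isReflection r hr
  obtain ⟨p, hp, w₀, rfl, hw₀⟩ := hJ.exists_eq_mul w
  have e : r = p * (w₀ * cs.simple i * w₀⁻¹) * p⁻¹ := by rw [hw]; group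
  have hq : w₀ * cs.simple i * w₀⁻¹ ∈ J := by
    have := hJ.conj_mem_of_mem_closure (inv_mem (hle hp)) hr
    rw [e] at this
    convert this using 1
    group
  have hq' : w₀ * cs.simple i * w₀⁻¹ ∈ cs.canonicalGenerators J :=
    ⟨hq, fun t ht => inversionSign_conj_of_forall i hw₀ (fun t ht => hJ.conj_mem _ hq t ht) ht⟩
  rw [e]
  exact mul_mem (mul_mem hp (Subgroup.subset_closure hq')) (inv_mem hp)

/-- The reflections of the group generated by a closed set of reflections are the elements of
this set. -/
theorem IsClosedReflectionSet.mem_of_mem_closure (hJ : cs.IsClosedReflectionSet J) {t : W}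
    (ht : cs.IsReflection t) (h : t ∈ Subgroup.closure J) : t ∈ J := by
  obtain ⟨w, i, hw⟩ := ht
  obtain ⟨p, hp, w₀, rfl, hw₀⟩ := hJ.exists_eq_mul w
  have e : t = p * (w₀ * cs.simple i * w₀⁻¹) * p⁻¹ := by rw [hw]; group
  rw [← hJ.closure_canonicalGenerators] at h
  have hq : w₀ * cs.simple i * w₀⁻¹ ∈ Subgroup.closure (cs.canonicalGenerators J) := by
    have := mul_mem (mul_mem (inv_mem hp) h) hp
    rw [e] at this
    convert this using 1
    group
  have hqr : cs.IsReflection (w₀ * cs.simple i * w₀⁻¹) := ⟨w₀, i, rfl⟩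
  have hcl := hJ.closure_canonicalGenerators
  by_cases hqJ : w₀ * cs.simple i * w₀⁻¹ ∈ J
  · rw [e]
    exact hJ.conj_mem_of_mem_closure (hcl ▸ hp) hqJ
  · exfalso
    -- Any inversion in `J` of `w₀ s w₀⁻¹` is this element itself. If it lies outside `J`, it has no
    -- inversion there and so equals 1, contrary to being a reflection.
    have h1 := hJ.eq_one_of_mem_closure hq fun u hu => by
      refine (zmod_two_cases _).resolve_right fun h1 => hqJ ?_
      rw [← inversionSign_conj_of_forall i hw₀ (fun t ht => ?_) hu h1]
      · exact hu
      · have := hJ.conj_mem_of_mem_closure (hcl ▸ hq) ht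
        rwa [hqr.inv] at this
    have h2 := cs.inversionSign_self hqr
    rw [h1, inversionSign_one] at h2
    exact absurd h2 (by decide)

end ClosedReflectionSets

/-! ### The exchange property and Matsumoto's theorem -/

section Matsumoto

variable {B W : Type*} [Group W] {M : CoxeterMatrix B} (cs : CoxeterSystem M W)

theorem mem_rightInvSeq_alternatingWord {i j : B} {n : ℕ} {t : W}
    (h : t ∈ cs.rightInvSeq (alternatingWord i j n)) :
    ∃ k < n, t = (cs.simple j * cs.simple i) ^ k * cs.simple j := by
  induction n generalizing i j t with
  | zero => simp [alternatingWord] at h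
  | succ n ih =>
    rw [alternatingWord_succ, rightInvSeq_concat, List.concat_eq_append, List.mem_append,
      List.mem_map, List.mem_singleton] at h
    rcases h with ⟨u, hu, rfl⟩ | rfl
    · obtain ⟨k, hk, rfl⟩ := ih hu
      refine ⟨k + 1, by omega, ?_⟩
      have hc := (SemiconjBy.pow_right (a := cs.simple j) (x := cs.simple i * cs.simple j)
        (y := cs.simple j * cs.simple i) (by simp [SemiconjBy, mul_assoc]) k).eq
      rw [MulAut.conj_apply, inv_simple, ← mul_assoc, hc, pow_succ]
      simp only [mul_assoc]
    · exact ⟨0, by omega, by simp⟩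

theorem exists_eraseIdx_of_isRightDescent {ω : List B} {i : B}
    (h : cs.IsRightDescent (cs.wordProd ω) i) :
    ∃ k, ∃ hk : k < (cs.rightInvSeq ω).length, (cs.rightInvSeq ω)[k] = cs.simple i ∧
      cs.wordProd ω * cs.simple i = cs.wordProd (ω.eraseIdx k) := by
  have h1 : cs.inversionSign (cs.wordProd ω.reverse) (cs.simple i) = 1 := by
    rw [inversionSign_eq_one_iff, wordProd_reverse, isLeftInversion_inv_iff,
      isRightInversion_simple_iff_isRightDescent]
    exact h
  have h2 := cs.mem_leftInvSeq_of_inversionSign h1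
  rw [leftInvSeq_reverse, List.mem_reverse] at h2
  obtain ⟨k, hk, hk'⟩ := List.getElem_of_mem h2
  refine ⟨k, hk, hk', ?_⟩
  have := cs.wordProd_mul_getD_rightInvSeq ω k
  rwa [List.getD_eq_getElem _ _ hk, hk'] at this

/-- With two right descents, an alternating suffix can be lengthened one letter at a time: exchange
appends the other letter at the cost of deleting one from the prefix. -/
theorem exists_isReduced_append_alternatingWord [Finite W] {w : W} {i j : B} (hij : i ≠ j)
    (hi : cs.IsRightDescent w i) (hj : cs.IsRightDescent w j) (n : ℕ) (hn : n ≤ M i j) :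
    ∃ ν : List B, cs.IsReduced (ν ++ alternatingWord i j n) ∧
      w = cs.wordProd (ν ++ alternatingWord i j n) := by
  induction n generalizing i j with
  | zero =>
    obtain ⟨ω, hω, rfl⟩ := cs.exists_isReduced w
    exact ⟨ω, by simpa [alternatingWord] using hω, by simp [alternatingWord]⟩
  | succ n ih =>
    obtain ⟨ν, hν, hw⟩ := ih hij.symm hj hi (by rw [M.symmetric]; omega)
    have hj' := hj
    rw [hw] at hj
    obtain ⟨k, hk, hk1, hk2⟩ := cs.exists_eraseIdx_of_isRightDescent hj
    rw [length_rightInvSeq] at hk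
    rcases Nat.lt_or_ge k ν.length with hkν | hkν
    · refine ⟨ν.eraseIdx k, ?_⟩
      rw [List.eraseIdx_append_of_lt_length hkν] at hk2
      have hw' : w = cs.wordProd (ν.eraseIdx k ++ alternatingWord i j (n + 1)) := by
        rw [alternatingWord_succ, List.concat_eq_append, ← List.append_assoc, wordProd_append,
          ← hk2, ← hw]
        simp
      refine ⟨?_, hw'⟩
      rw [IsReduced, ← hw', hw, hν.eq]
      simp [List.length_eraseIdx_of_lt hkν]
      omega
    -- A deletion inside the alternating suffix would make `s_j` one of its inversions, which gives
    -- `(s_i s_j) ^ (l + 1) = 1` with `l + 1 < M i j`.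
    · exfalso
      have h1 : cs.simple j ∈ cs.rightInvSeq (alternatingWord j i n) := by
        have h2 : (ν ++ alternatingWord j i n).drop ν.length = alternatingWord j i n :=
          List.drop_left
        rw [← h2, rightInvSeq_drop, ← hk1, List.mem_drop_iff_getElem]
        refine ⟨k - ν.length, ?_, ?_⟩
        · rw [length_rightInvSeq]; omega
        · congr 1; omega
      obtain ⟨l, hl, hl'⟩ := cs.mem_rightInvSeq_alternatingWord h1
      refine cs.simple_mul_simple_pow_ne_one hij (n := l + 1) (by omega) (Or.inr (by omega)) ?_
      rw [pow_succ, ← mul_assoc, ← hl', simple_mul_simple_self]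

/-- Matsumoto's theorem. -/
theorem prod_map_eq_of_isReduced [Finite W] {N : Type*} [Monoid N] (f : B → N)
    (hf : ∀ i j, ((braidWord M i j).map f).prod = ((braidWord M j i).map f).prod)
    {ω ω' : List B} (hω : cs.IsReduced ω) (hω' : cs.IsReduced ω')
    (h : cs.wordProd ω = cs.wordProd ω') : (ω.map f).prod = (ω'.map f).prod := by
  induction hn : ω.length generalizing ω ω' with
  | zero =>
    have h2 : ω'.length = 0 := by rw [← hω'.eq, ← h, hω.eq, hn]
    rw [List.length_eq_zero_iff.1 hn, List.length_eq_zero_iff.1 h2]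
  | succ n ih =>
    have hn' : ω'.length = n + 1 := by rw [← hω'.eq, ← h, hω.eq, hn]
    have key : ∀ (μ μ' : List B) (i : B), cs.IsReduced (μ ++ [i]) → cs.IsReduced (μ' ++ [i]) →
        cs.wordProd (μ ++ [i]) = cs.wordProd (μ' ++ [i]) → (μ ++ [i]).length = n + 1 →
        ((μ ++ [i]).map f).prod = ((μ' ++ [i]).map f).prod := by
      intro μ μ' i h1 h2 h3 h4
      have h5 : cs.IsReduced μ := by simpa using h1.take μ.length
      have h6 : cs.IsReduced μ' := by simpa using h2.take μ'.length
      rw [wordProd_append, wordProd_append] at h3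
      have := ih h5 h6 (mul_right_cancel h3) (by simpa using h4)
      simp only [List.map_append, List.prod_append, this]
    obtain ⟨μ, i, rfl⟩ : ∃ μ i, ω = μ ++ [i] :=
      ⟨_, _, (List.dropLast_append_getLast (by rintro rfl; simp at hn)).symm⟩
    obtain ⟨μ', j, rfl⟩ : ∃ μ i, ω' = μ ++ [i] :=
      ⟨_, _, (List.dropLast_append_getLast (by rintro rfl; simp at hn')).symm⟩
    by_cases hij : i = j
    · subst hij
      exact key _ _ _ hω hω' h hn
    have desc : ∀ (μ : List B) (i : B), cs.IsReduced (μ ++ [i]) →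
        cs.IsRightDescent (cs.wordProd (μ ++ [i])) i := by
      intro μ i h1
      rw [IsRightDescent, h1.eq, wordProd_append, wordProd_singleton,
        simple_mul_simple_cancel_right]
      exact (cs.length_wordProd_le μ).trans_lt (by simp)
    have hi := desc _ _ hω
    have hj := desc _ _ hω'
    rw [← h] at hj
    -- When the last letters differ, both words are compared with `ν` followed by one of the two
    -- braid words: each of these shares its last letter with one of the given words.
    obtain ⟨ν, hν, hw⟩ := cs.exists_isReduced_append_alternatingWord hij hi hj (M i j) le_rfl
    obtain ⟨m, hm⟩ := Nat.exists_eq_succ_of_ne_zero (cs.matrix_ne_zero i j)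
    have hb : cs.wordProd (ν ++ braidWord M i j) = cs.wordProd (ν ++ braidWord M j i) := by
      rw [wordProd_append, wordProd_append, wordProd_braidWord_eq]
    have hν' : cs.IsReduced (ν ++ braidWord M j i) := by
      rw [IsReduced, ← hb, hν.eq]
      simp [M.symmetric i j]
    have e1 : ν ++ braidWord M i j = (ν ++ alternatingWord j i m) ++ [j] := by
      rw [braidWord, hm, Nat.succ_eq_add_one, alternatingWord_succ, List.concat_eq_append,
        List.append_assoc]
    have e2 : ν ++ braidWord M j i = (ν ++ alternatingWord i j m) ++ [i] := by
      rw [braidWord, M.symmetric j i, hm, Nat.succ_eq_add_one, alternatingWord_succ,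
        List.concat_eq_append, List.append_assoc]
    change cs.IsReduced (ν ++ braidWord M i j) at hν
    change _ = cs.wordProd (ν ++ braidWord M i j) at hw
    have f1 := key μ (ν ++ alternatingWord i j m) i hω (e2 ▸ hν') (by rw [← e2, ← hb, hw]) hn
    have f2 := key μ' (ν ++ alternatingWord j i m) j hω' (e1 ▸ hν) (by rw [← e1, ← hw, h]) hn'
    rw [f1, f2, ← e1, ← e2, List.map_append, List.map_append, List.prod_append, List.prod_append,
      hf i j]

end Matsumoto

end CoxeterSystem

namespace CoxeterSystem

/-! ### Reduced alternating words and descents -/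

section ReducedBraidWords

variable {B W : Type*} [Group W] {M : CoxeterMatrix B} (cs : CoxeterSystem M W)

theorem isReduced_alternatingWord {i j : B} (hij : i ≠ j) (n : ℕ) (hn : n ≤ M i j) :
    cs.IsReduced (alternatingWord i j n) := by
  induction n generalizing i j with
  | zero => simp [alternatingWord, IsReduced]
  | succ n ih =>
    have h1 := ih hij.symm (by rw [M.symmetric]; omega)
    by_contra hred
    have hdesc : cs.IsRightDescent (cs.wordProd (alternatingWord j i n)) j := by
      have h2 : cs.length (cs.wordProd (alternatingWord i j (n + 1))) ≠ n + 1 := by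
        simpa [IsReduced] using hred
      rw [alternatingWord_succ, wordProd_concat] at h2
      have h3 := cs.length_mul_simple (cs.wordProd (alternatingWord j i n)) j
      rw [IsRightDescent]
      rw [h1.eq, length_alternatingWord] at h3 ⊢
      omega
    obtain ⟨k, hk, hk1, -⟩ := cs.exists_eraseIdx_of_isRightDescent hdesc
    obtain ⟨l, hl, hl'⟩ := cs.mem_rightInvSeq_alternatingWord (hk1 ▸ List.getElem_mem hk)
    refine cs.simple_mul_simple_pow_ne_one hij (n := l + 1) (by omega) (Or.inr (by omega)) ?_
    rw [pow_succ, ← mul_assoc, ← hl', simple_mul_simple_self]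

theorem inversionSign_eq_zero_of_not_isLeftDescent {w : W} {i : B} (h : ¬cs.IsLeftDescent w i) :
    cs.inversionSign w (cs.simple i) = 0 := by
  refine (zmod_two_cases _).resolve_right fun h1 => h ?_
  rw [inversionSign_eq_one_iff, isLeftInversion_simple_iff_isLeftDescent] at h1
  exact h1

theorem inversionSign_eq_zero_of_not_isRightDescent {w : W} {i : B}
    (h : ¬cs.IsRightDescent w i) :
    cs.inversionSign w (w * cs.simple i * w⁻¹) = 0 := by
  refine (zmod_two_cases _).resolve_right fun h1 => h ?_
  rw [inversionSign_eq_one_iff] at h1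
  have := h1.2
  rwa [inv_mul_cancel_right] at this

theorem not_isLeftDescent_of_isReduced_cons {i : B} {ω : List B} (h : cs.IsReduced (i :: ω)) :
    cs.IsReduced ω ∧ ¬cs.IsLeftDescent (cs.wordProd ω) i := by
  have h1 : cs.IsReduced ω := by simpa using h.drop 1
  refine ⟨h1, ?_⟩
  rw [IsLeftDescent, ← wordProd_cons, h.eq, h1.eq]
  simp

end ReducedBraidWords

/-! ### The model of the regular representation -/

section RegularRepresentation

variable {B W : Type*} [Group W] {M : CoxeterMatrix B} (cs : CoxeterSystem M W)
variable (k : Type*) [CommRing k]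

theorem mem_smul_reflectionSubgroups {w t : W} {H : cs.ReflectionSubgroups} :
    t ∈ ((w • H : cs.ReflectionSubgroups) : Subgroup W) ↔ w⁻¹ * t * w ∈ (H : Subgroup W) := by
  rw [coe_smul_reflectionSubgroups, Subgroup.mem_map_equiv, MulAut.conj_symm_apply]

theorem smul_reflectionSubgroups_of_mem {t : W} {H : cs.ReflectionSubgroups}
    (h : t ∈ (H : Subgroup W)) : t • H = H := by
  ext x
  rw [mem_smul_reflectionSubgroups]
  constructor
  · intro h1
    have := mul_mem (mul_mem h h1) (inv_mem h)
    convert this using 1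
    group
  · intro h1
    exact mul_mem (mul_mem (inv_mem h) h1) h

/-- The module underlying the regular representation of `𝒞_W(u)`. -/
abbrev RegularModule : Type _ := (cs.ReflectionSubgroups × W) →₀ k

variable {k} (u : cs.SimpleClass → k)

open Classical in
/-- The structure coefficient of the left multiplication by `g_i`. -/
noncomputable def leftCoeff (i : B) (H : cs.ReflectionSubgroups) (w : W) : k :=
  -- The basis vector `(H, w)` stands for `ε_H g_w`. The quadratic relation contributes only if `s_i
  -- w` is shorter than `w`, and its factor `e_{s_i}` acts on `ε_H` as 1 or 0 according to whether
  -- `s_i ∈ H`.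
  if cs.simple i ∈ (H : Subgroup W) ∧ cs.inversionSign w (cs.simple i) = 1 then
    u (cs.simpleClass i) - 1 else 0

open Classical in
/-- The structure coefficient of the right multiplication by `g_i`. -/
noncomputable def rightCoeff (i : B) (H : cs.ReflectionSubgroups) (w : W) : k :=
  if w * cs.simple i * w⁻¹ ∈ (H : Subgroup W) ∧
    cs.inversionSign w (w * cs.simple i * w⁻¹) = 1 then u (cs.simpleClass i) - 1 else 0

/-- The left multiplication by `g_i`. -/
noncomputable def leftOp (i : B) : Module.End k (cs.RegularModule k) :=
  Finsupp.linearCombination k fun p =>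
    (1 + cs.leftCoeff u i p.1 p.2) • Finsupp.single (cs.simple i • p.1, cs.simple i * p.2) 1 +
      cs.leftCoeff u i p.1 p.2 • Finsupp.single p 1

/-- The right multiplication by `g_i`. -/
noncomputable def rightOp (i : B) : Module.End k (cs.RegularModule k) :=
  Finsupp.linearCombination k fun p =>
    (1 + cs.rightCoeff u i p.1 p.2) • Finsupp.single (p.1, p.2 * cs.simple i) 1 +
      cs.rightCoeff u i p.1 p.2 • Finsupp.single p 1

open Classical in
/-- The left multiplication by `e_t`. -/
noncomputable def idemOp (t : cs.Reflection) : Module.End k (cs.RegularModule k) :=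
  Finsupp.linearCombination k fun p =>
    if (t : W) ∈ (p.1 : Subgroup W) then Finsupp.single p 1 else 0

theorem leftOp_single (i : B) (H : cs.ReflectionSubgroups) (w : W) :
    cs.leftOp u i (Finsupp.single (H, w) 1) =
      (1 + cs.leftCoeff u i H w) • Finsupp.single (cs.simple i • H, cs.simple i * w) 1 +
      cs.leftCoeff u i H w • Finsupp.single (H, w) 1 := by
  simp only [leftOp, Finsupp.linearCombination_single, one_smul]

theorem rightOp_single (i : B) (H : cs.ReflectionSubgroups) (w : W) :
    cs.rightOp u i (Finsupp.single (H, w) 1) =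
      (1 + cs.rightCoeff u i H w) • Finsupp.single (H, w * cs.simple i) 1 +
      cs.rightCoeff u i H w • Finsupp.single (H, w) 1 := by
  simp only [rightOp, Finsupp.linearCombination_single, one_smul]

theorem idemOp_single_of_mem {t : cs.Reflection} {H : cs.ReflectionSubgroups}
    (h : (t : W) ∈ (H : Subgroup W)) (w : W) :
    cs.idemOp t (Finsupp.single (H, w) (1 : k)) = Finsupp.single (H, w) 1 := by
  simp only [idemOp, Finsupp.linearCombination_single, one_smul]
  exact if_pos h

theorem idemOp_single_of_notMem {t : cs.Reflection} {H : cs.ReflectionSubgroups}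
    (h : (t : W) ∉ (H : Subgroup W)) (w : W) :
    cs.idemOp t (Finsupp.single (H, w) (1 : k)) = 0 := by
  simp only [idemOp, Finsupp.linearCombination_single, one_smul]
  exact if_neg h

theorem simpleClass_eq_of_conj {i j : B} {w : W} (h : cs.simple i = w * cs.simple j * w⁻¹) :
    cs.simpleClass i = cs.simpleClass j := by
  apply Subtype.ext
  change ConjClasses.mk (cs.simple i) = ConjClasses.mk (cs.simple j)
  rw [ConjClasses.mk_eq_mk_iff_isConj, isConj_comm, isConj_iff]
  exact ⟨w, h.symm⟩

theorem leftCoeff_mul_right {i j : B} {w : W} (h : cs.simple i ≠ w * cs.simple j * w⁻¹)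
    (H : cs.ReflectionSubgroups) :
    cs.leftCoeff u i H (w * cs.simple j) = cs.leftCoeff u i H w := by
  have : cs.inversionSign (w * cs.simple j) (cs.simple i) = 1 ↔
      cs.inversionSign w (cs.simple i) = 1 := by
    rw [inversionSign_mul_simple]
    tauto
  classical
  exact if_congr (and_congr_right' this) rfl rfl

theorem rightCoeff_mul_left {i j : B} {w : W} (h : cs.simple i ≠ w * cs.simple j * w⁻¹)
    (H : cs.ReflectionSubgroups) :
    cs.rightCoeff u j (cs.simple i • H) (cs.simple i * w) = cs.rightCoeff u j H w := by
  classical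
  have e : (cs.simple i)⁻¹ * (cs.simple i * w * cs.simple j * (cs.simple i * w)⁻¹) *
      cs.simple i = w * cs.simple j * w⁻¹ := by group
  have h1 : cs.simple i * w * cs.simple j * (cs.simple i * w)⁻¹ ∈
      ((cs.simple i • H : cs.ReflectionSubgroups) : Subgroup W) ↔
      w * cs.simple j * w⁻¹ ∈ (H : Subgroup W) := by
    rw [mem_smul_reflectionSubgroups, e]
  have h2 : cs.inversionSign (cs.simple i * w)
      (cs.simple i * w * cs.simple j * (cs.simple i * w)⁻¹) =
      cs.inversionSign w (w * cs.simple j * w⁻¹) := by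
    rw [inversionSign_mul, e, inversionSign_simple, if_neg, zero_add]
    intro h3
    apply h
    rw [← e, h3]
    simp
  classical
  exact if_congr (and_congr h1 (by rw [h2])) rfl rfl

theorem rightCoeff_eq_leftCoeff {i j : B} {w : W} (h : cs.simple i = w * cs.simple j * w⁻¹)
    (H : cs.ReflectionSubgroups) : cs.rightCoeff u j H w = cs.leftCoeff u i H w := by
  classical
  rw [rightCoeff, leftCoeff, ← cs.simpleClass_eq_of_conj h]
  exact if_congr (by rw [← h]) rfl rfl

theorem simple_smul_eq_or (i : B) (H : cs.ReflectionSubgroups) :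
    cs.simple i • H = H ∨ ∀ w, cs.leftCoeff u i H w = 0 := by
  by_cases h : cs.simple i ∈ (H : Subgroup W)
  · exact Or.inl (cs.smul_reflectionSubgroups_of_mem h)
  · exact Or.inr fun w => if_neg fun h1 => h h1.1

theorem leftCoeff_simple_smul (i : B) (H : cs.ReflectionSubgroups) (w : W) :
    cs.leftCoeff u i (cs.simple i • H) w = cs.leftCoeff u i H w := by
  have : cs.simple i ∈ ((cs.simple i • H : cs.ReflectionSubgroups) : Subgroup W) ↔
      cs.simple i ∈ (H : Subgroup W) := by
    rw [mem_smul_reflectionSubgroups]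
    simp
  classical
  exact if_congr (and_congr_left' this) rfl rfl

/-- If `s_i ≠ w s_j w⁻¹`, neither operator affects the coefficient of the other. If `s_i w = w s_j`,
the left and right coefficients coincide, and they vanish unless `s_i` fixes `H`. -/
theorem leftOp_mul_rightOp (i j : B) :
    cs.leftOp u i * cs.rightOp u j = cs.rightOp u j * cs.leftOp u i := by
  ext1 ⟨H, w⟩
  ext1
  simp only [LinearMap.comp_apply, Finsupp.lsingle_apply, Module.End.mul_apply, rightOp_single,
    leftOp_single, map_add, map_smul]
  by_cases h : cs.simple i = w * cs.simple j * w⁻¹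
  · have hw : w * cs.simple j = cs.simple i * w := by rw [h]; group
    have h' : cs.simple i = (cs.simple i * w) * cs.simple j * (cs.simple i * w)⁻¹ := by
      rw [mul_assoc (cs.simple i) w, hw]; simp
    rw [cs.rightCoeff_eq_leftCoeff u h, cs.rightCoeff_eq_leftCoeff u h', hw,
      leftCoeff_simple_smul, mul_assoc, hw, simple_mul_simple_cancel_left]
    rcases cs.simple_smul_eq_or u i H with h1 | h1
    · rw [h1]
    · rw [h1, h1]; module
  · rw [cs.leftCoeff_mul_right u h, cs.rightCoeff_mul_left u h, mul_assoc]
    module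

/-- Right multiplication along ascents takes `(H, 1)` to every `(H, w)`, so the vectors `(H, 1)`
generate the module under the right operators. -/
theorem ext_of_commute_rightOp {X Y : Module.End k (cs.RegularModule k)}
    (hX : ∀ j, X * cs.rightOp u j = cs.rightOp u j * X)
    (hY : ∀ j, Y * cs.rightOp u j = cs.rightOp u j * Y)
    (h : ∀ H, X (Finsupp.single (H, 1) 1) = Y (Finsupp.single (H, 1) 1)) : X = Y := by
  ext1 ⟨H, w⟩
  ext1
  simp only [LinearMap.comp_apply, Finsupp.lsingle_apply]
  induction hn : cs.length w using Nat.strong_induction_on generalizing w with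
  | _ n ih =>
    subst hn
    by_cases h1 : w = 1
    · rw [h1, h]
    obtain ⟨j, hj⟩ := cs.exists_rightDescent_of_ne_one h1
    have hd : ¬cs.IsRightDescent (w * cs.simple j) j :=
      (cs.isRightDescent_iff_not_isRightDescent_mul).1 hj
    have h0 : cs.rightCoeff u j H (w * cs.simple j) = 0 := by
      rw [rightCoeff, cs.inversionSign_eq_zero_of_not_isRightDescent hd, if_neg]
      simp
    have h2 := cs.rightOp_single u j H (w * cs.simple j)
    rw [h0, add_zero, one_smul, zero_smul, add_zero, simple_mul_simple_cancel_right] at h2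
    rw [← h2, ← Module.End.mul_apply, ← Module.End.mul_apply, hX, hY, Module.End.mul_apply,
      Module.End.mul_apply, ih _ hj _ rfl]

theorem prod_leftOp_single {ω : List B} (hω : cs.IsReduced ω) (H : cs.ReflectionSubgroups) :
    (ω.map (cs.leftOp u)).prod (Finsupp.single (H, 1) 1) =
      Finsupp.single (cs.wordProd ω • H, cs.wordProd ω) 1 := by
  induction ω with
  | nil => simp
  | cons i ω ih =>
    obtain ⟨h1, h2⟩ := cs.not_isLeftDescent_of_isReduced_cons hω
    rw [List.map_cons, List.prod_cons, Module.End.mul_apply, ih h1, leftOp_single, leftCoeff,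
      cs.inversionSign_eq_zero_of_not_isLeftDescent h2, if_neg (by simp), wordProd_cons, mul_smul]
    simp

theorem prod_leftOp_mul_rightOp (ω : List B) (j : B) :
    (ω.map (cs.leftOp u)).prod * cs.rightOp u j = cs.rightOp u j * (ω.map (cs.leftOp u)).prod := by
  change Commute _ _
  apply Commute.list_prod_left
  intro x hx
  obtain ⟨i, _, rfl⟩ := List.mem_map.1 hx
  exact cs.leftOp_mul_rightOp u i j

/-- Both sides commute with the right operators, and both braid words are reduced words of the same
element. Hence they agree on the generators `(H, 1)`. -/
theorem leftOp_braid (i j : B) :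
    ((braidWord M i j).map (cs.leftOp u)).prod = ((braidWord M j i).map (cs.leftOp u)).prod := by
  by_cases hij : i = j
  · rw [hij]
  refine cs.ext_of_commute_rightOp u (cs.prod_leftOp_mul_rightOp u _)
    (cs.prod_leftOp_mul_rightOp u _) fun H => ?_
  rw [prod_leftOp_single _ _ (cs.isReduced_alternatingWord hij _ le_rfl),
    prod_leftOp_single _ _ (cs.isReduced_alternatingWord (Ne.symm hij) _ le_rfl),
    wordProd_braidWord_eq]

theorem idemOp_mul_self (t : cs.Reflection) :
    cs.idemOp t * cs.idemOp t = (cs.idemOp t : Module.End k (cs.RegularModule k)) := by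
  ext1 ⟨H, w⟩
  ext1
  simp only [LinearMap.comp_apply, Finsupp.lsingle_apply, Module.End.mul_apply]
  by_cases h : (t : W) ∈ (H : Subgroup W)
  · rw [idemOp_single_of_mem _ h, idemOp_single_of_mem _ h]
  · rw [idemOp_single_of_notMem _ h, map_zero]

theorem idemOp_comm (t₁ t₂ : cs.Reflection) :
    cs.idemOp t₁ * cs.idemOp t₂ =
      (cs.idemOp t₂ * cs.idemOp t₁ : Module.End k (cs.RegularModule k)) := by
  ext1 ⟨H, w⟩
  ext1
  simp only [LinearMap.comp_apply, Finsupp.lsingle_apply, Module.End.mul_apply]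
  by_cases h₁ : (t₁ : W) ∈ (H : Subgroup W) <;> by_cases h₂ : (t₂ : W) ∈ (H : Subgroup W) <;>
    simp only [idemOp_single_of_mem, idemOp_single_of_notMem, h₁, h₂, map_zero, not_false_eq_true]

theorem idemOp_mul_conj (t t₁ : cs.Reflection) :
    cs.idemOp t * cs.idemOp t₁ =
      (cs.idemOp t * cs.idemOp (cs.conjRefl t t₁) : Module.End k (cs.RegularModule k)) := by
  rw [idemOp_comm, cs.idemOp_comm t]
  ext1 ⟨H, w⟩
  ext1
  simp only [LinearMap.comp_apply, Finsupp.lsingle_apply, Module.End.mul_apply]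
  by_cases h : (t : W) ∈ (H : Subgroup W)
  · have h1 : ((cs.conjRefl t t₁ : cs.Reflection) : W) ∈ (H : Subgroup W) ↔
        (t₁ : W) ∈ (H : Subgroup W) := by
      rw [conjRefl, Subgroup.mul_mem_cancel_right _ (inv_mem h), Subgroup.mul_mem_cancel_left _ h]
    rw [idemOp_single_of_mem _ h]
    by_cases h₁ : (t₁ : W) ∈ (H : Subgroup W)
    · rw [idemOp_single_of_mem _ h₁, idemOp_single_of_mem _ (h1.2 h₁)]
    · rw [idemOp_single_of_notMem _ h₁, idemOp_single_of_notMem _ (fun h => h₁ (h1.1 h))]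
  · rw [idemOp_single_of_notMem _ h, map_zero, map_zero]

theorem leftOp_mul_idemOp (i : B) (t : cs.Reflection) :
    cs.leftOp u i * cs.idemOp t = cs.idemOp (cs.conjRefl (cs.simple i) t) * cs.leftOp u i := by
  ext1 ⟨H, w⟩
  ext1
  simp only [LinearMap.comp_apply, Finsupp.lsingle_apply, Module.End.mul_apply,
    leftOp_single, map_add, map_smul]
  have h1 : ((cs.conjRefl (cs.simple i) t : cs.Reflection) : W) ∈
      ((cs.simple i • H : cs.ReflectionSubgroups) : Subgroup W) ↔ (t : W) ∈ (H : Subgroup W) := by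
    rw [mem_smul_reflectionSubgroups, conjRefl]
    simp [mul_assoc]
  have h2 : cs.leftCoeff u i H w • cs.idemOp (cs.conjRefl (cs.simple i) t)
      (Finsupp.single (H, w) (1 : k)) =
      cs.leftCoeff u i H w • cs.idemOp t (Finsupp.single (H, w) (1 : k)) := by
    by_cases h : cs.simple i ∈ (H : Subgroup W)
    · rw [cs.smul_reflectionSubgroups_of_mem h] at h1
      congr 1
      by_cases h₁ : (t : W) ∈ (H : Subgroup W)
      · rw [idemOp_single_of_mem _ h₁, idemOp_single_of_mem _ (h1.2 h₁)]
      · rw [idemOp_single_of_notMem _ h₁, idemOp_single_of_notMem _ (fun h => h₁ (h1.1 h))]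
    · have h0 : cs.leftCoeff u i H w = 0 := if_neg fun h1 => h h1.1
      rw [h0, zero_smul, zero_smul]
  rw [h2]
  by_cases h : (t : W) ∈ (H : Subgroup W)
  · rw [idemOp_single_of_mem _ h, idemOp_single_of_mem _ (h1.2 h), leftOp_single]
  · rw [idemOp_single_of_notMem _ h, idemOp_single_of_notMem _ (fun h' => h (h1.1 h'))]
    simp

theorem leftCoeff_of_mem {i : B} {H : cs.ReflectionSubgroups} {w : W}
    (h : cs.simple i ∈ (H : Subgroup W)) (hw : cs.inversionSign w (cs.simple i) = 1) :
    cs.leftCoeff u i H w = u (cs.simpleClass i) - 1 := if_pos ⟨h, hw⟩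

theorem leftCoeff_of_inversionSign {i : B} {H : cs.ReflectionSubgroups} {w : W}
    (hw : cs.inversionSign w (cs.simple i) = 0) : cs.leftCoeff u i H w = 0 :=
  if_neg fun h => by rw [hw] at h; exact absurd h.2 (by decide)

theorem leftOp_quadratic (i : B) :
    cs.leftOp u i * cs.leftOp u i =
      1 + algebraMap k (Module.End k (cs.RegularModule k)) (u (cs.simpleClass i) - 1) *
        cs.idemOp (cs.simpleRefl i) * (1 + cs.leftOp u i) := by
  ext1 ⟨H, w⟩
  ext1
  have h1 : cs.inversionSign (cs.simple i * w) (cs.simple i) =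
      1 + cs.inversionSign w (cs.simple i) := cs.inversionSign_simple_mul_self i w
  simp only [LinearMap.comp_apply, Finsupp.lsingle_apply, Module.End.mul_apply, LinearMap.add_apply,
    leftOp_single, map_add, map_smul, simple_mul_simple_cancel_left,
    leftCoeff_simple_smul, Module.End.one_apply, Module.algebraMap_end_apply]
  rw [← mul_smul, simple_mul_simple_self, one_smul]
  by_cases h : cs.simple i ∈ (H : Subgroup W)
  · have h' : (cs.simpleRefl i : W) ∈ (H : Subgroup W) := h
    rw [cs.smul_reflectionSubgroups_of_mem h, idemOp_single_of_mem _ h',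
      idemOp_single_of_mem _ h']
    rcases zmod_two_cases (cs.inversionSign w (cs.simple i)) with h2 | h2
    · rw [h2, add_zero] at h1
      rw [cs.leftCoeff_of_mem u h h1, cs.leftCoeff_of_inversionSign u h2]
      module
    · rw [h2, CharTwo.add_self_eq_zero] at h1
      rw [cs.leftCoeff_of_mem u h h2, cs.leftCoeff_of_inversionSign u h1]
      module
  · have h0 : ∀ w, cs.leftCoeff u i H w = 0 := fun w => if_neg fun h1 => h h1.1
    have h₁ : (cs.simpleRefl i : W) ∉ (H : Subgroup W) := h
    have h₂ : (cs.simpleRefl i : W) ∉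
        ((cs.simple i • H : cs.ReflectionSubgroups) : Subgroup W) := by
      rw [mem_smul_reflectionSubgroups]
      simpa [simpleRefl] using h
    rw [idemOp_single_of_notMem _ h₁, idemOp_single_of_notMem _ h₂, h0, h0]
    simp

end RegularRepresentation

end CoxeterSystem

/-! ### Atoms of a finite family of commuting idempotents -/

section Atoms

open Finset

/-- Expand the product of `e t + (1 - e t) = 1` over all `t`. -/
theorem exists_atoms_of_comm {T C : Type*} [Fintype T] [DecidableEq T] [CommRing C] (e : T → C)
    (he : ∀ t, e t * e t = e t) : ∃ ε : Finset T → C, ∑ J, ε J = 1 ∧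
      (∀ t J, t ∈ J → e t * ε J = ε J) ∧ (∀ t J, t ∉ J → e t * ε J = 0) := by
  refine ⟨fun J => (∏ i ∈ J, e i) * ∏ i ∈ univ \ J, (1 - e i), ?_, fun t J h => ?_,
    fun t J h => ?_⟩
  · have := Finset.prod_add e (fun i => 1 - e i) univ
    rw [Finset.powerset_univ] at this
    rw [← this]
    simp
  · beta_reduce
    rw [← Finset.mul_prod_erase J e h, ← mul_assoc, ← mul_assoc, he]
  · have ht : t ∈ univ \ J := by simpa using h
    beta_reduce
    rw [← Finset.mul_prod_erase _ (fun i => 1 - e i) ht, mul_left_comm, ← mul_assoc (e t),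
      mul_sub, mul_one, he, sub_self, zero_mul, mul_zero]

theorem exists_atoms {T A : Type*} [Fintype T] [DecidableEq T] [Ring A] (e : T → A)
    (he : ∀ t, e t * e t = e t) (hc : ∀ t t', e t * e t' = e t' * e t) :
    ∃ ε : Finset T → A, ∑ J, ε J = 1 ∧
      (∀ t J, t ∈ J → e t * ε J = ε J) ∧ (∀ t J, t ∉ J → e t * ε J = 0) ∧
      (∀ t J, ε J * e t = e t * ε J) := by
  have := Subring.isMulCommutative_closure (s := Set.range e)
    (by rintro _ ⟨t, rfl⟩ _ ⟨t', rfl⟩; exact hc t t')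
  let _ : CommRing (Subring.closure (Set.range e)) :=
    { (inferInstance : Ring (Subring.closure (Set.range e))) with
      mul_comm := this.is_comm.comm }
  let e' : T → Subring.closure (Set.range e) := fun t => ⟨e t, Subring.subset_closure ⟨t, rfl⟩⟩
  obtain ⟨ε, h1, h2, h3⟩ := exists_atoms_of_comm e' fun t => Subtype.ext (he t)
  refine ⟨fun J => ε J, ?_, fun t J h => ?_, fun t J h => ?_, fun t J => ?_⟩
  · have := congrArg (Subring.closure (Set.range e)).subtype h1
    rw [map_sum, map_one] at this
    exact this
  · exact congrArg Subtype.val (h2 t J h)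
  · exact congrArg Subtype.val (h3 t J h)
  · exact congrArg Subtype.val (mul_comm (ε J) (e' t))

end Atoms

namespace CoxeterSystem

/-! ### Idempotents indexed by reflection subgroups -/

section Idempotents

variable {B W : Type*} [Group W] [Finite W] {M : CoxeterMatrix B} (cs : CoxeterSystem M W)

noncomputable instance : Fintype cs.ReflectionSubgroups := Fintype.ofFinite _

/-- `ε` is the family of primitive idempotents, indexed by the reflection subgroups, of the
commutative ring generated by the idempotents `E t`. -/
structure IsAtomFamily {A : Type*} [Ring A] (E : cs.Reflection → A)
    (ε : cs.ReflectionSubgroups → A) : Prop where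
  sum_eq_one : ∑ H, ε H = 1
  mul_left_of_mem : ∀ (t : cs.Reflection) (H : cs.ReflectionSubgroups), (t : W) ∈ (H : Subgroup W) → E t * ε H = ε H
  mul_left_of_notMem : ∀ (t : cs.Reflection) (H : cs.ReflectionSubgroups),
    (t : W) ∉ (H : Subgroup W) → E t * ε H = 0
  comm : ∀ t H, ε H * E t = E t * ε H

variable {cs}

theorem closure_reflections (H : cs.ReflectionSubgroups) :
    Subgroup.closure {t | t ∈ (H : Subgroup W) ∧ cs.IsReflection t} = H := by
  obtain ⟨J, _, hJ, hH⟩ := H.2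
  refine le_antisymm ?_ ?_
  · rw [Subgroup.closure_le]
    exact fun t ht => ht.1
  · conv_lhs => rw [← hH]
    apply Subgroup.closure_mono
    exact fun t ht => ⟨hH ▸ Subgroup.subset_closure ht, hJ t ht⟩

theorem exists_reflection_of_ne {H K : cs.ReflectionSubgroups} (h : H ≠ K) :
    ∃ t : cs.Reflection, ((t : W) ∈ (H : Subgroup W) ∧ (t : W) ∉ (K : Subgroup W)) ∨
      ((t : W) ∉ (H : Subgroup W) ∧ (t : W) ∈ (K : Subgroup W)) := by
  by_contra! h1
  apply h
  apply Subtype.ext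
  rw [← closure_reflections H, ← closure_reflections K]
  congr 1
  ext t
  simp only [Set.mem_ofPred_eq, and_congr_left_iff]
  intro ht
  have := h1 ⟨t, ht⟩
  tauto

theorem IsClosedReflectionSet.exists_reflectionSubgroup {J : Set W}
    (hJ : cs.IsClosedReflectionSet J) : ∃ H : cs.ReflectionSubgroups,
      ∀ t : cs.Reflection, (t : W) ∈ (H : Subgroup W) ↔ (t : W) ∈ J :=
  ⟨⟨Subgroup.closure J, J, J.toFinite, hJ.isReflection, rfl⟩, fun t =>
    ⟨fun h => hJ.mem_of_mem_closure t.2 h, fun h => Subgroup.subset_closure h⟩⟩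

/-- Among the atoms indexed by all sets of reflections, the conjugation relation leaves only those
of closed sets, and closed sets correspond to reflection subgroups. -/
theorem exists_isAtomFamily {A : Type*} [Ring A] (E : cs.Reflection → A)
    (h1 : ∀ t, E t * E t = E t) (h2 : ∀ t t', E t * E t' = E t' * E t)
    (h3 : ∀ t t₁, E t * E t₁ = E t * E (cs.conjRefl t t₁)) :
    ∃ ε, cs.IsAtomFamily E ε := by
  classical
  let _ : Fintype cs.Reflection := Fintype.ofFinite _
  obtain ⟨ε, hs, hm, hn, hc⟩ := exists_atoms E h1 h2
  let R : cs.ReflectionSubgroups → Finset cs.Reflection :=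
    fun H => Finset.univ.filter fun t => (t : W) ∈ (H : Subgroup W)
  have hR : ∀ t H, t ∈ R H ↔ (t : W) ∈ (H : Subgroup W) := fun t H => by simp [R]
  have hinj : Function.Injective R := by
    intro H K hHK
    by_contra hne
    obtain ⟨t, ht⟩ := exists_reflection_of_ne hne
    rw [← hR, ← hR, hHK] at ht
    tauto
  have hzero : ∀ J ∉ Set.range R, ε J = 0 := by
    intro J hJ
    by_contra hne
    apply hJ
    have hcl : cs.IsClosedReflectionSet ((fun t : cs.Reflection => (t : W)) '' (J : Set _)) := by
      refine ⟨?_, ?_⟩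
      · rintro _ ⟨t, _, rfl⟩
        exact t.2
      · rintro _ ⟨t, ht, rfl⟩ _ ⟨t₁, ht₁, rfl⟩
        -- On the atom of `J` both `E t` and `E t₁` act as 1, so `E (t t₁ t⁻¹)` cannot act as 0
        -- unless the atom vanishes.
        have hmem : cs.conjRefl t t₁ ∈ J := by
          by_contra hnot
          apply hne
          rw [← hm t J ht, ← hm t₁ J ht₁, ← mul_assoc, h3, mul_assoc, hn _ J hnot, mul_zero]
        refine ⟨_, hmem, ?_⟩
        simp only [conjRefl]
        rw [t.2.inv]
    obtain ⟨H, hH⟩ := hcl.exists_reflectionSubgroup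
    refine ⟨H, ?_⟩
    ext t
    rw [hR, hH]
    simpa using fun _ => t.2
  refine ⟨fun H => ε (R H), ?_, ?_, ?_, ?_⟩
  · rw [← hs]
    exact Fintype.sum_of_injective R hinj _ _ hzero fun _ => rfl
  · exact fun t H h => hm _ _ ((hR _ _).2 h)
  · exact fun t H h => hn _ _ fun h' => h ((hR _ _).1 h')
  · exact fun t H => hc _ _

namespace IsAtomFamily

variable {A : Type*} [Ring A] {E : cs.Reflection → A} {ε ε' : cs.ReflectionSubgroups → A}

/-- A reflection that lies in exactly one of `w⁻¹ K w` and `H` acts by 1 from one side and by 0 from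
the other. Allowing two families yields uniqueness of the atoms from `x = 1`. -/
theorem mul_mul_eq_zero (h : cs.IsAtomFamily E ε) (h' : cs.IsAtomFamily E ε') {x : A} {w : W}
    (hx : ∀ t, x * E t = E (cs.conjRefl w t) * x) {H K : cs.ReflectionSubgroups}
    (hne : K ≠ w • H) : ε K * x * ε' H = 0 := by
  have hne' : w⁻¹ • K ≠ H := fun e => hne (by rw [← e, smul_inv_smul])
  have hmem : ∀ t : cs.Reflection, (t : W) ∈ ((w⁻¹ • K : cs.ReflectionSubgroups) : Subgroup W) ↔
      ((cs.conjRefl w t : cs.Reflection) : W) ∈ (K : Subgroup W) := by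
    intro t
    rw [mem_smul_reflectionSubgroups, inv_inv, conjRefl]
  obtain ⟨t, ht | ht⟩ := exists_reflection_of_ne hne'
  · rw [← h.mul_left_of_mem _ K ((hmem t).1 ht.1), ← h.comm, mul_assoc (ε K), ← hx, mul_assoc,
      mul_assoc, h'.mul_left_of_notMem _ _ ht.2, mul_zero, mul_zero]
  · rw [← h'.mul_left_of_mem _ H ht.2, mul_assoc, ← mul_assoc x, hx, ← mul_assoc, ← mul_assoc,
      h.comm, h.mul_left_of_notMem _ _ (fun h' => ht.1 ((hmem t).2 h')), zero_mul, zero_mul]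

theorem intertwine (h : cs.IsAtomFamily E ε) (h' : cs.IsAtomFamily E ε') {x : A} {w : W}
    (hx : ∀ t, x * E t = E (cs.conjRefl w t) * x) (H : cs.ReflectionSubgroups) :
    x * ε' H = ε (w • H) * x := by
  classical
  have e1 : x * ε' H = ε (w • H) * x * ε' H := by
    calc x * ε' H = (∑ K, ε K) * x * ε' H := by rw [h.sum_eq_one, one_mul]
      _ = ∑ K, ε K * x * ε' H := by rw [Finset.sum_mul, Finset.sum_mul]
      _ = ε (w • H) * x * ε' H := Finset.sum_eq_single_of_mem _ (Finset.mem_univ _)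
        fun K _ hK => h.mul_mul_eq_zero h' hx hK
  have e2 : ε (w • H) * x = ε (w • H) * x * ε' H := by
    calc ε (w • H) * x = ε (w • H) * x * ∑ K, ε' K := by rw [h'.sum_eq_one, mul_one]
      _ = ∑ K, ε (w • H) * x * ε' K := by rw [Finset.mul_sum]
      _ = ε (w • H) * x * ε' H := Finset.sum_eq_single_of_mem _ (Finset.mem_univ _)
        fun K _ hK => h.mul_mul_eq_zero h' hx fun e => hK (smul_left_cancel w e).symm
  rw [e1, ← e2]

theorem one_mul_eq_conj (t : cs.Reflection) : (1 : A) * E t = E (cs.conjRefl 1 t) * 1 := by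
  rw [one_mul, mul_one]
  congr 1
  apply Subtype.ext
  simp [conjRefl]

theorem unique (h : cs.IsAtomFamily E ε) (h' : cs.IsAtomFamily E ε') : ε' = ε := by
  funext H
  have := h.intertwine h' one_mul_eq_conj H
  rwa [one_mul, one_smul, mul_one] at this

theorem mul_eq_zero (h : cs.IsAtomFamily E ε) {H K : cs.ReflectionSubgroups} (hne : H ≠ K) :
    ε H * ε K = 0 := by
  have := h.mul_mul_eq_zero h one_mul_eq_conj (H := K) (K := H) (by rwa [one_smul])
  rwa [mul_one] at this

theorem mul_self (h : cs.IsAtomFamily E ε) (H : cs.ReflectionSubgroups) : ε H * ε H = ε H := by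
  classical
  calc ε H * ε H = ∑ K, ε H * ε K := (Finset.sum_eq_single_of_mem _ (Finset.mem_univ _)
        fun K _ hK => h.mul_eq_zero (Ne.symm hK)).symm
    _ = ε H := by rw [← Finset.mul_sum, h.sum_eq_one, mul_one]

theorem map {A' : Type*} [Ring A'] (h : cs.IsAtomFamily E ε) (f : A →+* A') :
    cs.IsAtomFamily (fun t => f (E t)) (fun H => f (ε H)) where
  sum_eq_one := by rw [← map_sum, h.sum_eq_one, map_one]
  mul_left_of_mem t H ht := by rw [← map_mul, h.mul_left_of_mem t H ht]
  mul_left_of_notMem t H ht := by rw [← map_mul, h.mul_left_of_notMem t H ht, map_zero]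
  comm t H := by rw [← map_mul, ← map_mul, h.comm]

end IsAtomFamily

end Idempotents

end CoxeterSystem

namespace CoxeterSystem

/-! ### The universal property of the presentation -/

section Presentation

variable {B W : Type*} [Group W] {M : CoxeterMatrix B} (cs : CoxeterSystem M W)
variable {k : Type*} [CommRing k] (u : cs.SimpleClass → k)

/-- The families `G` and `E` satisfy the defining relations of `𝒞_W(u)`. -/
structure SatisfiesRelations {A : Type*} [Ring A] [Algebra k A] (G : B → A)
    (E : cs.Reflection → A) : Prop where
  braid : ∀ i j, ((braidWord M i j).map G).prod = ((braidWord M j i).map G).prod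
  e_idem : ∀ t, E t * E t = E t
  e_comm : ∀ t₁ t₂, E t₁ * E t₂ = E t₂ * E t₁
  e_conj : ∀ t t₁ : cs.Reflection, E t * E t₁ = E t * E (cs.conjRefl t t₁)
  g_e : ∀ i t, G i * E t = E (cs.conjRefl (cs.simple i) t) * G i
  quadratic : ∀ i, G i * G i =
    1 + algebraMap k A (u (cs.simpleClass i) - 1) * E (cs.simpleRefl i) * (1 + G i)

/-- The generator `g_i` of `𝒞_W(u)`. -/
noncomputable def genG (i : B) : cs.CAlgebra k u := RingQuot.mkAlgHom k (cs.CRel k u) (cs.freeG k i)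

/-- The generator `e_t` of `𝒞_W(u)`. -/
noncomputable def genE (t : cs.Reflection) : cs.CAlgebra k u :=
  RingQuot.mkAlgHom k (cs.CRel k u) (cs.freeE k t)

theorem satisfiesRelations_gen : cs.SatisfiesRelations u (cs.genG u) (cs.genE u) where
  braid i j := by
    have := RingQuot.mkAlgHom_rel k (CRel.braid (cs := cs) (k := k) (u := u) i j)
    rw [map_list_prod, map_list_prod, List.map_map, List.map_map] at this
    exact this
  e_idem t := by
    have := RingQuot.mkAlgHom_rel k (CRel.e_idem (cs := cs) (k := k) (u := u) t)
    rwa [map_mul] at this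
  e_comm t t' := by
    have := RingQuot.mkAlgHom_rel k (CRel.e_comm (cs := cs) (k := k) (u := u) t t')
    rwa [map_mul, map_mul] at this
  e_conj t t' := by
    have := RingQuot.mkAlgHom_rel k (CRel.e_conj (cs := cs) (k := k) (u := u) t t')
    rwa [map_mul, map_mul] at this
  g_e i t := by
    have := RingQuot.mkAlgHom_rel k (CRel.g_e (cs := cs) (k := k) (u := u) i t)
    rwa [map_mul, map_mul] at this
  quadratic i := by
    have := RingQuot.mkAlgHom_rel k (CRel.quadratic (cs := cs) (k := k) (u := u) i)
    rwa [map_add, map_mul, map_mul, map_mul, map_add, map_one, AlgHom.commutes] at this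

variable {u} {cs}

/-- The homomorphism from `𝒞_W(u)` determined by the images of the generators. -/
noncomputable def SatisfiesRelations.lift {A : Type*} [Ring A] [Algebra k A] {G : B → A}
    {E : cs.Reflection → A} (h : cs.SatisfiesRelations u G E) : cs.CAlgebra k u →ₐ[k] A :=
  RingQuot.liftAlgHom k ⟨FreeAlgebra.lift k (Sum.elim G E), by
    have hG : ∀ i, FreeAlgebra.lift k (Sum.elim G E) (cs.freeG k i) = G i := fun i => by
      simp [freeG]
    have hE : ∀ t, FreeAlgebra.lift k (Sum.elim G E) (cs.freeE k t) = E t := fun i => by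
      simp [freeE]
    have hG' : (FreeAlgebra.lift k (Sum.elim G E)) ∘ cs.freeG k = G := funext hG
    intro x y hxy
    cases hxy with
    | braid i j => rw [map_list_prod, map_list_prod, List.map_map, List.map_map, hG', h.braid]
    | e_idem t => rw [map_mul, hE, h.e_idem]
    | e_comm t t' => rw [map_mul, map_mul, hE, hE, h.e_comm]
    | e_conj t t' => rw [map_mul, map_mul, hE, hE, hE, h.e_conj]
    | g_e i t => rw [map_mul, map_mul, hG, hE, hE, h.g_e]
    | quadratic i =>
      rw [map_mul, map_add, map_mul, map_mul, map_add, map_one, hG, hE, AlgHom.commutes,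
        h.quadratic]⟩

theorem SatisfiesRelations.lift_genG {A : Type*} [Ring A] [Algebra k A] {G : B → A}
    {E : cs.Reflection → A} (h : cs.SatisfiesRelations u G E) (i : B) :
    h.lift (cs.genG u i) = G i := by
  rw [lift, genG, RingQuot.liftAlgHom_mkAlgHom_apply]
  simp [freeG]

theorem SatisfiesRelations.lift_genE {A : Type*} [Ring A] [Algebra k A] {G : B → A}
    {E : cs.Reflection → A} (h : cs.SatisfiesRelations u G E) (t : cs.Reflection) :
    h.lift (cs.genE u t) = E t := by
  rw [lift, genE, RingQuot.liftAlgHom_mkAlgHom_apply]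
  simp [freeE]

theorem SatisfiesRelations.eq_top {S : Subalgebra k (cs.CAlgebra k u)}
    (hG : ∀ i, cs.genG u i ∈ S) (hE : ∀ t, cs.genE u t ∈ S) : S = ⊤ := by
  rw [eq_top_iff]
  rintro x -
  obtain ⟨y, rfl⟩ := RingQuot.mkAlgHom_surjective k (cs.CRel k u) x
  induction y using FreeAlgebra.induction with
  | grade0 r => rw [AlgHom.commutes]; exact S.algebraMap_mem r
  | grade1 x =>
    cases x with
    | inl i => exact hG i
    | inr t => exact hE t
  | mul a b ha hb => rw [map_mul]; exact mul_mem ha hb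
  | add a b ha hb => rw [map_add]; exact add_mem ha hb

end Presentation

/-! ### The standard basis `ε_H g_w` -/

section Basis

variable {B W : Type*} [Group W] [Finite W] {M : CoxeterMatrix B} (cs : CoxeterSystem M W)
variable {k : Type*} [CommRing k] (u : cs.SimpleClass → k)

/-- The idempotent of `𝒞_W(u)` attached to a reflection subgroup. -/
noncomputable def atom : cs.ReflectionSubgroups → cs.CAlgebra k u :=
  (exists_isAtomFamily (cs.genE u) (cs.satisfiesRelations_gen u).e_idem
    (cs.satisfiesRelations_gen u).e_comm (cs.satisfiesRelations_gen u).e_conj).choose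

theorem isAtomFamily_atom : cs.IsAtomFamily (cs.genE u) (cs.atom u) :=
  (exists_isAtomFamily (cs.genE u) (cs.satisfiesRelations_gen u).e_idem
    (cs.satisfiesRelations_gen u).e_comm (cs.satisfiesRelations_gen u).e_conj).choose_spec

/-- A reduced word of `w`. -/
noncomputable def reducedWord (w : W) : List B := (cs.exists_isReduced w).choose

theorem isReduced_reducedWord (w : W) : cs.IsReduced (cs.reducedWord w) :=
  (cs.exists_isReduced w).choose_spec.1

theorem wordProd_reducedWord (w : W) : cs.wordProd (cs.reducedWord w) = w :=
  (cs.exists_isReduced w).choose_spec.2.symm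

/-- The element `g_w` of `𝒞_W(u)`. -/
noncomputable def basisG (w : W) : cs.CAlgebra k u := ((cs.reducedWord w).map (cs.genG u)).prod

theorem basisG_wordProd {ω : List B} (hω : cs.IsReduced ω) :
    cs.basisG u (cs.wordProd ω) = (ω.map (cs.genG u)).prod :=
  cs.prod_map_eq_of_isReduced (cs.genG u) (cs.satisfiesRelations_gen u).braid
    (cs.isReduced_reducedWord _) hω (cs.wordProd_reducedWord _)

theorem basisG_one : cs.basisG u 1 = 1 := by
  have := cs.basisG_wordProd u (ω := []) (by simp [IsReduced])
  simpa using this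

theorem basisG_simple (i : B) : cs.basisG u (cs.simple i) = cs.genG u i := by
  have := cs.basisG_wordProd u (ω := [i]) (by simp [IsReduced])
  simpa using this

theorem genG_mul_basisG_of_not_isLeftDescent {i : B} {w : W} (h : ¬cs.IsLeftDescent w i) :
    cs.genG u i * cs.basisG u w = cs.basisG u (cs.simple i * w) := by
  have hred : cs.IsReduced (i :: cs.reducedWord w) := by
    rw [IsReduced, wordProd_cons, wordProd_reducedWord, List.length_cons,
      (cs.not_isLeftDescent_iff).1 h, ← (cs.isReduced_reducedWord w).eq, wordProd_reducedWord]
  have := cs.basisG_wordProd u hred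
  rw [wordProd_cons, wordProd_reducedWord] at this
  rw [this, List.map_cons, List.prod_cons, basisG]

theorem genG_mul_basisG_of_isLeftDescent {i : B} {w : W} (h : cs.IsLeftDescent w i) :
    cs.genG u i * cs.basisG u w = cs.basisG u (cs.simple i * w) +
      algebraMap k _ (u (cs.simpleClass i) - 1) * cs.genE u (cs.simpleRefl i) *
        (cs.basisG u (cs.simple i * w) + cs.basisG u w) := by
  have h1 := cs.genG_mul_basisG_of_not_isLeftDescent u
    ((cs.isLeftDescent_iff_not_isLeftDescent_mul).1 h)
  rw [simple_mul_simple_cancel_left] at h1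
  rw [← h1, ← mul_assoc, (cs.satisfiesRelations_gen u).quadratic i]
  simp only [add_mul, mul_add, one_mul, mul_one, mul_assoc]

theorem conjRefl_mul (v w : W) (t : cs.Reflection) :
    cs.conjRefl (v * w) t = cs.conjRefl v (cs.conjRefl w t) := by
  apply Subtype.ext
  simp [conjRefl, mul_assoc]

theorem basisG_mul_genE (w : W) (t : cs.Reflection) :
    cs.basisG u w * cs.genE u t = cs.genE u (cs.conjRefl w t) * cs.basisG u w := by
  suffices h : ∀ ω : List B, (ω.map (cs.genG u)).prod * cs.genE u t =
      cs.genE u (cs.conjRefl (cs.wordProd ω) t) * (ω.map (cs.genG u)).prod by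
    have := h (cs.reducedWord w)
    rwa [wordProd_reducedWord] at this
  intro ω
  induction ω with
  | nil => exact IsAtomFamily.one_mul_eq_conj t
  | cons i ω ih =>
    rw [List.map_cons, List.prod_cons, mul_assoc, ih, ← mul_assoc,
      (cs.satisfiesRelations_gen u).g_e, mul_assoc, wordProd_cons, conjRefl_mul]

theorem basisG_mul_atom (w : W) (H : cs.ReflectionSubgroups) :
    cs.basisG u w * cs.atom u H = cs.atom u (w • H) * cs.basisG u w :=
  (cs.isAtomFamily_atom u).intertwine (cs.isAtomFamily_atom u) (cs.basisG_mul_genE u w) H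

/-- The span contains 1 and is stable under left multiplication by the generators: `g_i` moves past
`ε_H` to `ε_{s_i H}`, and `g_i g_w` is again a combination of the `g` with coefficients from
`e_{s_i}`. -/
theorem span_atom_mul_basisG :
    Submodule.span k (Set.range fun p : cs.ReflectionSubgroups × W =>
      cs.atom u p.1 * cs.basisG u p.2) = ⊤ := by
  set S := Submodule.span k (Set.range fun p : cs.ReflectionSubgroups × W =>
      cs.atom u p.1 * cs.basisG u p.2) with hS
  have hmem : ∀ H w, cs.atom u H * cs.basisG u w ∈ S := fun H w =>
    Submodule.subset_span ⟨(H, w), rfl⟩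
  have hmem' : ∀ w, cs.basisG u w ∈ S := fun w => by
    rw [← one_mul (cs.basisG u w), ← (cs.isAtomFamily_atom u).sum_eq_one, Finset.sum_mul]
    exact sum_mem fun H _ => hmem H w
  have hE : ∀ t, ∀ x ∈ S, cs.genE u t * x ∈ S := by
    intro t x hx
    induction hx using Submodule.span_induction with
    | mem x h =>
      obtain ⟨⟨H, w⟩, rfl⟩ := h
      by_cases ht : (t : W) ∈ (H : Subgroup W)
      · rw [← mul_assoc, (cs.isAtomFamily_atom u).mul_left_of_mem t H ht]
        exact hmem H w
      · rw [← mul_assoc, (cs.isAtomFamily_atom u).mul_left_of_notMem t H ht, zero_mul]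
        exact zero_mem _
    | zero => rw [mul_zero]; exact zero_mem _
    | add x y _ _ hx hy => rw [mul_add]; exact add_mem hx hy
    | smul a x _ hx => rw [mul_smul_comm]; exact S.smul_mem a hx
  have hA : ∀ H, ∀ x ∈ S, cs.atom u H * x ∈ S := by
    intro H x hx
    induction hx using Submodule.span_induction with
    | mem x h =>
      obtain ⟨⟨K, w⟩, rfl⟩ := h
      rw [← mul_assoc]
      by_cases hHK : H = K
      · subst hHK
        rw [(cs.isAtomFamily_atom u).mul_self]
        exact hmem H w
      · rw [(cs.isAtomFamily_atom u).mul_eq_zero hHK, zero_mul]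
        exact zero_mem _
    | zero => rw [mul_zero]; exact zero_mem _
    | add x y _ _ hx hy => rw [mul_add]; exact add_mem hx hy
    | smul a x _ hx => rw [mul_smul_comm]; exact S.smul_mem a hx
  have hGw : ∀ i w, cs.genG u i * cs.basisG u w ∈ S := by
    intro i w
    by_cases h : cs.IsLeftDescent w i
    · rw [cs.genG_mul_basisG_of_isLeftDescent u h, mul_assoc, ← Algebra.smul_def]
      exact add_mem (hmem' _) (S.smul_mem _ (hE _ _ (add_mem (hmem' _) (hmem' _))))
    · rw [cs.genG_mul_basisG_of_not_isLeftDescent u h]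
      exact hmem' _
  have hG : ∀ i, ∀ x ∈ S, cs.genG u i * x ∈ S := by
    intro i x hx
    induction hx using Submodule.span_induction with
    | mem x h =>
      obtain ⟨⟨K, w⟩, rfl⟩ := h
      rw [← mul_assoc, ← basisG_simple, basisG_mul_atom, mul_assoc, basisG_simple]
      exact hA _ _ (hGw i w)
    | zero => rw [mul_zero]; exact zero_mem _
    | add x y _ _ hx hy => rw [mul_add]; exact add_mem hx hy
    | smul a x _ hx => rw [mul_smul_comm]; exact S.smul_mem a hx
  let T : Subalgebra k (cs.CAlgebra k u) :=
    { carrier := {a | ∀ x ∈ S, a * x ∈ S}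
      mul_mem' := fun {a b} ha hb x hx => by rw [mul_assoc]; exact ha _ (hb x hx)
      add_mem' := fun {a b} ha hb x hx => by rw [add_mul]; exact add_mem (ha x hx) (hb x hx)
      algebraMap_mem' := fun r x hx => by rw [← Algebra.smul_def]; exact S.smul_mem r hx }
  have hT : T = ⊤ := SatisfiesRelations.eq_top hG hE
  rw [eq_top_iff]
  rintro a -
  have ha : a ∈ T := hT ▸ Algebra.mem_top
  have := ha 1 (by rw [← cs.basisG_one u]; exact hmem' 1)
  rwa [mul_one] at this

theorem satisfiesRelations_regular :
    cs.SatisfiesRelations u (cs.leftOp u) (cs.idemOp : _ → Module.End k (cs.RegularModule k)) where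
  braid := cs.leftOp_braid u
  e_idem := cs.idemOp_mul_self
  e_comm := cs.idemOp_comm
  e_conj := cs.idemOp_mul_conj
  g_e := cs.leftOp_mul_idemOp u
  quadratic := cs.leftOp_quadratic u

/-- The regular representation of `𝒞_W(u)`. -/
noncomputable def regularRep : cs.CAlgebra k u →ₐ[k] Module.End k (cs.RegularModule k) :=
  (cs.satisfiesRelations_regular u).lift

theorem regularRep_genE (t : cs.Reflection) : cs.regularRep u (cs.genE u t) = cs.idemOp t :=
  (cs.satisfiesRelations_regular u).lift_genE t

theorem regularRep_basisG (w : W) (H : cs.ReflectionSubgroups) :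
    cs.regularRep u (cs.basisG u w) (Finsupp.single (H, 1) 1) = Finsupp.single (w • H, w) 1 := by
  have h : cs.regularRep u (cs.basisG u w) = ((cs.reducedWord w).map (cs.leftOp u)).prod := by
    rw [basisG, map_list_prod, List.map_map]
    congr 2
    funext i
    exact (cs.satisfiesRelations_regular u).lift_genG i
  rw [h, prod_leftOp_single _ _ (cs.isReduced_reducedWord w), wordProd_reducedWord]

theorem regularRep_atom_of_ne {H K : cs.ReflectionSubgroups} (h : H ≠ K) (w : W) :
    cs.regularRep u (cs.atom u H) (Finsupp.single (K, w) 1) = 0 := by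
  obtain ⟨t, ht | ht⟩ := exists_reflection_of_ne h
  · rw [← (cs.isAtomFamily_atom u).mul_left_of_mem t H ht.1, ← (cs.isAtomFamily_atom u).comm,
      map_mul, Module.End.mul_apply, regularRep_genE, idemOp_single_of_notMem _ ht.2, map_zero]
  · rw [← idemOp_single_of_mem _ ht.2, ← cs.regularRep_genE u, ← Module.End.mul_apply,
      ← map_mul, (cs.isAtomFamily_atom u).comm,
      (cs.isAtomFamily_atom u).mul_left_of_notMem t H ht.1, map_zero, LinearMap.zero_apply]

theorem regularRep_atom_self (H : cs.ReflectionSubgroups) (w : W) :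
    cs.regularRep u (cs.atom u H) (Finsupp.single (H, w) 1) = Finsupp.single (H, w) 1 := by
  classical
  have h : ∑ K, cs.regularRep u (cs.atom u K) (Finsupp.single (H, w) 1) =
      Finsupp.single (H, w) 1 := by
    rw [← LinearMap.sum_apply, ← map_sum, (cs.isAtomFamily_atom u).sum_eq_one, map_one,
      Module.End.one_apply]
  rwa [Finset.sum_eq_single_of_mem H (Finset.mem_univ H)
    fun K _ hK => cs.regularRep_atom_of_ne u hK w] at h

/-- The evaluation of the regular representation at the unit. -/
noncomputable def regularEval : cs.CAlgebra k u →ₗ[k] cs.RegularModule k :=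
  (LinearMap.applyₗ (∑ H : cs.ReflectionSubgroups, Finsupp.single (H, (1 : W)) (1 : k))).comp
    (cs.regularRep u).toLinearMap

/-- The unit `∑ ε_K` corresponds to the sum of the vectors `(K, 1)`. Acting by `g_w` gives the sum
of the `(w • K, w)`, from which `ε_H` selects one term. -/
theorem regularEval_atom_mul_basisG (H : cs.ReflectionSubgroups) (w : W) :
    cs.regularEval u (cs.atom u H * cs.basisG u w) = Finsupp.single (H, w) 1 := by
  classical
  change cs.regularRep u (cs.atom u H * cs.basisG u w)
    (∑ H : cs.ReflectionSubgroups, Finsupp.single (H, (1 : W)) (1 : k)) = _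
  rw [map_mul, Module.End.mul_apply, map_sum]
  simp only [regularRep_basisG]
  rw [map_sum, Finset.sum_eq_single_of_mem (w⁻¹ • H) (Finset.mem_univ _), smul_inv_smul,
    regularRep_atom_self]
  intro K _ hK
  apply regularRep_atom_of_ne
  rintro rfl
  exact hK (inv_smul_smul w K).symm

theorem linearIndependent_atom_mul_basisG :
    LinearIndependent k (fun p : cs.ReflectionSubgroups × W =>
      cs.atom u p.1 * cs.basisG u p.2) := by
  refine LinearIndependent.of_comp (cs.regularEval u) ?_
  have : (cs.regularEval u) ∘ (fun p : cs.ReflectionSubgroups × W =>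
      cs.atom u p.1 * cs.basisG u p.2) = fun p => Finsupp.single p 1 := by
    funext p
    exact cs.regularEval_atom_mul_basisG u p.1 p.2
  rw [this]
  exact Finsupp.linearIndependent_single_one k _

/-- The standard basis of `𝒞_W(u)`. -/
noncomputable def standardBasis : Module.Basis (cs.ReflectionSubgroups × W) k (cs.CAlgebra k u) :=
  Module.Basis.mk (cs.linearIndependent_atom_mul_basisG u) (cs.span_atom_mul_basisG u).ge

theorem standardBasis_apply (H : cs.ReflectionSubgroups) (w : W) :
    cs.standardBasis u (H, w) = cs.atom u H * cs.basisG u w := by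
  rw [standardBasis, Module.Basis.mk_apply]

end Basis

end CoxeterSystem

/-! ### Semisimplicity from a separability idempotent -/

section Separable

/-- An algebra over a field with a separability idempotent is semisimple. -/
theorem isSemisimpleRing_of_separabilityIdempotent {k A ι : Type*} [Field k] [Ring A] [Algebra k A]
    [Fintype ι] (a b : ι → A) (h1 : ∑ i, a i * b i = 1)
    (h2 : ∀ x, ∑ i, (x * a i) ⊗ₜ[k] b i = ∑ i, a i ⊗ₜ[k] (b i * x)) : IsSemisimpleRing A := by
  refine { exists_isCompl := fun N => ?_ }
  obtain ⟨p, hp⟩ := (N.restrictScalars k).exists_isCompl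
  let π : A →ₗ[k] A := (N.restrictScalars k).subtype ∘ₗ (N.restrictScalars k).projectionOnto p hp
  have hπN : ∀ x, π x ∈ N := fun x => ((N.restrictScalars k).projectionOnto p hp x).2
  have hπ : ∀ x ∈ N, π x = x := fun x hx => by
    have := Submodule.projectionOnto_apply_left hp (⟨x, hx⟩ : N.restrictScalars k)
    exact congrArg Subtype.val this
  have hlin : ∀ x y, ∑ i, a i * π (b i * (x * y)) = x * ∑ i, a i * π (b i * y) := by
    intro x y
    let F : A ⊗[k] A →ₗ[k] A := TensorProduct.lift
      ((LinearMap.mul k A).compl₂ (π ∘ₗ (LinearMap.mulRight k y)))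
    have hF : ∀ c d, F (c ⊗ₜ d) = c * π (d * y) := fun c d => rfl
    have := congrArg F (h2 x)
    rw [map_sum, map_sum] at this
    simp only [hF] at this
    rw [Finset.mul_sum]
    simp only [← mul_assoc] at this ⊢
    exact this.symm
  -- A `k`-linear projection onto `N`, averaged by the separability idempotent, becomes `A`-linear
  -- and remains the identity on `N`.
  let P : A →ₗ[A] N :=
    { toFun := fun y => ⟨∑ i, a i * π (b i * y), sum_mem fun i _ => N.smul_mem _ (hπN _)⟩
      map_add' := fun y z => by
        apply Subtype.ext
        simp only [mul_add, map_add, Finset.sum_add_distrib]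
        rfl
      map_smul' := fun x y => Subtype.ext (hlin x y) }
  refine ⟨LinearMap.ker P, LinearMap.isCompl_of_proj (f := P) fun y => ?_⟩
  apply Subtype.ext
  change ∑ i, a i * π (b i * y) = y
  have : ∀ i, a i * π (b i * y) = a i * b i * y := fun i => by
    rw [hπ (b i * y) (N.smul_mem (b i) y.2), mul_assoc]
  simp only [this]
  rw [← Finset.sum_mul, h1, one_mul]

end Separable

namespace CoxeterSystem

/-! ### Unit parameters: semidirect product and semisimplicity -/

section UnitParameters

variable {B W : Type*} [Group W] [Finite W] {M : CoxeterMatrix B} (cs : CoxeterSystem M W)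
variable (k : Type*) [CommRing k]

theorem genG_mul_basisG_one (i : B) (w : W) :
    cs.genG (fun _ => (1 : k)) i * cs.basisG (fun _ => 1) w =
      cs.basisG (fun _ => 1) (cs.simple i * w) := by
  by_cases h : cs.IsLeftDescent w i
  · rw [cs.genG_mul_basisG_of_isLeftDescent _ h]
    simp
  · exact cs.genG_mul_basisG_of_not_isLeftDescent _ h

/-- The elements `g_w` of `𝒞_W(1)` form a group isomorphic to `W`. -/
noncomputable def groupHom : W →* cs.CAlgebra k (fun _ => 1) where
  toFun := cs.basisG (fun _ => 1)
  map_one' := cs.basisG_one _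
  map_mul' v w := by
    induction v using cs.simple_induction_left generalizing w with
    | one => rw [one_mul, basisG_one, one_mul]
    | mul_simple_left v i ih =>
      rw [mul_assoc, ← genG_mul_basisG_one, ih, ← mul_assoc, genG_mul_basisG_one]

variable {k} {cs}

/-- At parameter 1 the quadratic relation becomes `g_i ^ 2 = 1`, so the relations among the `g_i`
are the Coxeter relations. -/
theorem satisfiesRelations_of_monoidHom {A : Type*} [Ring A] [Algebra k A] (G : W →* A)
    {E : cs.Reflection → A} (h1 : ∀ t, E t * E t = E t) (h2 : ∀ t t', E t * E t' = E t' * E t)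
    (h3 : ∀ t t₁ : cs.Reflection, E t * E t₁ = E t * E (cs.conjRefl t t₁))
    (h4 : ∀ w t, G w * E t = E (cs.conjRefl w t) * G w) :
    cs.SatisfiesRelations (fun _ => (1 : k)) (fun i => G (cs.simple i)) E where
  braid i j := by
    have h : ∀ ω : List B, (ω.map fun i => G (cs.simple i)).prod = G (cs.wordProd ω) := fun ω => by
      rw [wordProd, map_list_prod, List.map_map]; rfl
    rw [h, h, wordProd_braidWord_eq]
  e_idem := h1
  e_comm := h2
  e_conj := h3
  g_e i t := h4 _ t
  quadratic i := by
    rw [← map_mul, simple_mul_simple_self, map_one]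
    simp

theorem lift_basisG_of_monoidHom {A : Type*} [Ring A] [Algebra k A] {G : W →* A}
    {E : cs.Reflection → A}
    (h : cs.SatisfiesRelations (fun _ => (1 : k)) (fun i => G (cs.simple i)) E) (w : W) :
    h.lift (cs.basisG (fun _ => 1) w) = G w := by
  rw [basisG, map_list_prod, List.map_map]
  conv_rhs => rw [← cs.wordProd_reducedWord w, wordProd, map_list_prod, List.map_map]
  congr 2
  funext i
  exact h.lift_genG i

/-- Atoms are unique, so the images of the `ε_H` are known as soon as some atom family of the target
is known. -/
theorem lift_atom {u : cs.SimpleClass → k} {A : Type*} [Ring A] [Algebra k A] {G : B → A}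
    {E : cs.Reflection → A} (h : cs.SatisfiesRelations u G E)
    {ε : cs.ReflectionSubgroups → A} (hε : cs.IsAtomFamily E ε) (H : cs.ReflectionSubgroups) :
    h.lift (cs.atom u H) = ε H := by
  have h1 := (cs.isAtomFamily_atom u).map h.lift.toRingHom
  have h2 : (fun t => h.lift.toRingHom (cs.genE u t)) = E := funext h.lift_genE
  rw [h2] at h1
  exact congrFun (hε.unique h1) H

variable (k) (cs)

open Classical in
/-- The indicator function of the reflection subgroups that contain `t`. -/
noncomputable def memFun (t : cs.Reflection) : cs.FunReflectionSubgroups k :=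
  fun H => if (t : W) ∈ (H : Subgroup W) then 1 else 0

variable {cs} in
theorem memFun_of_mem {t : cs.Reflection} {H : cs.ReflectionSubgroups}
    (h : (t : W) ∈ (H : Subgroup W)) : cs.memFun k t H = 1 := if_pos h

variable {cs} in
theorem memFun_of_notMem {t : cs.Reflection} {H : cs.ReflectionSubgroups}
    (h : (t : W) ∉ (H : Subgroup W)) : cs.memFun k t H = 0 := if_neg h

theorem smul_memFun (w : W) (t : cs.Reflection) :
    w • cs.memFun k t = cs.memFun k (cs.conjRefl w t) := by
  funext H
  rw [smul_funReflectionSubgroups_apply]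
  have h : (t : W) ∈ ((w⁻¹ • H : cs.ReflectionSubgroups) : Subgroup W) ↔
      ((cs.conjRefl w t : cs.Reflection) : W) ∈ (H : Subgroup W) := by
    rw [mem_smul_reflectionSubgroups, inv_inv, conjRefl]
  by_cases h' : (t : W) ∈ ((w⁻¹ • H : cs.ReflectionSubgroups) : Subgroup W)
  · rw [memFun_of_mem k h', memFun_of_mem k (h.1 h')]
  · rw [memFun_of_notMem k h', memFun_of_notMem k (fun h1 => h' (h.2 h1))]

theorem memFun_mul_self (t : cs.Reflection) : cs.memFun k t * cs.memFun k t = cs.memFun k t := by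
  funext H
  by_cases h : (t : W) ∈ (H : Subgroup W)
  · rw [Pi.mul_apply, memFun_of_mem k h, one_mul]
  · rw [Pi.mul_apply, memFun_of_notMem k h, zero_mul]

theorem memFun_mul_conj (t t₁ : cs.Reflection) :
    cs.memFun k t * cs.memFun k t₁ = cs.memFun k t * cs.memFun k (cs.conjRefl t t₁) := by
  funext H
  rw [Pi.mul_apply, Pi.mul_apply]
  by_cases h : (t : W) ∈ (H : Subgroup W)
  · have h1 : ((cs.conjRefl t t₁ : cs.Reflection) : W) ∈ (H : Subgroup W) ↔
        (t₁ : W) ∈ (H : Subgroup W) := by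
      rw [conjRefl, Subgroup.mul_mem_cancel_right _ (inv_mem h), Subgroup.mul_mem_cancel_left _ h]
    by_cases h' : (t₁ : W) ∈ (H : Subgroup W)
    · rw [memFun_of_mem k h', memFun_of_mem k (h1.2 h')]
    · rw [memFun_of_notMem k h', memFun_of_notMem k (fun h2 => h' (h1.1 h2))]
  · rw [memFun_of_notMem k h, zero_mul, zero_mul]

open Classical in
theorem isAtomFamily_memFun : cs.IsAtomFamily (cs.memFun k)
    (fun H => (Pi.single H 1 : cs.FunReflectionSubgroups k)) where
  sum_eq_one := Finset.univ_sum_single (1 : cs.FunReflectionSubgroups k)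
  mul_left_of_mem t H h := by
    funext K
    rw [Pi.mul_apply]
    by_cases hK : K = H
    · rw [hK, memFun_of_mem k h, one_mul]
    · rw [Pi.single_eq_of_ne hK, mul_zero]
  mul_left_of_notMem t H h := by
    funext K
    rw [Pi.mul_apply]
    by_cases hK : K = H
    · rw [hK, memFun_of_notMem k h, zero_mul]; rfl
    · rw [Pi.single_eq_of_ne hK, mul_zero]; rfl
  comm t H := mul_comm _ _

theorem single_one_mul_single (f f' : cs.FunReflectionSubgroups k) (w : W) :
    (SkewMonoidAlgebra.single 1 f * SkewMonoidAlgebra.single w f' : cs.FunSemidirect k) =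
      SkewMonoidAlgebra.single w (f * f') := by
  rw [SkewMonoidAlgebra.single_mul_single, one_mul, one_smul]

/-- The image of `e_t` in the semidirect product. -/
noncomputable def semidirectE (t : cs.Reflection) : cs.FunSemidirect k :=
  SkewMonoidAlgebra.single 1 (cs.memFun k t)

theorem semidirectE_idem (t : cs.Reflection) :
    cs.semidirectE k t * cs.semidirectE k t = cs.semidirectE k t := by
  rw [semidirectE, single_one_mul_single, memFun_mul_self]

theorem semidirectE_comm (t t' : cs.Reflection) :
    cs.semidirectE k t * cs.semidirectE k t' = cs.semidirectE k t' * cs.semidirectE k t := by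
  rw [semidirectE, semidirectE, single_one_mul_single, single_one_mul_single, mul_comm]

theorem semidirectE_conj (t t₁ : cs.Reflection) :
    cs.semidirectE k t * cs.semidirectE k t₁ =
      cs.semidirectE k t * cs.semidirectE k (cs.conjRefl t t₁) := by
  rw [semidirectE, semidirectE, semidirectE, single_one_mul_single, single_one_mul_single,
    memFun_mul_conj]

theorem of_mul_semidirectE (w : W) (t : cs.Reflection) :
    SkewMonoidAlgebra.of (cs.FunReflectionSubgroups k) W w * cs.semidirectE k t =
      cs.semidirectE k (cs.conjRefl w t) *
        SkewMonoidAlgebra.of (cs.FunReflectionSubgroups k) W w := by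
  rw [semidirectE, semidirectE, SkewMonoidAlgebra.of_apply, SkewMonoidAlgebra.single_mul_single,
    single_one_mul_single, smul_memFun, mul_one, mul_one, one_mul]

theorem satisfiesRelations_semidirect :
    cs.SatisfiesRelations (fun _ => (1 : k))
      (fun i => SkewMonoidAlgebra.of (cs.FunReflectionSubgroups k) W (cs.simple i))
      (cs.semidirectE k) :=
  satisfiesRelations_of_monoidHom _ (cs.semidirectE_idem k) (cs.semidirectE_comm k)
    (cs.semidirectE_conj k) (cs.of_mul_semidirectE k)

open Classical in
theorem isAtomFamily_semidirect : cs.IsAtomFamily (cs.semidirectE k)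
    (fun H => (SkewMonoidAlgebra.single 1 (Pi.single H 1) : cs.FunSemidirect k)) :=
  (cs.isAtomFamily_memFun k).map
    { SkewMonoidAlgebra.singleAddHom (k := cs.FunReflectionSubgroups k) (1 : W) with
      map_one' := rfl
      map_mul' := fun f f' => (cs.single_one_mul_single k f f' 1).symm }

/-- The basis of the semidirect product that consists of the elements `δ_H w`. -/
noncomputable def semidirectBasis :
    Module.Basis (cs.ReflectionSubgroups × W) k (cs.FunSemidirect k) :=
  ((Finsupp.basis fun _ : W => Pi.basisFun k cs.ReflectionSubgroups).map
    SkewMonoidAlgebra.coeffLinearEquiv.symm).reindex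
    ((Equiv.sigmaEquivProd W cs.ReflectionSubgroups).trans (Equiv.prodComm _ _))

open Classical in
theorem semidirectBasis_apply (H : cs.ReflectionSubgroups) (w : W) :
    cs.semidirectBasis k (H, w) = SkewMonoidAlgebra.single w (Pi.single H 1) := by
  simp [semidirectBasis]
  rfl

/-- The isomorphism between `𝒞_W(1)` and the semidirect product. -/
theorem nonempty_algEquiv_semidirect :
    Nonempty (cs.CAlgebra k (fun _ => 1) ≃ₐ[k] cs.FunSemidirect k) := by
  classical
  set φ := (cs.satisfiesRelations_semidirect k).lift
  have h : φ.toLinearMap = ((cs.standardBasis fun _ => (1 : k)).equiv (cs.semidirectBasis k)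
      (Equiv.refl _)).toLinearMap := by
    refine (cs.standardBasis fun _ => (1 : k)).ext fun p => ?_
    rw [LinearEquiv.coe_coe, Module.Basis.equiv_apply, Equiv.refl_apply, standardBasis_apply,
      semidirectBasis_apply, AlgHom.toLinearMap_apply, map_mul,
      lift_atom _ (cs.isAtomFamily_semidirect k), lift_basisG_of_monoidHom,
      SkewMonoidAlgebra.of_apply, single_one_mul_single, mul_one]
  refine ⟨AlgEquiv.ofBijective φ ?_⟩
  have h' : (φ : cs.CAlgebra k (fun _ => 1) → cs.FunSemidirect k) =
      (cs.standardBasis fun _ => (1 : k)).equiv (cs.semidirectBasis k) (Equiv.refl _) :=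
    congrArg DFunLike.coe h
  rw [h']
  exact LinearEquiv.bijective _

theorem basisG_mul_one_param (v w : W) :
    cs.basisG (fun _ => (1 : k)) v * cs.basisG (fun _ => 1) w = cs.basisG (fun _ => 1) (v * w) :=
  ((cs.groupHom k).map_mul v w).symm

open TensorProduct in
theorem isSemisimpleRing_one_param (k : Type*) [Field k] (hk : (Nat.card W : k) ≠ 0) :
    IsSemisimpleRing (cs.CAlgebra k (fun _ => 1)) := by
  classical
  cases nonempty_fintype W
  have hε := cs.isAtomFamily_atom (fun _ => (1 : k))
  set ε := cs.atom (fun _ => (1 : k)) with hεdef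
  set g := cs.basisG (fun _ => (1 : k)) with hgdef
  have hg : ∀ v w, g v * g w = g (v * w) := cs.basisG_mul_one_param k
  -- The separability idempotent is `|W|⁻¹ ∑ g_w ε_H ⊗ ε_H g_{w⁻¹}`. It commutes with `g_i` by the
  -- substitution `w ↦ s_i w`, and with `e_t` because `e_{w⁻¹ t w}` is absorbed or killed by `ε_H`
  -- on both sides of the tensor.
  refine isSemisimpleRing_of_separabilityIdempotent (k := k)
    (ι := W × cs.ReflectionSubgroups)
    (fun p => (Nat.card W : k)⁻¹ • (g p.1 * ε p.2)) (fun p => ε p.2 * g p.1⁻¹) ?_ ?_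
  · have h : ∀ w, ∑ H, ((Nat.card W : k)⁻¹ • (g w * ε H)) * (ε H * g w⁻¹) =
        (Nat.card W : k)⁻¹ • 1 := fun w => by
      have : ∀ H, ((Nat.card W : k)⁻¹ • (g w * ε H)) * (ε H * g w⁻¹) =
          (Nat.card W : k)⁻¹ • (g w * ε H * g w⁻¹) := fun H => by
        rw [smul_mul_assoc, mul_assoc, ← mul_assoc (ε H), hε.mul_self, ← mul_assoc]
      simp only [this]
      rw [← Finset.smul_sum, ← Finset.sum_mul, ← Finset.mul_sum, hε.sum_eq_one, mul_one, hg,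
        mul_inv_cancel, hgdef, basisG_one]
    rw [Fintype.sum_prod_type]
    simp only [h]
    rw [Finset.sum_const, Finset.card_univ, ← Nat.card_eq_fintype_card, ← Nat.cast_smul_eq_nsmul k,
      smul_smul, mul_inv_cancel₀ hk, one_smul]
  · let T : Subalgebra k (cs.CAlgebra k (fun _ => (1 : k))) :=
      { carrier := {x | ∑ p : W × cs.ReflectionSubgroups,
            (x * ((Nat.card W : k)⁻¹ • (g p.1 * ε p.2))) ⊗ₜ[k] (ε p.2 * g p.1⁻¹) =
          ∑ p : W × cs.ReflectionSubgroups,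
            ((Nat.card W : k)⁻¹ • (g p.1 * ε p.2)) ⊗ₜ[k] (ε p.2 * g p.1⁻¹ * x)}
        mul_mem' := fun {x y} hx hy => by
          have h1 := congrArg (TensorProduct.map (LinearMap.mulLeft k x) LinearMap.id) hy
          have h2 := congrArg (TensorProduct.map LinearMap.id (LinearMap.mulRight k y)) hx
          simp only [map_sum, TensorProduct.map_tmul, LinearMap.mulLeft_apply,
            LinearMap.mulRight_apply, LinearMap.id_apply] at h1 h2
          simp only [Set.mem_ofPred_eq, mul_assoc] at h1 h2 ⊢
          rw [h1, h2]
        add_mem' := fun {x y} hx hy => by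
          simp only [Set.mem_ofPred_eq] at hx hy ⊢
          simp only [add_mul, mul_add, TensorProduct.add_tmul, TensorProduct.tmul_add,
            Finset.sum_add_distrib]
          rw [hx, hy]
        algebraMap_mem' := fun r => by
          refine Finset.sum_congr rfl fun p _ => ?_
          rw [← Algebra.smul_def, TensorProduct.smul_tmul, ← Algebra.commutes r,
            ← Algebra.smul_def] }
    have hT : T = ⊤ := by
      refine SatisfiesRelations.eq_top (fun i => ?_) (fun t => ?_)
      · change ∑ p : W × cs.ReflectionSubgroups, _ = ∑ p : W × cs.ReflectionSubgroups, _
        rw [← basisG_simple, ← hgdef]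
        rw [← Equiv.sum_comp ((Equiv.mulLeft (cs.simple i)).prodCongr (Equiv.refl _))
          (fun p => ((Nat.card W : k)⁻¹ • (g p.1 * ε p.2)) ⊗ₜ[k] (ε p.2 * g p.1⁻¹ * _))]
        refine Finset.sum_congr rfl fun p _ => ?_
        simp only [Equiv.prodCongr_apply, Prod.map, Equiv.coe_mulLeft, Equiv.refl_apply]
        rw [mul_smul_comm, ← mul_assoc, hg, mul_assoc, hg, mul_inv_rev, inv_mul_cancel_right]
      · change ∑ p : W × cs.ReflectionSubgroups, _ = ∑ p : W × cs.ReflectionSubgroups, _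
        refine Finset.sum_congr rfl fun p _ => ?_
        obtain ⟨w, H⟩ := p
        have e1 : cs.genE (fun _ => (1 : k)) t * g w =
            g w * cs.genE (fun _ => (1 : k)) (cs.conjRefl w⁻¹ t) := by
          rw [hgdef, basisG_mul_genE, ← conjRefl_mul, mul_inv_cancel]
          congr 2
          apply Subtype.ext
          simp [conjRefl]
        have e2 : g w⁻¹ * cs.genE (fun _ => (1 : k)) t =
            cs.genE (fun _ => (1 : k)) (cs.conjRefl w⁻¹ t) * g w⁻¹ := by
          rw [hgdef, basisG_mul_genE]
        simp only
        rw [mul_smul_comm, ← mul_assoc, e1, mul_assoc, mul_assoc, e2, ← mul_assoc (ε H), hε.comm]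
        by_cases h : ((cs.conjRefl w⁻¹ t : cs.Reflection) : W) ∈ (H : Subgroup W)
        · rw [hε.mul_left_of_mem _ _ h]
        · rw [hε.mul_left_of_notMem _ _ h, mul_zero, smul_zero, zero_mul,
            TensorProduct.zero_tmul, TensorProduct.tmul_zero]
    intro x
    have hx : x ∈ T := hT ▸ Algebra.mem_top
    exact hx

end UnitParameters

end CoxeterSystem

/-! ### Lifting points of an open locus after a finite extension -/

theorem PrimeSpectrum.mem_nhds_bot_or_compl_mem_nhds_bot {P : Type*} [CommRing P] [IsDomain P]
    {s : Set (PrimeSpectrum P)} (hs : Topology.IsConstructible s) :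
    s ∈ nhds (⊥ : PrimeSpectrum P) ∨ sᶜ ∈ nhds (⊥ : PrimeSpectrum P) := by
  induction hs using Topology.IsConstructible.empty_union_induction with
  | open_retrocompact U hU _ =>
    by_cases h : (⊥ : PrimeSpectrum P) ∈ U
    · exact .inl (hU.mem_nhds h)
    · have : U = ∅ := by
        rw [Set.eq_empty_iff_forall_notMem]
        intro x hx
        exact h (((PrimeSpectrum.le_iff_specializes ⊥ x).mp bot_le).mem_open hU hx)
      right
      simp [this]
  | union s _ t _ hs ht =>
    rcases hs with hs | hs
    · exact .inl (Filter.mem_of_superset hs Set.subset_union_left)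
    · rcases ht with ht | ht
      · exact .inl (Filter.mem_of_superset ht Set.subset_union_right)
      · right
        rw [Set.compl_union]
        exact Filter.inter_mem hs ht
  | compl s _ hs => rw [compl_compl]; exact hs.symm

/-- By Chevalley's theorem the image of `Spec R` is constructible. Injectivity puts the generic
point into it, and a constructible set that contains the generic point is a neighbourhood of it. -/
theorem exists_ne_zero_forall_mem_range_comap {P R : Type*} [CommRing P] [IsDomain P]
    [CommRing R] [Algebra P R] [Algebra.FinitePresentation P R]
    (hinj : Function.Injective (algebraMap P R)) :
    ∃ D : P, D ≠ 0 ∧ ∀ p : PrimeSpectrum P, D ∉ p.asIdeal →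
      p ∈ Set.range (PrimeSpectrum.comap (algebraMap P R)) := by
  have hc := PrimeSpectrum.isConstructible_range_comap
    (f := algebraMap P R) (RingHom.finitePresentation_algebraMap.mpr inferInstance)
  have hbot : (⊥ : PrimeSpectrum P) ∈ Set.range (PrimeSpectrum.comap (algebraMap P R)) := by
    rw [PrimeSpectrum.mem_range_comap_iff]
    have : (⊥ : PrimeSpectrum P).asIdeal = ⊥ := rfl
    rw [this, Ideal.map_bot, ← RingHom.ker_eq_comap_bot]
    exact (RingHom.injective_iff_ker_eq_bot _).mp hinj
  have hn : Set.range (PrimeSpectrum.comap (algebraMap P R)) ∈ nhds (⊥ : PrimeSpectrum P) := by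
    rcases PrimeSpectrum.mem_nhds_bot_or_compl_mem_nhds_bot hc with h | h
    · exact h
    · exact absurd hbot (mem_of_mem_nhds h)
  obtain ⟨U, ⟨D, rfl⟩, hD, hU⟩ :=
    PrimeSpectrum.isTopologicalBasis_basic_opens.mem_nhds_iff.mp hn
  refine ⟨D, fun h0 => ?_, fun p hp => hU hp⟩
  subst h0
  simp at hD

/-- A nonzero algebra of finite type over a field has a point in a finite extension, which can be
chosen in the universe of the base field. -/
theorem exists_finite_extension_point {L : Type uL} [Field L] {T : Type*} [CommRing T] [Algebra L T]
    [Nontrivial T] [Algebra.FiniteType L T] :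
    ∃ (L' : Type uL) (_ : Field L') (_ : Algebra L L'), FiniteDimensional L L' ∧
      Nonempty (T →ₐ[L] L') := by
  obtain ⟨m, hm⟩ := Ideal.exists_maximal T
  let : Field (T ⧸ m) := Ideal.Quotient.field m
  have : Algebra.FiniteType L (T ⧸ m) :=
    Algebra.FiniteType.of_surjective (Ideal.Quotient.mkₐ L m) Ideal.Quotient.mk_surjective
  have : Module.Finite L (T ⧸ m) := finite_of_finite_type_of_isJacobsonRing L (T ⧸ m)
  let f : (T ⧸ m) →ₐ[L] AlgebraicClosure L := IsAlgClosed.lift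
  refine ⟨f.fieldRange, inferInstance, inferInstance, ?_, ⟨?_⟩⟩
  · exact Module.Finite.of_surjective f.rangeRestrict.toLinearMap f.rangeRestrict_surjective
  · exact f.rangeRestrict.comp (Ideal.Quotient.mkₐ L m)

/-- If an algebra `R` of finite presentation over a domain `P` contains `P`, then outside the
zero locus of some nonzero `D`, field-valued points of `P` lift to `R` after a finite extension. -/
theorem exists_ne_zero_forall_exists_lift {P R : Type*} [CommRing P] [IsDomain P]
    [CommRing R] [Algebra P R] [Algebra.FinitePresentation P R]
    (hinj : Function.Injective (algebraMap P R)) :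
    ∃ D : P, D ≠ 0 ∧ ∀ (L : Type uL) [Field L] (g : P →+* L), g D ≠ 0 →
      ∃ (L' : Type uL) (_ : Field L') (_ : Algebra L L'), FiniteDimensional L L' ∧
        ∃ h : R →+* L', h.comp (algebraMap P R) = (algebraMap L L').comp g := by
  obtain ⟨D, hD, hP⟩ := exists_ne_zero_forall_mem_range_comap hinj
  refine ⟨D, hD, fun L _ g hg => ?_⟩
  let : Algebra P L := g.toAlgebra
  obtain ⟨q, hq⟩ := hP ⟨RingHom.ker g, RingHom.ker_isPrime g⟩ hg
  have hq' : q.asIdeal.comap (algebraMap P R) = RingHom.ker g := congrArg PrimeSpectrum.asIdeal hq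
  -- The tensor product maps to `L ⊗ κ(q)` over the residue field `F` of `ker g`, a tensor product
  -- of two extensions of a field and hence nonzero.
  have : Nontrivial (L ⊗[P] R) := by
    have hp : (RingHom.ker g).IsPrime := RingHom.ker_isPrime g
    let F := (RingHom.ker g).ResidueField
    let a₁ : Algebra F L := (Ideal.ResidueField.lift (RingHom.ker g) g le_rfl (by
      intro x hx
      exact (isUnit_iff_ne_zero.mpr hx))).toAlgebra
    let a₂ : Algebra F q.asIdeal.ResidueField :=
      (Ideal.ResidueField.map (RingHom.ker g) q.asIdeal (algebraMap P R) hq'.symm).toAlgebra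
    have : IsScalarTower P F L := .of_algebraMap_eq fun x => by
      exact (Ideal.ResidueField.lift_algebraMap _ _ _ _ x).symm
    have : IsScalarTower P F q.asIdeal.ResidueField := .of_algebraMap_eq fun x => by
      rw [RingHom.algebraMap_toAlgebra]
      rw [Ideal.ResidueField.map_algebraMap]
      rfl
    let φ : L ⊗[P] R →ₐ[P] L ⊗[F] q.asIdeal.ResidueField :=
      Algebra.TensorProduct.lift
        ((Algebra.TensorProduct.includeLeft :
          L →ₐ[F] L ⊗[F] q.asIdeal.ResidueField).restrictScalars P)
        (((Algebra.TensorProduct.includeRight :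
          q.asIdeal.ResidueField →ₐ[F] L ⊗[F] q.asIdeal.ResidueField).restrictScalars P).comp
            (IsScalarTower.toAlgHom P R q.asIdeal.ResidueField)) (fun _ _ => Commute.all _ _)
    exact RingHom.domain_nontrivial φ.toRingHom
  obtain ⟨L', _, _, hfin, ⟨f⟩⟩ := exists_finite_extension_point (L := L) (T := L ⊗[P] R)
  refine ⟨L', _, _, hfin, f.toRingHom.comp
    (Algebra.TensorProduct.includeRight : R →ₐ[P] L ⊗[P] R).toRingHom, ?_⟩
  ext x
  have h1 : (1 : L) ⊗ₜ[P] algebraMap P R x = (algebraMap P L x) ⊗ₜ[P] 1 := by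
    rw [Algebra.algebraMap_eq_smul_one, Algebra.algebraMap_eq_smul_one, TensorProduct.tmul_smul,
      TensorProduct.smul_tmul']
  change f ((1 : L) ⊗ₜ[P] algebraMap P R x) = _
  rw [h1]
  exact f.commutes _

/-- An algebra over a Noetherian domain that maps to all the infinitesimal neighbourhoods of a
point is faithful. -/
theorem algebraMap_injective_of_forall_algHom {P R : Type*} [CommRing P] [IsDomain P]
    [IsNoetherianRing P] [CommRing R] [Algebra P R] {I : Ideal P} (hI : I ≠ ⊤)
    (h : ∀ n : ℕ, Nonempty (R →ₐ[P] P ⧸ I ^ n)) : Function.Injective (algebraMap P R) := by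
  rw [injective_iff_map_eq_zero]
  intro x hx
  -- The kernel lies in every power of `I`, and Krull's theorem makes their intersection zero.
  have : x ∈ ⨅ n : ℕ, I ^ n := by
    rw [Ideal.mem_iInf]
    intro n
    obtain ⟨f⟩ := h n
    rw [← Ideal.Quotient.eq_zero_iff_mem]
    have := f.commutes x
    rw [hx, map_zero] at this
    exact this.symm
  have hK := Ideal.iInf_pow_eq_bot_of_isDomain I hI
  exact (Ideal.ext_iff.mp hK x).mp this

namespace CoxeterSystem

/-! ### Change of the base ring -/

section BaseChange

variable {B W : Type*} [Group W] {M : CoxeterMatrix B} {cs : CoxeterSystem M W}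

theorem SatisfiesRelations.map {k k' A A' : Type*} [CommRing k] [CommRing k'] [Ring A] [Ring A']
    [Algebra k A] [Algebra k' A'] {u : cs.SimpleClass → k} {u' : cs.SimpleClass → k'} {G : B → A}
    {E : cs.Reflection → A} (h : cs.SatisfiesRelations u G E) (φ : A →+* A')
    (hφ : ∀ c, φ (algebraMap k A (u c)) = algebraMap k' A' (u' c)) :
    cs.SatisfiesRelations u' (fun i => φ (G i)) (fun t => φ (E t)) where
  braid i j := by
    have := congrArg φ (h.braid i j)
    rwa [map_list_prod, map_list_prod, List.map_map, List.map_map] at this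
  e_idem t := by rw [← map_mul, h.e_idem]
  e_comm t t' := by rw [← map_mul, ← map_mul, h.e_comm]
  e_conj t t' := by rw [← map_mul, ← map_mul, h.e_conj]
  g_e i t := by rw [← map_mul, ← map_mul, h.g_e]
  quadratic i := by
    rw [← map_mul, h.quadratic, map_add, map_mul, map_mul, map_add, map_one, map_sub, map_sub,
      map_sub, hφ, map_one, map_one, map_one]

variable {k k' : Type*} [CommRing k] [CommRing k'] {u : cs.SimpleClass → k}
variable {u' : cs.SimpleClass → k'}

/-- The homomorphism `𝒞_W(u) → 𝒞_W(u')` over a homomorphism of base rings that takes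
`u` to `u'`. -/
noncomputable def baseChange (f : k →+* k') (hu : ∀ c, f (u c) = u' c) :
    cs.CAlgebra k u →+* cs.CAlgebra k' u' :=
  letI : Algebra k (cs.CAlgebra k' u') :=
    ((algebraMap k' (cs.CAlgebra k' u')).comp f).toAlgebra' fun c x => Algebra.commutes (f c) x
  ((cs.satisfiesRelations_gen u').map (u' := u) (RingHom.id _) fun c => by
    rw [← hu]; rfl).lift.toRingHom

variable (f : k →+* k') (hu : ∀ c, f (u c) = u' c)

theorem baseChange_genG (i : B) : baseChange f hu (cs.genG u i) = cs.genG u' i :=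
  letI : Algebra k (cs.CAlgebra k' u') :=
    ((algebraMap k' (cs.CAlgebra k' u')).comp f).toAlgebra' fun c x => Algebra.commutes (f c) x
  ((cs.satisfiesRelations_gen u').map (u' := u) (RingHom.id _) fun c => by
    rw [← hu]; rfl).lift_genG i

theorem baseChange_genE (t : cs.Reflection) : baseChange f hu (cs.genE u t) = cs.genE u' t :=
  letI : Algebra k (cs.CAlgebra k' u') :=
    ((algebraMap k' (cs.CAlgebra k' u')).comp f).toAlgebra' fun c x => Algebra.commutes (f c) x
  ((cs.satisfiesRelations_gen u').map (u' := u) (RingHom.id _) fun c => by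
    rw [← hu]; rfl).lift_genE t

theorem baseChange_algebraMap (r : k) :
    baseChange f hu (algebraMap k (cs.CAlgebra k u) r) = algebraMap k' _ (f r) :=
  letI : Algebra k (cs.CAlgebra k' u') :=
    ((algebraMap k' (cs.CAlgebra k' u')).comp f).toAlgebra' fun c x => Algebra.commutes (f c) x
  ((cs.satisfiesRelations_gen u').map (u' := u) (RingHom.id _) fun c => by
    rw [← hu]; rfl).lift.commutes r

theorem baseChange_smul (r : k) (x : cs.CAlgebra k u) :
    baseChange f hu (r • x) = f r • baseChange f hu x := by
  rw [Algebra.smul_def, map_mul, baseChange_algebraMap, ← Algebra.smul_def]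

variable [Finite W]

theorem baseChange_basisG (w : W) : baseChange f hu (cs.basisG u w) = cs.basisG u' w := by
  rw [basisG, map_list_prod, List.map_map, basisG]
  congr 2
  funext i
  exact baseChange_genG f hu i

theorem baseChange_atom (H : cs.ReflectionSubgroups) :
    baseChange f hu (cs.atom u H) = cs.atom u' H := by
  have h1 := (cs.isAtomFamily_atom u).map (baseChange f hu)
  rw [show (fun t => baseChange f hu (cs.genE u t)) = cs.genE u' from
    funext (baseChange_genE f hu)] at h1
  exact congrFun ((cs.isAtomFamily_atom u').unique h1) H

theorem baseChange_standardBasis (p : cs.ReflectionSubgroups × W) :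
    baseChange f hu (cs.standardBasis u p) = cs.standardBasis u' p := by
  rw [standardBasis_apply, standardBasis_apply, map_mul, baseChange_atom, baseChange_basisG]

/-- Standard bases are carried to standard bases, so change of base acts on coordinates. Kernels,
surjectivity and determinants are thereby reduced to the base rings. -/
theorem standardBasis_repr_baseChange (x : cs.CAlgebra k u) (p : cs.ReflectionSubgroups × W) :
    (cs.standardBasis u').repr (baseChange f hu x) p = f ((cs.standardBasis u).repr x p) := by
  classical
  cases nonempty_fintype W
  conv_lhs => rw [← (cs.standardBasis u).sum_repr x]
  rw [map_sum]
  simp only [baseChange_smul, baseChange_standardBasis]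
  rw [Module.Basis.repr_sum_self]

theorem baseChange_eq_zero_iff {x : cs.CAlgebra k u} :
    baseChange f hu x = 0 ↔ ∀ p, f ((cs.standardBasis u).repr x p) = 0 := by
  rw [← (cs.standardBasis u').forall_coord_eq_zero_iff]
  simp only [Module.Basis.coord_apply, standardBasis_repr_baseChange]

theorem baseChange_surjective (hf : Function.Surjective f) :
    Function.Surjective (baseChange (cs := cs) f hu) := by
  classical
  cases nonempty_fintype W
  intro y
  choose g hg using hf
  refine ⟨∑ p, g ((cs.standardBasis u').repr y p) • cs.standardBasis u p, ?_⟩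
  rw [map_sum]
  simp only [baseChange_smul, baseChange_standardBasis, hg]
  exact (cs.standardBasis u').sum_repr y

theorem mul_eq_zero_of_baseChange_eq_zero (hf : ∀ a b, f a = 0 → f b = 0 → a * b = 0)
    {x y : cs.CAlgebra k u} (hx : baseChange f hu x = 0) (hy : baseChange f hu y = 0) :
    x * y = 0 := by
  classical
  cases nonempty_fintype W
  rw [baseChange_eq_zero_iff] at hx hy
  rw [← (cs.standardBasis u).sum_repr x, ← (cs.standardBasis u).sum_repr y, Finset.sum_mul_sum]
  refine Finset.sum_eq_zero fun p _ => Finset.sum_eq_zero fun q _ => ?_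
  rw [smul_mul_smul_comm, hf _ _ (hx p) (hy q), zero_smul]

/-- Extension of scalars takes `𝒞_W(u)` to `𝒞_W(u)`. -/
theorem nonempty_algEquiv_tensorProduct [Algebra k k'] (u : cs.SimpleClass → k) :
    Nonempty ((k' ⊗[k] cs.CAlgebra k u) ≃ₐ[k']
      cs.CAlgebra k' fun c => algebraMap k k' (u c)) := by
  classical
  let ι : cs.CAlgebra k u →ₐ[k] k' ⊗[k] cs.CAlgebra k u := Algebra.TensorProduct.includeRight
  have hrel : cs.SatisfiesRelations (fun c => algebraMap k k' (u c))
      (fun i => ι (cs.genG u i)) (fun t => ι (cs.genE u t)) :=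
    (cs.satisfiesRelations_gen u).map ι.toRingHom fun c => by
      change ι (algebraMap _ _ _) = _
      rw [ι.commutes]
      rfl
  set φ := hrel.lift
  have hat : cs.IsAtomFamily (fun t => ι (cs.genE u t)) (fun H => ι (cs.atom u H)) :=
    (cs.isAtomFamily_atom u).map ι.toRingHom
  have h : φ.toLinearMap = ((cs.standardBasis fun c => algebraMap k k' (u c)).equiv
      ((cs.standardBasis u).baseChange k') (Equiv.refl _)).toLinearMap := by
    refine (cs.standardBasis _).ext fun p => ?_
    rw [LinearEquiv.coe_coe, Module.Basis.equiv_apply, Equiv.refl_apply, standardBasis_apply,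
      Module.Basis.baseChange_apply, standardBasis_apply, AlgHom.toLinearMap_apply, map_mul,
      lift_atom _ hat]
    have h2 : φ (cs.basisG (fun c => algebraMap k k' (u c)) p.2) = ι (cs.basisG u p.2) := by
      rw [basisG, map_list_prod, List.map_map, basisG, map_list_prod, List.map_map]
      congr 2
      funext i
      exact hrel.lift_genG i
    rw [h2, ← map_mul]
    rfl
  refine ⟨(AlgEquiv.ofBijective φ ?_).symm⟩
  have h' : (φ : _ → k' ⊗[k] cs.CAlgebra k u) = (cs.standardBasis fun c => algebraMap k k' (u c)).equiv
      ((cs.standardBasis u).baseChange k') (Equiv.refl _) :=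
    congrArg DFunLike.coe h
  rw [h']
  exact LinearEquiv.bijective _

end BaseChange

end CoxeterSystem

/-! ### Lifting group homomorphisms along square-zero extensions -/

section LiftHom

/-- Lifting of multiplicative families along square-zero extensions in which the order of the
group is invertible; the family is graded by the subgroups `V w`. -/
theorem exists_multiplicative_lift {W A A' : Type*} [Group W] [Finite W] [Ring A] [Ring A']
    (f : A' →+* A) (hf : ∀ x y, f x = 0 → f y = 0 → x * y = 0) {m : A'}
    (hm : m * (Nat.card W : A') = 1) (hmc : ∀ x, m * x = x * m) (V : W → AddSubgroup A')
    (hV : ∀ v w x y, x ∈ V v → y ∈ V w → x * y ∈ V (v * w)) (hmV : ∀ w, ∀ x ∈ V w, m * x ∈ V w)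
    (G : W → A') (hG : ∀ w, G w ∈ V w) (h1 : f (G 1) = 1)
    (hmul : ∀ v w, f (G v) * f (G w) = f (G (v * w))) :
    ∃ G' : W → A', (∀ w, G' w ∈ V w) ∧ (∀ w, f (G' w) = f (G w)) ∧ G' 1 = 1 ∧
      ∀ v w, G' v * G' w = G' (v * w) := by
  classical
  cases nonempty_fintype W
  -- The defect of multiplicativity is a 2-cocycle with values in the square-zero kernel.
  let c : W → W → A' := fun v w => G v * G w - G (v * w)
  have hc0 : ∀ v w, f (c v w) = 0 := fun v w => by
    simp only [c]; rw [map_sub, map_mul, hmul, sub_self]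
  have hcV : ∀ v w, c v w ∈ V (v * w) := fun v w =>
    sub_mem (hV _ _ _ _ (hG v) (hG w)) (hG _)
  have hNr : ∀ x y z, f x = 0 → f y = f z → x * y = x * z := fun x y z hx hyz => by
    rw [← sub_eq_zero, ← mul_sub]
    exact hf _ _ hx (by rw [map_sub, hyz, sub_self])
  -- Averaging the cocycle over its second variable, with `m = |W|⁻¹`, gives a cochain whose
  -- coboundary is `c`; subtracting it corrects `G`.
  let θ : W → A' := fun w => m * ∑ x, c w x * G x⁻¹
  have hθ0 : ∀ w, f (θ w) = 0 := fun w => by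
    simp only [θ, map_mul, map_sum, hc0, zero_mul, Finset.sum_const_zero, mul_zero]
  have hθV : ∀ w, θ w ∈ V w := fun w => by
    refine hmV _ _ (sum_mem fun x _ => ?_)
    have := hV _ _ _ _ (hcV w x) (hG x⁻¹)
    rwa [mul_inv_cancel_right] at this
  have key : ∀ v w, G v * θ w = θ (v * w) - θ v * G w + c v w := fun v w => by
    -- The cocycle identity, which expresses associativity of `G v * G w * G x`, multiplied on the
    -- right by `G x⁻¹`.
    have e1 : ∀ x, G v * (c w x * G x⁻¹) =
        c (v * w) x * G x⁻¹ - c v (w * x) * G (w * x)⁻¹ * G w + c v w := fun x => by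
      have e2 : c v (w * x) * G (w * x)⁻¹ * G w = c v (w * x) * G x⁻¹ := by
        rw [mul_assoc]
        exact hNr _ _ _ (hc0 _ _) (by rw [map_mul, hmul, mul_inv_rev, inv_mul_cancel_right])
      have e3 : c v w * (G x * G x⁻¹) = c v w := by
        conv_rhs => rw [← mul_one (c v w)]
        exact hNr _ _ _ (hc0 _ _) (by rw [map_mul, hmul, mul_inv_cancel, h1, map_one])
      rw [e2]
      conv_rhs => rw [← e3]
      simp only [c, mul_assoc v w x]
      noncomm_ring
    have e4 : ∑ x, c v (w * x) * G (w * x)⁻¹ * G w = (∑ x, c v x * G x⁻¹) * G w := by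
      rw [Finset.sum_mul]
      exact Equiv.sum_comp (Equiv.mulLeft w) fun x => c v x * G x⁻¹ * G w
    simp only [θ]
    rw [← mul_assoc, ← hmc, mul_assoc, Finset.mul_sum]
    simp only [e1]
    rw [Finset.sum_add_distrib, Finset.sum_sub_distrib, e4, mul_add, mul_sub, mul_assoc m _ (G w),
      Finset.sum_const, Finset.card_univ, ← Nat.card_eq_fintype_card, nsmul_eq_mul,
      ← mul_assoc m (Nat.card W : A'), hm, one_mul]
  have hmul' : ∀ v w, (G v - θ v) * (G w - θ w) = G (v * w) - θ (v * w) := fun v w => by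
    rw [mul_sub, sub_mul, sub_mul, key, hf _ _ (hθ0 v) (hθ0 w)]
    simp only [c]
    noncomm_ring
  refine ⟨fun w => G w - θ w, fun w => sub_mem (hG w) (hθV w), fun w => ?_, ?_, hmul'⟩
  · rw [map_sub, hθ0, sub_zero]
  -- The corrected value at 1 is idempotent and congruent to 1. Its difference `n` from 1 satisfies
  -- `n ^ 2 = -n` and `n ^ 2 = 0`.
  · have h2 := hmul' 1 1
    rw [mul_one] at h2
    have h3 : f (G 1 - θ 1 - 1) = 0 := by rw [map_sub, map_sub, hθ0, h1, map_one]; simp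
    have h4 := hf _ _ h3 h3
    have h5 : (G 1 - θ 1 - 1) * (G 1 - θ 1 - 1) =
      (G 1 - θ 1) * (G 1 - θ 1) - (G 1 - θ 1) - (G 1 - θ 1 - 1) := by noncomm_ring
    rw [h5, h2, sub_self, zero_sub, neg_eq_zero, sub_eq_zero] at h4
    exact h4

end LiftHom

namespace CoxeterSystem

/-! ### Splittings, their lifting and their moduli -/

section Splittings

/-- The elements that intertwine two families. -/
def intertwiners {A T : Type*} [Ring A] (E E' : T → A) : AddSubgroup A where
  carrier := {x | ∀ t, x * E t = E' t * x}
  zero_mem' t := by rw [zero_mul, mul_zero]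
  add_mem' {x y} hx hy t := by rw [add_mul, mul_add, hx t, hy t]
  neg_mem' {x} hx t := by rw [neg_mul, mul_neg, hx t]

variable {B W : Type*} [Group W] [Finite W] {M : CoxeterMatrix B} {cs : CoxeterSystem M W}

/-- A family of elements of `𝒞_W(u)` that multiply like the elements of `W`, permute the
idempotents like `W`, and form together with the idempotents a basis of `𝒞_W(u)`. -/
structure IsSplitting {k : Type*} [CommRing k] (u : cs.SimpleClass → k)
    (G : W → cs.CAlgebra k u) : Prop where
  map_one : G 1 = 1
  map_mul : ∀ v w, G v * G w = G (v * w)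
  mul_genE : ∀ w t, G w * cs.genE u t = cs.genE u (cs.conjRefl w t) * G w
  isUnit : ∀ [Fintype W] [DecidableEq (cs.ReflectionSubgroups × W)],
    IsUnit ((cs.standardBasis u).det fun p => cs.atom u p.1 * G p.2)

/-- The algebra with a splitting is a specialization at `1`. -/
theorem IsSplitting.nonempty_algEquiv {k : Type*} [CommRing k] {u : cs.SimpleClass → k}
    {G : W → cs.CAlgebra k u} (h : IsSplitting u G) :
    Nonempty (cs.CAlgebra k u ≃ₐ[k] cs.CAlgebra k fun _ => 1) := by
  classical
  cases nonempty_fintype W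
  let G' : W →* cs.CAlgebra k u := ⟨⟨G, h.map_one⟩, fun v w => (h.map_mul v w).symm⟩
  have hr := cs.satisfiesRelations_gen u
  have hrel := satisfiesRelations_of_monoidHom (k := k) G' hr.e_idem hr.e_comm hr.e_conj h.mul_genE
  obtain ⟨hli, hsp⟩ := (Module.Basis.is_basis_iff_det (cs.standardBasis u)).mpr h.isUnit
  set b := Module.Basis.mk hli hsp.ge
  have h' : hrel.lift.toLinearMap = ((cs.standardBasis fun _ => (1 : k)).equiv b
      (Equiv.refl _)).toLinearMap := by
    refine (cs.standardBasis fun _ => (1 : k)).ext fun p => ?_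
    rw [LinearEquiv.coe_coe, Module.Basis.equiv_apply, Equiv.refl_apply, standardBasis_apply,
      AlgHom.toLinearMap_apply, _root_.map_mul, lift_atom _ (cs.isAtomFamily_atom u),
      lift_basisG_of_monoidHom, Module.Basis.mk_apply]
    rfl
  refine ⟨(AlgEquiv.ofBijective hrel.lift ?_).symm⟩
  have h'' : (hrel.lift : _ → cs.CAlgebra k u) = (cs.standardBasis fun _ => (1 : k)).equiv b
      (Equiv.refl _) := congrArg DFunLike.coe h'
  rw [h'']
  exact LinearEquiv.bijective _

theorem isSplitting_one {k : Type*} [CommRing k] {u : cs.SimpleClass → k} (hu : ∀ c, u c = 1) :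
    ∃ G, IsSplitting u G := by
  obtain rfl : u = fun _ => 1 := funext hu
  refine ⟨cs.basisG _, cs.basisG_one _, cs.basisG_mul_one_param k, cs.basisG_mul_genE _, ?_⟩
  intro _ _
  have : (fun p : cs.ReflectionSubgroups × W => cs.atom (fun _ => (1 : k)) p.1 *
      cs.basisG (fun _ => 1) p.2) = cs.standardBasis fun _ => 1 :=
    funext fun p => (cs.standardBasis_apply _ p.1 p.2).symm
  rw [this, Module.Basis.det_self]
  exact isUnit_one

section

variable {k k' : Type*} [CommRing k] [CommRing k'] {u : cs.SimpleClass → k}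
variable {u' : cs.SimpleClass → k'} (f : k →+* k')

theorem det_baseChange (hu : ∀ c, f (u c) = u' c) [Fintype W] [DecidableEq (cs.ReflectionSubgroups × W)]
    (v : cs.ReflectionSubgroups × W → cs.CAlgebra k u) :
    f ((cs.standardBasis u).det v) =
      (cs.standardBasis u').det fun p => baseChange f hu (v p) := by
  rw [Module.Basis.det_apply, Module.Basis.det_apply, RingHom.map_det]
  congr 1
  ext p q
  rw [RingHom.mapMatrix_apply, Matrix.map_apply, Module.Basis.toMatrix_apply,
    Module.Basis.toMatrix_apply, standardBasis_repr_baseChange]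

theorem det_baseChange_atom (hu : ∀ c, f (u c) = u' c) [Fintype W] [DecidableEq (cs.ReflectionSubgroups × W)]
    (G : W → cs.CAlgebra k u) :
    f ((cs.standardBasis u).det fun p => cs.atom u p.1 * G p.2) =
      (cs.standardBasis u').det fun p => cs.atom u' p.1 * baseChange f hu (G p.2) := by
  rw [det_baseChange f hu]
  simp only [_root_.map_mul, baseChange_atom]

theorem IsSplitting.baseChange (hu : ∀ c, f (u c) = u' c) {G : W → cs.CAlgebra k u} (h : IsSplitting u G) :
    IsSplitting u' fun w => CoxeterSystem.baseChange f hu (G w) where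
  map_one := by rw [h.map_one, _root_.map_one]
  map_mul v w := by rw [← _root_.map_mul, h.map_mul]
  mul_genE w t := by
    rw [← baseChange_genE f hu, ← _root_.map_mul, h.mul_genE, _root_.map_mul, baseChange_genE]
  isUnit := by
    intro _ _
    rw [← det_baseChange_atom f hu]
    exact h.isUnit.map f

/-- Splittings lift along square-zero extensions in which the order of `W` is invertible. -/
theorem IsSplitting.exists_lift (hu : ∀ c, f (u c) = u' c) (hf : Function.Surjective f)
    (hsq : ∀ a b, f a = 0 → f b = 0 → a * b = 0) (hW : IsUnit (Nat.card W : k))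
    {G : W → cs.CAlgebra k' u'} (h : IsSplitting u' G) : ∃ G', IsSplitting u G' := by
  classical
  choose g hg using fun w => baseChange_surjective f hu hf (G w)
  have hε := cs.isAtomFamily_atom u
  have hε' := cs.isAtomFamily_atom u'
  obtain ⟨m, hm⟩ := hW.exists_left_inv
  let V : W → AddSubgroup (cs.CAlgebra k u) := fun w =>
    intertwiners (cs.genE u) fun t => cs.genE u (cs.conjRefl w t)
  -- An arbitrary lift need not permute the `e_t`. Cutting it down to the blocks from `ε_H` to `ε_{w
  -- H}` enforces this and does not change its reduction.
  let g' : W → cs.CAlgebra k u := fun w => ∑ H, cs.atom u (w • H) * g w * cs.atom u H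
  have hg'V : ∀ w, g' w ∈ V w := fun w t => by
    simp only [g']
    rw [Finset.sum_mul, Finset.mul_sum]
    refine Finset.sum_congr rfl fun H _ => ?_
    have hiff : (t : W) ∈ (H : Subgroup W) ↔ ((cs.conjRefl w t : cs.Reflection) : W) ∈
        ((w • H : cs.ReflectionSubgroups) : Subgroup W) := by
      rw [mem_smul_reflectionSubgroups]
      simp [conjRefl, mul_assoc]
    rw [mul_assoc _ _ (cs.genE u t), hε.comm, ← mul_assoc, ← mul_assoc, ← mul_assoc]
    by_cases ht : (t : W) ∈ (H : Subgroup W)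
    · rw [hε.mul_left_of_mem _ _ (hiff.1 ht), mul_assoc, hε.mul_left_of_mem _ _ ht]
    · rw [hε.mul_left_of_notMem _ _ (fun h' => ht (hiff.2 h')), mul_assoc,
        hε.mul_left_of_notMem _ _ ht, mul_zero, zero_mul, zero_mul]
  have hg'f : ∀ w, CoxeterSystem.baseChange f hu (g' w) = G w := fun w => by
    simp only [g', _root_.map_sum, _root_.map_mul, baseChange_atom, hg]
    have : ∀ H, cs.atom u' (w • H) * G w * cs.atom u' H = G w * cs.atom u' H := fun H => by
      rw [← hε'.intertwine hε' (h.mul_genE w), mul_assoc, hε'.mul_self]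
    simp only [this]
    rw [← Finset.mul_sum, hε'.sum_eq_one, mul_one]
  obtain ⟨G', hV', hfG', h1, h2⟩ := exists_multiplicative_lift (CoxeterSystem.baseChange f hu)
    (fun x y => mul_eq_zero_of_baseChange_eq_zero f hu hsq) (m := algebraMap k _ m)
    (by rw [← map_natCast (algebraMap k (cs.CAlgebra k u)), ← _root_.map_mul, hm, _root_.map_one])
    (fun x => Algebra.commutes m x) V
    (fun v w x y hx hy t => by
      rw [mul_assoc, hy t, ← mul_assoc, hx]
      change cs.genE u (cs.conjRefl v (cs.conjRefl w t)) * x * y = _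
      rw [← conjRefl_mul, mul_assoc])
    (fun w x hx t => by
      rw [mul_assoc, hx t, ← mul_assoc, ← mul_assoc, Algebra.commutes m])
    g' hg'V (by rw [hg'f, h.map_one]) (fun v w => by rw [hg'f, hg'f, hg'f, h.map_mul])
  refine ⟨G', h1, h2, hV', ?_⟩
  intro _ _
  have hd := det_baseChange_atom f hu G'
  simp only [hfG', hg'f] at hd
  obtain ⟨e, he⟩ := h.isUnit.exists_right_inv
  obtain ⟨e, rfl⟩ := hf e
  rw [← hd, ← _root_.map_mul] at he
  -- The determinant is a unit modulo a square-zero ideal, hence a unit.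
  have hn : f ((cs.standardBasis u).det (fun p => cs.atom u p.1 * G' p.2) * e - 1) = 0 := by
    rw [map_sub, he, _root_.map_one, sub_self]
  have hnil : IsNilpotent ((cs.standardBasis u).det (fun p => cs.atom u p.1 * G' p.2) * e - 1) :=
    ⟨2, by rw [pow_two]; exact hsq _ _ hn hn⟩
  have hu2 := hnil.isUnit_one_add
  rw [add_sub_cancel] at hu2
  exact isUnit_of_mul_isUnit_left hu2

end

/-! ### The ring that parametrises splittings -/

section Universal

variable (cs)
variable {P : Type*} [CommRing P] (u : cs.SimpleClass → P)

/-- The polynomial ring in the coordinates of a family indexed by `W` and the inverse of a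
determinant. -/
abbrev CoordinateRing (P : Type*) [CommRing P] : Type _ :=
  MvPolynomial (Option (W × (cs.ReflectionSubgroups × W))) P

/-- The universal family of elements of `𝒞_W(u)`. -/
noncomputable def universalFamily (w : W) :
    cs.CAlgebra (cs.CoordinateRing P) fun c => algebraMap P (cs.CoordinateRing P) (u c) :=
  (cs.standardBasis _).equivFun.symm fun p => MvPolynomial.X (some (w, p))

open Classical in
/-- The equations of the scheme of splittings. -/
noncomputable def splittingEquations [Fintype W] : Set (cs.CoordinateRing P) :=
  let b := cs.standardBasis fun c => algebraMap P (cs.CoordinateRing P) (u c)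
  let G := cs.universalFamily u
  Set.range (fun p => b.repr (G 1 - 1) p) ∪
  Set.range (fun q : (W × W) × (cs.ReflectionSubgroups × W) =>
    b.repr (G q.1.1 * G q.1.2 - G (q.1.1 * q.1.2)) q.2) ∪
  Set.range (fun q : (W × cs.Reflection) × (cs.ReflectionSubgroups × W) =>
    b.repr (G q.1.1 * cs.genE _ q.1.2 - cs.genE _ (cs.conjRefl q.1.1 q.1.2) * G q.1.1) q.2) ∪
  {b.det (fun p => cs.atom _ p.1 * G p.2) * MvPolynomial.X none - 1}

/-- The coordinate ring of the scheme of splittings. -/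
abbrev SplittingRing [Fintype W] : Type _ :=
  cs.CoordinateRing P ⧸ Ideal.span (cs.splittingEquations u)

/-- The universal splitting. By base change along it, every point of the parameter ring gives a
splitting. -/
theorem isSplitting_splittingRing [Fintype W] :
    ∃ G, IsSplitting (fun c => algebraMap P (cs.SplittingRing u) (u c)) G := by
  classical
  let f := Ideal.Quotient.mk (Ideal.span (cs.splittingEquations u))
  have hu : ∀ c, f (algebraMap P (cs.CoordinateRing P) (u c)) =
    algebraMap P (cs.SplittingRing u) (u c) := fun c => rfl
  have hf : ∀ a ∈ cs.splittingEquations u, f a = 0 := fun a ha =>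
    Ideal.Quotient.eq_zero_iff_mem.mpr (Ideal.subset_span ha)
  refine ⟨fun w => baseChange f hu (cs.universalFamily u w), ?_, fun v w => ?_, fun w t => ?_, ?_⟩
  · rw [← sub_eq_zero, ← map_one (baseChange f hu), ← map_sub, baseChange_eq_zero_iff]
    exact fun p => hf _ (.inl (.inl (.inl ⟨p, rfl⟩)))
  · rw [← sub_eq_zero, ← map_mul, ← map_sub, baseChange_eq_zero_iff]
    exact fun p => hf _ (.inl (.inl (.inr ⟨((v, w), p), rfl⟩)))
  · rw [← sub_eq_zero, ← baseChange_genE f hu, ← baseChange_genE f hu, ← map_mul, ← map_mul,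
      ← map_sub, baseChange_eq_zero_iff]
    exact fun p => hf _ (.inl (.inr ⟨((w, t), p), rfl⟩))
  · intro _ _
    rw [← det_baseChange_atom f hu]
    have h := hf _ (.inr rfl)
    rw [map_sub, map_mul, map_one, sub_eq_zero] at h
    convert! IsUnit.of_mul_eq_one _ h

variable {cs u} in
theorem IsSplitting.nonempty_algHom [Fintype W] {Q : Type*} [CommRing Q] [Algebra P Q]
    {G : W → cs.CAlgebra Q fun c => algebraMap P Q (u c)} (h : IsSplitting _ G) :
    Nonempty (cs.SplittingRing u →ₐ[P] Q) := by
  classical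
  obtain ⟨d, hd⟩ := h.isUnit.exists_right_inv
  let φ : cs.CoordinateRing P →ₐ[P] Q := MvPolynomial.aeval fun o =>
    o.elim d fun q => (cs.standardBasis _).repr (G q.1) q.2
  have hu : ∀ c, φ.toRingHom (algebraMap P (cs.CoordinateRing P) (u c)) = algebraMap P Q (u c) :=
    fun c => φ.commutes _
  have hG : ∀ w, CoxeterSystem.baseChange φ.toRingHom hu (cs.universalFamily u w) = G w :=
    fun w => by
      refine (cs.standardBasis _).ext_elem fun p => ?_
      rw [standardBasis_repr_baseChange, universalFamily, Module.Basis.equivFun_symm_apply,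
        Module.Basis.repr_sum_self]
      change φ (MvPolynomial.X _) = _
      rw [MvPolynomial.aeval_X]
      rfl
  refine ⟨Ideal.Quotient.liftₐ _ φ fun a ha => ?_⟩
  suffices hle : Ideal.span (cs.splittingEquations u) ≤ RingHom.ker φ from hle ha
  rw [Ideal.span_le]
  have hz : ∀ x p, CoxeterSystem.baseChange φ.toRingHom hu x = 0 →
      (cs.standardBasis _).repr x p ∈ RingHom.ker φ := fun x p hx =>
    (baseChange_eq_zero_iff φ.toRingHom hu).mp hx p
  rintro _ (((⟨p, rfl⟩ | ⟨⟨⟨v, w⟩, p⟩, rfl⟩) | ⟨⟨⟨w, t⟩, p⟩, rfl⟩) | rfl)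
  · exact hz _ _ (by rw [_root_.map_sub, hG, h.map_one, _root_.map_one, sub_self])
  · exact hz _ _ (by rw [_root_.map_sub, _root_.map_mul, hG, hG, hG, h.map_mul, sub_self])
  · exact hz _ _ (by
      rw [_root_.map_sub, _root_.map_mul, _root_.map_mul, baseChange_genE, baseChange_genE, hG,
        h.mul_genE, sub_self])
  · have e := det_baseChange_atom φ.toRingHom hu (cs.universalFamily u)
    simp only [hG] at e
    change φ _ = 0
    rw [_root_.map_sub, _root_.map_mul, _root_.map_one, sub_eq_zero, MvPolynomial.aeval_X]
    rw [← hd]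
    congr 1

end Universal

end Splittings

end CoxeterSystem

namespace CoxeterSystem

/-! ### Splittings for generic parameters -/

section Generic

variable {B W : Type*} [Group W] [Finite W] {M : CoxeterMatrix B} (cs : CoxeterSystem M W)

instance : Finite cs.SimpleClass :=
  Set.Finite.to_subtype ((Set.finite_range (ConjClasses.mk (α := W))).subset
    (Set.range_subset_iff.mpr fun i => ⟨cs.simple i, rfl⟩))

variable {k : Type*} [Field k]

/-- A formal splitting around `u = 1`: modulo `I` the parameters equal 1, and each step from `I ^ (n
+ 1)` to `I ^ (n + 2)` is a square-zero extension. -/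
theorem exists_isSplitting_quotient_pow (hk : (Nat.card W : k) ≠ 0) (n : ℕ) :
    ∃ G, IsSplitting (cs := cs) (fun c => algebraMap (MvPolynomial cs.SimpleClass k)
      (MvPolynomial cs.SimpleClass k ⧸
        RingHom.ker (MvPolynomial.eval fun _ : cs.SimpleClass => (1 : k)) ^ (n + 1))
      (MvPolynomial.X c)) G := by
  set I := RingHom.ker (MvPolynomial.eval fun _ : cs.SimpleClass => (1 : k)) with hI
  induction n with
  | zero =>
    refine isSplitting_one fun c => ?_
    refine Eq.trans ?_ (map_one (algebraMap (MvPolynomial cs.SimpleClass k)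
      (MvPolynomial cs.SimpleClass k ⧸ I ^ (0 + 1))))
    refine Ideal.Quotient.eq.mpr ?_
    rw [zero_add, pow_one, hI, RingHom.mem_ker]
    simp
  | succ n ih =>
    obtain ⟨G, hG⟩ := ih
    have hle : I ^ (n + 1 + 1) ≤ I ^ (n + 1) := Ideal.pow_le_pow_right (Nat.le_succ _)
    refine IsSplitting.exists_lift (Ideal.Quotient.factor hle) (fun c => rfl)
      (Ideal.Quotient.factor_surjective hle) ?_ ?_ hG
    · intro a b ha hb
      obtain ⟨a, rfl⟩ := Ideal.Quotient.mk_surjective a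
      obtain ⟨b, rfl⟩ := Ideal.Quotient.mk_surjective b
      rw [Ideal.Quotient.factor_mk, Ideal.Quotient.eq_zero_iff_mem] at ha hb
      rw [← map_mul, Ideal.Quotient.eq_zero_iff_mem]
      refine Ideal.pow_le_pow_right (m := n + 1 + 1) (n := (n + 1) + (n + 1)) (by omega) ?_
      rw [pow_add]
      exact Ideal.mul_mem_mul ha hb
    · have := (isUnit_iff_ne_zero.mpr hk).map (algebraMap k
        (MvPolynomial cs.SimpleClass k ⧸ I ^ (n + 1 + 1)))
      rwa [map_natCast] at this

/-- Away from the zero locus of a nonzero polynomial in the parameters, the algebra has a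
splitting after a finite extension of the base field. -/
theorem exists_ne_zero_forall_isSplitting (hk : (Nat.card W : k) ≠ 0) :
    ∃ D : MvPolynomial cs.SimpleClass k, D ≠ 0 ∧
      ∀ (L : Type uL) [Field L] (g : MvPolynomial cs.SimpleClass k →+* L), g D ≠ 0 →
        ∃ (L' : Type uL) (_ : Field L') (_ : Algebra L L'), FiniteDimensional L L' ∧
          ∃ G, IsSplitting (cs := cs) (fun c => algebraMap L L' (g (MvPolynomial.X c))) G := by
  classical
  cases nonempty_fintype W
  let u : cs.SimpleClass → MvPolynomial cs.SimpleClass k := MvPolynomial.X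
  set I := RingHom.ker (MvPolynomial.eval fun _ : cs.SimpleClass => (1 : k)) with hI
  have hne : I ≠ ⊤ := RingHom.ker_ne_top _
  have hfin : Algebra.FiniteType (MvPolynomial cs.SimpleClass k) (cs.SplittingRing u) :=
    Algebra.FiniteType.of_surjective (Ideal.Quotient.mkₐ _ _) Ideal.Quotient.mk_surjective
  have hfp := Algebra.FinitePresentation.of_finiteType.mp hfin
  -- The splittings over the infinitesimal neighbourhoods of `u = 1` are algebra maps out of the
  -- parametrising ring, so this ring contains the polynomial ring.
  have hinj := algebraMap_injective_of_forall_algHom (R := cs.SplittingRing u) hne fun n => by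
    obtain ⟨G, hG⟩ := cs.exists_isSplitting_quotient_pow hk n
    obtain ⟨φ⟩ := hG.nonempty_algHom (u := u)
    exact ⟨(Ideal.Quotient.factorₐ _ (Ideal.pow_le_pow_right (Nat.le_succ n))).comp φ⟩
  obtain ⟨D, hD, h⟩ := exists_ne_zero_forall_exists_lift.{uL} hinj
  refine ⟨D, hD, fun L _ g hg => ?_⟩
  obtain ⟨L', _, _, hfd, f, hf⟩ := h L g hg
  obtain ⟨G, hG⟩ := cs.isSplitting_splittingRing u
  exact ⟨L', _, _, hfd, _, hG.baseChange f fun c => RingHom.congr_fun hf (MvPolynomial.X c)⟩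

end Generic

end CoxeterSystem

/-! ### Descent of semisimplicity along field extensions -/

section Descent

/-- Take a complement `C` of the left ideal `A y` and write `1 = b y + c` with `c ∈ C`. Then `y = y
b y + y c = y c` lies in both `A y` and `C`. -/
theorem IsSemisimpleRing.eq_zero_of_forall_mul_mul_eq_zero {A : Type*} [Ring A] [IsSemisimpleRing A]
    {y : A} (hy : ∀ b, y * b * y = 0) : y = 0 := by
  obtain ⟨C, hC⟩ := exists_isCompl (Ideal.span {y})
  have h1 : (1 : A) ∈ Ideal.span {y} ⊔ C := by rw [hC.sup_eq_top]; trivial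
  obtain ⟨z, hz, c, hc, hzc⟩ := Submodule.mem_sup.mp h1
  obtain ⟨b, rfl⟩ := Ideal.mem_span_singleton'.mp hz
  have h2 : y = y * c := by
    conv_lhs => rw [← mul_one y, ← hzc, mul_add, ← mul_assoc, hy, zero_add]
  have h3 : y ∈ Ideal.span {y} ⊓ C :=
    ⟨Ideal.mem_span_singleton_self y, by rw [h2]; exact C.mul_mem_left y hc⟩
  rw [hC.inf_eq_bot] at h3
  exact h3

/-- Any nonzero element of the last nonzero power of the Jacobson radical will do. Unlike membership
in the radical, the property obtained is visibly preserved by extension of scalars. -/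
theorem IsArtinianRing.exists_forall_mul_mul_eq_zero {A : Type*} [Ring A] [IsArtinianRing A]
    (h : ¬ IsSemisimpleRing A) : ∃ y : A, y ≠ 0 ∧ ∀ b, y * b * y = 0 := by
  rw [IsArtinianRing.isSemisimpleRing_iff_jacobson] at h
  have hnil : IsNilpotent (Ring.jacobson A) := IsSemiprimaryRing.isNilpotent
  have hts : (Ring.jacobson A).IsTwoSided := inferInstance
  generalize hJ : (Ring.jacobson A : Ideal A) = J at h hnil hts
  clear hJ
  classical
  obtain ⟨n, hn, hmin⟩ : ∃ n, J ^ n = ⊥ ∧ ∀ m < n, J ^ m ≠ ⊥ :=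
    ⟨Nat.find hnil, Nat.find_spec hnil, fun m hm => Nat.find_min hnil hm⟩
  have h2 : 2 ≤ n := by
    by_contra hlt
    obtain rfl | rfl : n = 0 ∨ n = 1 := by omega
    · rw [Submodule.pow_zero, Ideal.one_eq_top] at hn
      exact h (eq_bot_iff.mpr (le_top.trans hn.le))
    · rw [Submodule.pow_one] at hn
      exact h hn
  obtain ⟨y, hy, hy0⟩ := Submodule.exists_mem_ne_zero_of_ne_bot (hmin (n - 1) (by omega))
  refine ⟨y, hy0, fun b => ?_⟩
  have h3 : y * b * y ∈ J ^ (n - 1) * J ^ (n - 1) :=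
    Ideal.mul_mem_mul (Ideal.mul_mem_right b _ hy) hy
  rw [← Ideal.IsTwoSided.pow_add] at h3
  have h4 : J ^ (n - 1 + (n - 1)) ≤ ⊥ := by
    rw [← hn]
    exact Ideal.pow_le_pow_right (by omega)
  exact h4 h3

/-- Semisimplicity descends along extensions of the base field. -/
theorem isSemisimpleRing_of_tensorProduct (L L' : Type*) {A : Type*} [Field L] [Field L']
    [Algebra L L'] [Ring A] [Algebra L A] [FiniteDimensional L A]
    [IsSemisimpleRing (L' ⊗[L] A)] : IsSemisimpleRing A := by
  have hA : IsArtinianRing A := IsArtinianRing.of_finite L A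
  by_contra h
  obtain ⟨y, hy0, hy⟩ := IsArtinianRing.exists_forall_mul_mul_eq_zero h
  have hι : Function.Injective (Algebra.TensorProduct.includeRight : A →ₐ[L] L' ⊗[L] A) :=
    Algebra.TensorProduct.includeRight_injective (algebraMap L L').injective
  apply hy0
  apply hι
  rw [map_zero]
  refine IsSemisimpleRing.eq_zero_of_forall_mul_mul_eq_zero fun b => ?_
  induction b with
  | zero => rw [mul_zero, zero_mul]
  | add b c hb hc => rw [mul_add, add_mul, hb, hc, add_zero]
  | tmul l a =>
    rw [Algebra.TensorProduct.includeRight_apply, Algebra.TensorProduct.tmul_mul_tmul,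
      Algebra.TensorProduct.tmul_mul_tmul, hy, TensorProduct.tmul_zero]

end Descent

namespace CoxeterSystem

/-! ### Consequences of a splitting over an extension field -/

section Generic

variable {B W : Type*} [Group W] [Finite W] {M : CoxeterMatrix B} {cs : CoxeterSystem M W}

/-- Over a field extension that carries a splitting, the algebra becomes the semidirect product;
in particular it is semisimple. -/
theorem IsSplitting.isSemisimpleRing_and_nonempty_algEquiv {L L' : Type*} [Field L] [Field L']
    [Algebra L L'] (hL : (Nat.card W : L') ≠ 0) {u : cs.SimpleClass → L}
    {G : W → cs.CAlgebra L' fun c => algebraMap L L' (u c)} (h : IsSplitting _ G) :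
    IsSemisimpleRing (cs.CAlgebra L u) ∧
      Nonempty ((L' ⊗[L] cs.CAlgebra L u) ≃ₐ[L'] cs.FunSemidirect L') := by
  classical
  cases nonempty_fintype W
  obtain ⟨e₁⟩ := nonempty_algEquiv_tensorProduct (k' := L') u
  obtain ⟨e₂⟩ := h.nonempty_algEquiv
  obtain ⟨e₃⟩ := cs.nonempty_algEquiv_semidirect L'
  have h1 := cs.isSemisimpleRing_one_param L' hL
  have h2 : IsSemisimpleRing (L' ⊗[L] cs.CAlgebra L u) :=
    (e₁.trans e₂).symm.toRingEquiv.isSemisimpleRing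
  have hfin : FiniteDimensional L (cs.CAlgebra L u) := .of_basis (cs.standardBasis u)
  exact ⟨isSemisimpleRing_of_tensorProduct L L', ⟨(e₁.trans e₂).trans e₃⟩⟩

end Generic

end CoxeterSystem

/-! ### Permanence of split semisimplicity -/

section SplitSemisimple

theorem IsSplitSemisimple.of_algEquiv_pi {k A ι : Type*} [Field k] [Ring A] [Algebra k A] [Finite ι]
    {m : ι → Type*} [∀ i, Fintype (m i)] [∀ i, DecidableEq (m i)] [∀ i, Nonempty (m i)]
    (e : A ≃ₐ[k] ∀ i, Matrix (m i) (m i) k) : IsSplitSemisimple k A := by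
  cases nonempty_fintype ι
  let f := Fintype.equivFin ι
  refine ⟨Fintype.card ι, fun j => Fintype.card (m (f.symm j)), fun j => Fintype.card_pos, ⟨?_⟩⟩
  exact (e.trans (AlgEquiv.piCongrLeft k (fun i => Matrix (m i) (m i) k) f.symm).symm).trans
    (AlgEquiv.piCongrRight fun j => Matrix.reindexAlgEquiv k k (Fintype.equivFin _))

theorem IsSplitSemisimple.congr {k A A' : Type*} [Field k] [Ring A] [Algebra k A] [Ring A']
    [Algebra k A'] (h : IsSplitSemisimple k A) (e : A' ≃ₐ[k] A) : IsSplitSemisimple k A' := by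
  obtain ⟨n, d, hd, ⟨f⟩⟩ := h
  exact ⟨n, d, hd, ⟨e.trans f⟩⟩

/-- The `k`-algebra isomorphism between functions on a sigma type and families of functions. -/
def AlgEquiv.piSigma (k : Type*) {ι : Type*} {κ : ι → Type*} [CommSemiring k]
    (A : (i : ι) → κ i → Type*) [∀ i j, Semiring (A i j)] [∀ i j, Algebra k (A i j)] :
    ((i : ι) → (j : κ i) → A i j) ≃ₐ[k] ((p : Σ i, κ i) → A p.1 p.2) :=
  { (Equiv.piCurry A).symm with
    map_mul' := fun _ _ => rfl
    map_add' := fun _ _ => rfl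
    commutes' := fun _ => rfl }

/-- A finite product of matrix algebras over split semisimple algebras is split semisimple. -/
theorem IsSplitSemisimple.pi_matrix {k ι : Type*} [Field k] [Finite ι] {A : ι → Type*}
    [∀ i, Ring (A i)] [∀ i, Algebra k (A i)] {m : ι → Type*} [∀ i, Fintype (m i)]
    [∀ i, DecidableEq (m i)] [∀ i, Nonempty (m i)] (h : ∀ i, IsSplitSemisimple k (A i)) :
    IsSplitSemisimple k (∀ i, Matrix (m i) (m i) (A i)) := by
  choose n d hd e using h
  have hne : ∀ p : Σ i, Fin (n i), Nonempty (m p.1 × Fin (d p.1 p.2)) := fun p =>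
    have : Nonempty (Fin (d p.1 p.2)) := ⟨⟨0, hd p.1 p.2⟩⟩
    inferInstance
  refine IsSplitSemisimple.of_algEquiv_pi (ι := Σ i, Fin (n i))
    (m := fun p => m p.1 × Fin (d p.1 p.2)) ?_
  refine (AlgEquiv.piCongrRight fun i => ?_).trans
    (AlgEquiv.piSigma k fun i (j : Fin (n i)) =>
      Matrix (m i × Fin (d i j)) (m i × Fin (d i j)) k)
  exact ((e i).some.mapMatrix.trans (Matrix.piAlgEquiv k)).trans
    (AlgEquiv.piCongrRight fun j => Matrix.compAlgEquiv (m i) (Fin (d i j)) k k)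

end SplitSemisimple

namespace CoxeterSystem

/-! ### Blocks of `𝒞_W(1)`: matrices over group algebras of normalizers -/

section Blocks

variable {B W : Type*} [Group W] {M : CoxeterMatrix B} (cs : CoxeterSystem M W)

theorem mem_normalizer_iff_smul_eq {H : cs.ReflectionSubgroups} {w : W} :
    w ∈ Subgroup.normalizer ((H : Subgroup W) : Set W) ↔ w • H = H := by
  rw [Subgroup.mem_normalizer_iff_map_conj_eq, Subtype.ext_iff]
  rfl

/-- The conjugacy classes of reflection subgroups. -/
abbrev SubgroupClass : Type _ := MulAction.orbitRel.Quotient W cs.ReflectionSubgroups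

/-- The reflection subgroups in a conjugacy class. -/
abbrev ClassFiber (o : cs.SubgroupClass) : Type _ :=
  {H : cs.ReflectionSubgroups // (Quotient.mk'' H : cs.SubgroupClass) = o}

/-- The normalizer of the representative of a conjugacy class. -/
abbrev classNormalizer (o : cs.SubgroupClass) : Subgroup W :=
  Subgroup.normalizer ((o.out : cs.ReflectionSubgroups) : Subgroup W)

theorem exists_smul_out_eq (H : cs.ReflectionSubgroups) :
    ∃ w : W, w • (Quotient.out (Quotient.mk'' H : cs.SubgroupClass)) = H := by
  have h := MulAction.orbitRel_apply.mp (Quotient.exact' (Quotient.out_eq' (Quotient.mk'' H : cs.SubgroupClass)).symm)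
  exact h

/-- An element of `W` that conjugates the representative of the class of `H` to `H`. -/
noncomputable def transporter (H : cs.ReflectionSubgroups) : W := (cs.exists_smul_out_eq H).choose

variable {cs}

theorem transporter_smul {o : cs.SubgroupClass} (y : cs.ClassFiber o) :
    cs.transporter y.1 • o.out = y.1 := by
  obtain ⟨y, rfl⟩ := y
  exact (cs.exists_smul_out_eq y).choose_spec

theorem transporter_inv_smul {o : cs.SubgroupClass} (y : cs.ClassFiber o) :
    (cs.transporter y.1)⁻¹ • y.1 = o.out := by
  rw [inv_smul_eq_iff, transporter_smul]

theorem transporter_conj_mem {o : cs.SubgroupClass} {y z : cs.ClassFiber o} {w : W}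
    (h : w • z.1 = y.1) : (cs.transporter y.1)⁻¹ * w * cs.transporter z.1 ∈ cs.classNormalizer o := by
  rw [mem_normalizer_iff_smul_eq, mul_smul, mul_smul, transporter_smul, h, transporter_inv_smul]

theorem mk_smul_eq {o : cs.SubgroupClass} (y : cs.ClassFiber o) (w : W) :
    (Quotient.mk'' (w • y.1) : cs.SubgroupClass) = o :=
  (Quotient.sound' (MulAction.orbitRel_apply.mpr ⟨w, rfl⟩)).trans y.2

variable (cs)

/-- The indices of the matrix units correspond to the pairs of a reflection subgroup and an
element of `W`. -/
noncomputable def blockIndex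
    (q : Σ o : cs.SubgroupClass, cs.ClassFiber o × cs.ClassFiber o × cs.classNormalizer o) :
    cs.ReflectionSubgroups × W :=
  (q.2.1.1, cs.transporter q.2.1.1 * q.2.2.2 * (cs.transporter q.2.2.1.1)⁻¹)

theorem blockIndex_smul {o : cs.SubgroupClass} (y z : cs.ClassFiber o)
    (h : cs.classNormalizer o) :
    (cs.transporter y.1 * h * (cs.transporter z.1)⁻¹) • z.1 = y.1 := by
  rw [mul_smul, mul_smul, transporter_inv_smul, cs.mem_normalizer_iff_smul_eq.mp h.2,
    transporter_smul]

/-- An element `w` with `w • z = y` is uniquely `τ_y h τ_z⁻¹` with `h` in the normalizer of the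
representative, where `τ` denotes the chosen transporters; and `z = w⁻¹ • y` is determined by `(y,
w)`. -/
theorem blockIndex_bijective : Function.Bijective cs.blockIndex := by
  constructor
  · rintro ⟨o, ⟨y, rfl⟩, z, h⟩ ⟨o', ⟨y', hy'⟩, z', h'⟩ he
    obtain ⟨h1, h2⟩ := Prod.ext_iff.mp he
    change y = y' at h1
    subst h1
    subst hy'
    simp only [blockIndex] at h2
    have hz : z = z' := by
      apply Subtype.ext
      have e1 := cs.blockIndex_smul ⟨y, rfl⟩ z h
      have e2 := cs.blockIndex_smul ⟨y, rfl⟩ z' h'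
      rw [← h2, ← e1] at e2
      exact (smul_left_cancel _ e2).symm
    subst hz
    rw [mul_left_inj, mul_right_inj] at h2
    rw [Subtype.ext h2]
  · rintro ⟨H, w⟩
    have h : w • (w⁻¹ • H) = H := smul_inv_smul w H
    refine ⟨⟨Quotient.mk'' H, ⟨H, rfl⟩, ⟨w⁻¹ • H, mk_smul_eq ⟨H, rfl⟩ _⟩,
      ⟨_, transporter_conj_mem (y := ⟨H, rfl⟩)
      (z := ⟨w⁻¹ • H, mk_smul_eq ⟨H, rfl⟩ _⟩) h⟩⟩, ?_⟩
    simp [blockIndex, mul_assoc]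

variable (k : Type*) [CommRing k]

/-- The product of the matrix algebras over the group algebras of the normalizers. -/
abbrev BlockAlgebra : Type _ :=
  (o : cs.SubgroupClass) → Matrix (cs.ClassFiber o) (cs.ClassFiber o)
    (MonoidAlgebra k (cs.classNormalizer o))

open Classical in
/-- The block matrices of an element of `W`. -/
noncomputable def blockG (w : W) : cs.BlockAlgebra k := fun _ => Matrix.of fun y z =>
  if h : w • z.1 = y.1 then MonoidAlgebra.single ⟨_, transporter_conj_mem h⟩ 1 else 0

variable {k} in
/-- The diagonal block matrices of a function. -/
noncomputable def blockDiag [DecidableEq cs.ReflectionSubgroups]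
    (f : cs.ReflectionSubgroups → k) : cs.BlockAlgebra k :=
  fun _ => Matrix.diagonal fun y => algebraMap k _ (f y.1)

theorem blockG_of_eq {o : cs.SubgroupClass} {y z : cs.ClassFiber o} {w : W}
    (h : w • z.1 = y.1) :
    cs.blockG k w o y z = MonoidAlgebra.single ⟨_, transporter_conj_mem h⟩ 1 := dif_pos h

theorem blockG_of_ne {o : cs.SubgroupClass} {y z : cs.ClassFiber o} {w : W}
    (h : w • z.1 ≠ y.1) : cs.blockG k w o y z = 0 := dif_neg h

variable [Finite W] [DecidableEq cs.ReflectionSubgroups]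

noncomputable instance (o : cs.SubgroupClass) : Fintype (cs.ClassFiber o) := Fintype.ofFinite _

/-- The block matrices of the elements of `W`, as a homomorphism. -/
noncomputable def blockHom : W →* cs.BlockAlgebra k where
  toFun := cs.blockG k
  map_one' := by
    funext o
    ext1 y z
    rw [Pi.one_apply, Matrix.one_apply]
    by_cases h : y = z
    · subst h
      rw [cs.blockG_of_eq k (one_smul W _), if_pos rfl, MonoidAlgebra.one_def]
      congr 1
      apply Subtype.ext
      simp
    · rw [if_neg h, cs.blockG_of_ne]
      rw [one_smul]
      exact fun h' => h (Subtype.ext h'.symm)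
  map_mul' v w := by
    funext o
    ext1 y x
    rw [Pi.mul_apply, Matrix.mul_apply]
    have hz : ∀ z, z ≠ (⟨w • x.1, mk_smul_eq x w⟩ : cs.ClassFiber o) →
        cs.blockG k v o y z * cs.blockG k w o z x = 0 := fun z hz => by
      rw [cs.blockG_of_ne k (y := z) fun h => hz (Subtype.ext h.symm), mul_zero]
    rw [Finset.sum_eq_single_of_mem _ (Finset.mem_univ _) fun z _ h => hz z h]
    rw [cs.blockG_of_eq k (y := ⟨w • x.1, mk_smul_eq x w⟩) rfl]
    by_cases h : v • w • x.1 = y.1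
    · rw [cs.blockG_of_eq k (z := ⟨w • x.1, mk_smul_eq x w⟩) h,
        cs.blockG_of_eq k (by rw [mul_smul]; exact h), MonoidAlgebra.single_mul_single, mul_one]
      congr 1
      apply Subtype.ext
      simp [mul_assoc]
    · rw [cs.blockG_of_ne k (z := ⟨w • x.1, mk_smul_eq x w⟩) h, zero_mul, cs.blockG_of_ne]
      rwa [mul_smul]

/-- The diagonal block matrices, as a homomorphism. -/
noncomputable def blockDiagHom : cs.FunReflectionSubgroups k →+* cs.BlockAlgebra k where
  toFun := cs.blockDiag
  map_one' := by
    funext o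
    simp [blockDiag]
    rfl
  map_zero' := by
    funext o
    simp [blockDiag]
  map_mul' f g := by
    funext o
    simp [blockDiag]
  map_add' f g := by
    funext o
    simp [blockDiag]

variable {k}

theorem blockG_mul_blockDiag (w : W) (f : cs.FunReflectionSubgroups k) :
    cs.blockG k w * cs.blockDiag f = cs.blockDiag (w • f) * cs.blockG k w := by
  funext o
  ext1 y z
  rw [Pi.mul_apply, Pi.mul_apply, blockDiag, blockDiag, Matrix.mul_diagonal, Matrix.diagonal_mul,
    smul_funReflectionSubgroups_apply]
  by_cases h : w • z.1 = y.1
  · rw [← h, inv_smul_smul, Algebra.commutes]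
  · rw [cs.blockG_of_ne k h, zero_mul, mul_zero]

variable (k)

theorem satisfiesRelations_block : cs.SatisfiesRelations (fun _ => (1 : k))
    (fun i => cs.blockHom k (cs.simple i)) (fun t => cs.blockDiagHom k (cs.memFun k t)) :=
  satisfiesRelations_of_monoidHom _
    (fun t => by rw [← map_mul, memFun_mul_self])
    (fun t t' => by rw [← map_mul, ← map_mul, mul_comm])
    (fun t t₁ => by rw [← map_mul, ← map_mul, memFun_mul_conj])
    (fun w t => by
      rw [← smul_memFun]
      exact cs.blockG_mul_blockDiag w _)

variable {k} in
theorem blockDiag_apply (f : cs.ReflectionSubgroups → k) (X : cs.BlockAlgebra k)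
    (o : cs.SubgroupClass) (y z : cs.ClassFiber o) :
    (cs.blockDiag f * X) o y z = algebraMap k _ (f y.1) * X o y z := by
  rw [Pi.mul_apply, blockDiag, Matrix.diagonal_mul]

/-- The basis of the block algebra that consists of the matrix units with entries in the
normalizers. -/
noncomputable def blockBasis [Fintype cs.SubgroupClass] : Module.Basis
    (Σ o : cs.SubgroupClass, cs.ClassFiber o × cs.ClassFiber o × cs.classNormalizer o) k
    (cs.BlockAlgebra k) :=
  Pi.basis fun o => Module.Basis.matrix (cs.ClassFiber o) (cs.ClassFiber o)
    (MonoidAlgebra.basis (cs.classNormalizer o) k)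

/-- The function `δ_y` selects row `y` in the matrices of `w`. As `w` acts as a monomial matrix, one
matrix unit with a normalizer element as entry remains. -/
theorem blockDiag_mul_blockG [Fintype cs.SubgroupClass]
    (q : Σ o : cs.SubgroupClass, cs.ClassFiber o × cs.ClassFiber o × cs.classNormalizer o) :
    cs.blockDiag (Pi.single (cs.blockIndex q).1 (1 : k)) * cs.blockG k (cs.blockIndex q).2 =
      cs.blockBasis k q := by
  classical
  obtain ⟨o, y, z, h⟩ := q
  rw [blockBasis, Pi.basis_apply, Module.Basis.matrix_apply, MonoidAlgebra.basis_apply]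
  funext o'
  ext1 y' z'
  rw [blockDiag_apply]
  simp only [blockIndex]
  by_cases ho : o' = o
  · subst ho
    rw [Pi.single_eq_same, Matrix.single_apply]
    by_cases hy : y = y'
    · subst hy
      rw [Pi.single_eq_same, map_one, one_mul]
      by_cases hz : z = z'
      · subst hz
        rw [cs.blockG_of_eq k (cs.blockIndex_smul y z h), if_pos ⟨rfl, rfl⟩]
        congr 1
        apply Subtype.ext
        simp [mul_assoc]
      · rw [if_neg fun h' => hz h'.2, cs.blockG_of_ne]
        intro e
        exact hz (Subtype.ext (smul_left_cancel _ (e.trans (cs.blockIndex_smul y z h).symm)).symm)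
    · rw [if_neg fun h' => hy h'.1, Pi.single_eq_of_ne, map_zero, zero_mul]
      exact fun e => hy (Subtype.ext e.symm)
  · rw [Pi.single_eq_of_ne ho, Pi.single_eq_of_ne, map_zero, zero_mul, Matrix.zero_apply]
    exact fun e => ho (by rw [← y'.2, e, y.2])

theorem nonempty_algEquiv_block :
    Nonempty (cs.CAlgebra k (fun _ => 1) ≃ₐ[k] cs.BlockAlgebra k) := by
  classical
  cases nonempty_fintype cs.SubgroupClass
  set φ := (cs.satisfiesRelations_block k).lift
  have hat := (cs.isAtomFamily_memFun k).map (cs.blockDiagHom k)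
  let e := Equiv.ofBijective _ cs.blockIndex_bijective
  have h : φ.toLinearMap = ((cs.standardBasis fun _ => (1 : k)).equiv (cs.blockBasis k)
      e.symm).toLinearMap := by
    refine (cs.standardBasis fun _ => (1 : k)).ext fun p => ?_
    obtain ⟨q, rfl⟩ := e.surjective p
    rw [LinearEquiv.coe_coe, Module.Basis.equiv_apply, Equiv.symm_apply_apply,
      AlgHom.toLinearMap_apply, standardBasis_apply, map_mul, lift_atom _ hat,
      lift_basisG_of_monoidHom, ← blockDiag_mul_blockG]
    congr!
  refine ⟨AlgEquiv.ofBijective φ ?_⟩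
  have h' : (φ : cs.CAlgebra k (fun _ => 1) → cs.BlockAlgebra k) =
      (cs.standardBasis fun _ => (1 : k)).equiv (cs.blockBasis k) e.symm :=
    congrArg DFunLike.coe h
  rw [h']
  exact LinearEquiv.bijective _

end Blocks

end CoxeterSystem

/-! ### Assembly of the main theorem -/

theorem mainTheorem2 {B : Type uB} {W : Type uW} [Group W] [Finite W] {M : CoxeterMatrix B}
    (cs : CoxeterSystem M W) :
    -- over every commutative ring, `𝒞_W(1) ≃ k^𝒲 ⋊ kW`
    (∀ (k : Type uk) [CommRing k],
      Nonempty (cs.CAlgebra k (fun _ => 1) ≃ₐ[k] cs.FunSemidirect k)) ∧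
    ∀ (k : Type uk) [Field k],
      -- `𝒞_W(1)` is semisimple if the characteristic does not divide `|W|`
      (¬ ringChar k ∣ Nat.card W → IsSemisimpleRing (cs.CAlgebra k (fun _ => 1))) ∧
      -- characteristic `0`, indeterminate parameters: over the field of rational functions `k(u)`,
      -- the algebra is semisimple and becomes isomorphic to `K'^𝒲 ⋊ K'W` over a finite
      -- extension `K'` of `k(u)`
      (ringChar k = 0 →
        IsSemisimpleRing (cs.CAlgebra (cs.GenericField k) (cs.genericParam k)) ∧
        ∃ (K' : Type (max uk uW)) (_ : Field K') (_ : Algebra (cs.GenericField k) K'),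
          FiniteDimensional (cs.GenericField k) K' ∧
          Nonempty ((K' ⊗[cs.GenericField k]
            cs.CAlgebra (cs.GenericField k) (cs.genericParam k)) ≃ₐ[K'] cs.FunSemidirect K')) ∧
      -- characteristic `0`, generic values of the parameters: outside the zero locus of a nonzero
      -- polynomial the same holds, for parameters in `k` or in any field extension `L` of `k`
      (ringChar k = 0 →
        ∃ D : MvPolynomial cs.SimpleClass k, D ≠ 0 ∧
          ∀ (L : Type uL) [Field L] [Algebra k L] (u : cs.SimpleClass → L),
            MvPolynomial.aeval u D ≠ 0 →
            IsSemisimpleRing (cs.CAlgebra L u) ∧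
            ∃ (L' : Type uL) (_ : Field L') (_ : Algebra L L'), FiniteDimensional L L' ∧
              Nonempty ((L' ⊗[L] cs.CAlgebra L u) ≃ₐ[L'] cs.FunSemidirect L')) ∧
      -- `𝒞_W(1)` is split semisimple if `k N_W(W₀)` is, for every reflection subgroup `W₀`
      ((∀ W₀ : cs.ReflectionSubgroups, IsSplitSemisimple k
          (MonoidAlgebra k (Subgroup.normalizer ((W₀ : Subgroup W) : Set W)))) →
        IsSplitSemisimple k (cs.CAlgebra k (fun _ => 1))) := by
  classical
  refine ⟨fun k _ => cs.nonempty_algEquiv_semidirect k, fun k _ => ⟨fun hk => ?_, fun hk => ?_,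
    fun hk => ?_, fun h => ?_⟩⟩
  · exact cs.isSemisimpleRing_one_param k fun h => hk (ringChar.dvd h)
  · have : CharP k 0 := ringChar.eq_iff.mp hk
    have : CharZero k := CharP.charP_to_charZero k
    have hW : (Nat.card W : k) ≠ 0 := Nat.cast_ne_zero.mpr Nat.card_pos.ne'
    obtain ⟨D, hD, h⟩ := cs.exists_ne_zero_forall_isSplitting.{max uk uW} hW
    -- The field of rational functions is the generic point of the parameter space, where the
    -- nonzero polynomial `D` does not vanish.
    obtain ⟨K', _, _, hfin, G, hG⟩ := h (cs.GenericField k) (algebraMap _ _) fun h0 =>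
      hD ((map_eq_zero_iff _ (IsFractionRing.injective _ _)).mp h0)
    obtain ⟨h1, h2⟩ := hG.isSemisimpleRing_and_nonempty_algEquiv (u := cs.genericParam k) (by
      rw [← map_natCast ((algebraMap (cs.GenericField k) K').comp (algebraMap k _))]
      exact (map_ne_zero _).mpr hW)
    exact ⟨h1, K', _, _, hfin, h2⟩
  · have : CharP k 0 := ringChar.eq_iff.mp hk
    have : CharZero k := CharP.charP_to_charZero k
    have hW : (Nat.card W : k) ≠ 0 := Nat.cast_ne_zero.mpr Nat.card_pos.ne'
    obtain ⟨D, hD, h⟩ := cs.exists_ne_zero_forall_isSplitting.{uL} hW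
    refine ⟨D, hD, fun L _ _ u hu => ?_⟩
    obtain ⟨L', _, _, hfin, G, hG⟩ := h L (MvPolynomial.aeval u).toRingHom hu
    have hX : (fun c => (MvPolynomial.aeval u).toRingHom (MvPolynomial.X c : MvPolynomial _ k)) =
        u := funext fun c => MvPolynomial.aeval_X u c
    obtain ⟨h1, h2⟩ := hG.isSemisimpleRing_and_nonempty_algEquiv (by
      rw [← map_natCast ((algebraMap L L').comp (algebraMap k L))]
      exact (map_ne_zero _).mpr hW)
    rw [hX] at h1 h2
    exact ⟨h1, L', _, _, hfin, h2⟩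
  · obtain ⟨e⟩ := cs.nonempty_algEquiv_block k
    have hne : ∀ o, Nonempty (cs.ClassFiber o) := fun o => ⟨⟨o.out, Quotient.out_eq' o⟩⟩
    exact (IsSplitSemisimple.pi_matrix fun o => h _).congr e
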